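/- A subordinator is a nondecreasing Lévy process with values in $[0,\infty)$ (started at $0$, independent and stationary increments, almost surely càdlàg nondecreasing paths). For a subordinator $\sigma$ define its local time (right-continuous inverse) $L(x)=\inf\{s\ge 0:\sigma(s)>x\}$, $x\ge 0$, and its closed range $R=\overline{\{\sigma(s):s\ge 0\}}$. Let $\mathfrak F([0,\infty))$ be the space of closed subsets of $[0,\infty)$ with the Fell topology and its Borel $\sigma$-field, and let $D[0,t]$ be the space of real-valued càdlàg functions on $[0,t]$ with the topology of uniform convergence and the $\sigma$-field generated by the evaluations. Since the latter $\sigma$-field is smaller than the Borel $\sigma$-field of the uniform topology, weak convergence $X_n\Rightarrow X$ in the product space means, as usual, that $X_n$ and $X$ are random elements for the product $\sigma$-field and $\mathbb E f(X_n)\to\mathbb E f(X)$ for every bounded real function $f$ which is continuous for the product topology and measurable for the product $\sigma$-field. **Proposition.** Let $\sigma$ and $\sigma_n$, $n\in\mathbb N$, be subordinators, with $\sigma$ strictly increasing on $[0,\infty)$ almost surely. Let $V$ and $V_n$, $n\in\mathbb N$, be nonnegative random variables such that $\sigma_n$ is independent of $V_n$ for each $n$ and $\sigma$ is independent of $V$.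 Let $L,L_n$ be the local times and $R,R_n$ the closed ranges of $\sigma,\sigma_n$. If $\sigma_n(1)\to\sigma(1)$ and $V_n\to V$ in distribution as $n\to\infty$, then for all $t,y>0$ $$\Bigl((V_n+\sigma_n(s))_{s\in[0,t]},\ (L_n((x-V_n)_+))_{x\in[0,y]},\ V_n+R_n\Bigr)\Rightarrow\Bigl((V+\sigma(s))_{s\in[0,t]},\ (L((x-V)_+))_{x\in[0,y]},\ V+R\Bigr)$$ weakly in $D[0,t]\times D[0,y]\times\mathfrak F([0,\infty))$. In particular, $$\Bigl((\sigma_n(s))_{s\in[0,t]},\ (L_n(x))_{x\in[0,y]},\ R_n\Bigr)\Rightarrow\Bigl((\sigma(s))_{s\in[0,t]},\ (L(x))_{x\in[0,y]},\ R\Bigr)$$ weakly in $D[0,t]\times D[0,y]\times\mathfrak F([0,\infty))$. (Finitely many $\sigma_n$ may vanish identically; for these $L_n$ is set to $0$.) -/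

import Mathlib

open MeasureTheory ProbabilityTheory Filter Topology Set
open scoped NNReal BoundedContinuousFunction

/-! ### Càdlàg functions and the space `D[0,t]` -/

/-- A real-valued function is càdlàg: right-continuous with (finite) left limits. -/
def IsCadlag {T : Type*} [TopologicalSpace T] [Preorder T] (g : T → ℝ) : Prop :=
  ∀ x, ContinuousWithinAt g (Ici x) x ∧ ∃ l : ℝ, Tendsto g (𝓝[<] x) (𝓝 l)

theorem isCadlag_zero {T : Type*} [TopologicalSpace T] [Preorder T] :
    IsCadlag (fun _ : T => (0 : ℝ)) :=
  fun _ => ⟨continuousWithinAt_const, 0, tendsto_const_nhds⟩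

/-- The space `D[0,t]` of real-valued càdlàg functions on the interval `[0,t]`. -/
structure CadlagSpace (t : ℝ≥0) where
  /-- the underlying function -/
  toFun : Icc (0 : ℝ≥0) t → ℝ
  isCadlag : IsCadlag toFun

namespace CadlagSpace

/-- `D[0,t]` carries the topology of uniform convergence. -/
instance instTopologicalSpace (t : ℝ≥0) : TopologicalSpace (CadlagSpace t) :=
  TopologicalSpace.induced (fun g : CadlagSpace t => UniformFun.ofFun g.toFun) inferInstance

/-- `D[0,t]` carries its usual σ-field, generated by the evaluations `g ↦ g s`, `s ∈ [0,t]`.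
It is also the σ-field generated by the balls of the uniform distance. -/
instance instMeasurableSpace (t : ℝ≥0) : MeasurableSpace (CadlagSpace t) :=
  MeasurableSpace.comap CadlagSpace.toFun MeasurableSpace.pi

open Classical in
/-- The restriction to `[0,t]` of a path `g : [0,∞) → ℝ`, as an element of `D[0,t]`. If the
restriction is not càdlàg (for the processes below: only on null sets), the value is the zero
function. -/
noncomputable def ofPath (t : ℝ≥0) (g : ℝ≥0 → ℝ) : CadlagSpace t :=
  if h : IsCadlag (fun s : Icc (0 : ℝ≥0) t => g s) then ⟨fun s => g s, h⟩
  else ⟨fun _ => 0, isCadlag_zero⟩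

end CadlagSpace

/-! ### Closed sets with the Fell topology -/

/-- The space of all closed subsets of `X` (the empty set included); a type synonym that carries
the Fell topology. -/
def FellCloseds (X : Type*) [TopologicalSpace X] : Type _ := TopologicalSpace.Closeds X

namespace FellCloseds

/-- The Fell topology, generated by the sets `{F : F ∩ K = ∅}`, `K` compact, and
`{F : F ∩ G ≠ ∅}`, `G` open. -/
instance instTopologicalSpace (X : Type*) [TopologicalSpace X] :
    TopologicalSpace (FellCloseds X) :=
  TopologicalSpace.generateFrom
    ({U | ∃ K : Set X, IsCompact K ∧
        U = {F : TopologicalSpace.Closeds X | (F : Set X) ∩ K = ∅}} ∪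
     {U | ∃ G : Set X, IsOpen G ∧
        U = {F : TopologicalSpace.Closeds X | ((F : Set X) ∩ G).Nonempty}})

/-- The Borel σ-field of the Fell topology. -/
instance instMeasurableSpace (X : Type*) [TopologicalSpace X] :
    MeasurableSpace (FellCloseds X) :=
  borel (FellCloseds X)

end FellCloseds

/-! ### Weak convergence -/

/-- Weak convergence `X n ⇒ Y` of random elements of a space `E` that carries a topology and a
σ-field, where the σ-field may be smaller than the Borel σ-field (as for `D[0,t]` with the uniform
topology and the σ-field generated by the evaluations): the `X n` and `Y` are random elements, and
`𝔼 f(X n) → 𝔼 f(Y)` for every bounded continuous function `f : E → ℝ` that is measurable. -/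
structure WeaklyConverges {E : Type*} [TopologicalSpace E] [MeasurableSpace E]
    {Ω : ℕ → Type*} {Ω' : Type*} [∀ n, MeasurableSpace (Ω n)] [MeasurableSpace Ω']
    (X : (n : ℕ) → Ω n → E) (P : (n : ℕ) → Measure (Ω n)) (Y : Ω' → E) (P' : Measure Ω') :
    Prop where
  aemeasurable_seq : ∀ n, AEMeasurable (X n) (P n)
  aemeasurable_lim : AEMeasurable Y P'
  tendsto_integral : ∀ f : E →ᵇ ℝ, Measurable f →
    Tendsto (fun n => ∫ ω, f (X n ω) ∂(P n)) atTop (𝓝 (∫ ω, f (Y ω) ∂P'))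

/-! ### Subordinators, local times, ranges -/

/-- A subordinator: a nondecreasing Lévy process with values in `[0,∞)`, i.e. a process that starts
at `0`, has independent and stationary increments, and whose paths are almost surely nondecreasing
and càdlàg. -/
structure IsSubordinator {Ω : Type*} [MeasurableSpace Ω] (σ : ℝ≥0 → Ω → ℝ≥0) (P : Measure Ω) :
    Prop where
  measurable : ∀ t, Measurable (σ t)
  zero : ∀ᵐ ω ∂P, σ 0 ω = 0
  indep_increments : HasIndepIncrements (fun t ω => (σ t ω : ℝ)) P
  stationary_increments : ∀ s t : ℝ≥0,
    IdentDistrib (fun ω => (σ (s + t) ω : ℝ) - (σ s ω : ℝ)) (fun ω => (σ t ω : ℝ)) P P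
  monotone : ∀ᵐ ω ∂P, Monotone (fun t => σ t ω)
  cadlag : ∀ᵐ ω ∂P, IsCadlag (fun t => (σ t ω : ℝ))

/-- The local time (right-continuous inverse) of a path `g`: `L(x) = inf {t ≥ 0 : g t > x}`.
The infimum of the empty set is `0` here; for a subordinator that is not identically `0` the set is
almost surely nonempty for all `x`. -/
noncomputable def localTime (g : ℝ≥0 → ℝ≥0) (x : ℝ≥0) : ℝ≥0 :=
  sInf {t : ℝ≥0 | g t > x}

theorem isClosed_shiftedRange (v : ℝ≥0) (g : ℝ≥0 → ℝ≥0) :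
    IsClosed ((fun r => v + r) '' closure (range g)) := by
  have h : Isometry (fun r : ℝ≥0 => v + r) := by
    refine Isometry.of_dist_eq fun a b => ?_
    simp [NNReal.dist_eq]
  exact h.isClosedEmbedding.isClosedMap _ isClosed_closure

/-- The shifted closed range `v + R` of a path `g`, where `R` is the closure of `{g t : t ≥ 0}`. -/
def shiftedRange (v : ℝ≥0) (g : ℝ≥0 → ℝ≥0) : FellCloseds ℝ≥0 :=
  (⟨(fun r => v + r) '' closure (range g), isClosed_shiftedRange v g⟩ :
    TopologicalSpace.Closeds ℝ≥0)

/-- For a path `g` and a shift `v`, the triple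
`((v + g s)_{s ∈ [0,t]}, (L((x - v)₊))_{x ∈ [0,y]}, v + R)` in `D[0,t] × D[0,y] × 𝔉([0,∞))`,
where `L` and `R` are the local time and the closed range of `g`. Subtraction in `ℝ≥0` is
truncated at `0`, so that `x - v` is the positive part `(x - v)₊`. -/
noncomputable def shiftedTriple (t y v : ℝ≥0) (g : ℝ≥0 → ℝ≥0) :
    CadlagSpace t × CadlagSpace y × FellCloseds ℝ≥0 :=
  (CadlagSpace.ofPath t (fun s => (v : ℝ) + (g s : ℝ)),
   CadlagSpace.ofPath y (fun x => (localTime g (x - v) : ℝ)),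
   shiftedRange v g)

/-- For a path `g`, the triple `((g s)_{s ∈ [0,t]}, (L(x))_{x ∈ [0,y]}, R)` in
`D[0,t] × D[0,y] × 𝔉([0,∞))`. -/
noncomputable def triple (t y : ℝ≥0) (g : ℝ≥0 → ℝ≥0) :
    CadlagSpace t × CadlagSpace y × FellCloseds ℝ≥0 :=
  (CadlagSpace.ofPath t (fun s => (g s : ℝ)),
   CadlagSpace.ofPath y (fun x => (localTime g x : ℝ)),
   (⟨closure (range g), isClosed_closure⟩ : TopologicalSpace.Closeds ℝ≥0))

/-! ### Càdlàg functions and local times -/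

/-! The triple depends continuously on the shift and the path at every strictly increasing,
unbounded path, if paths carry locally uniform convergence (`tendsto_shiftedTriple`): strictness
makes the inverse stable under perturbation, and unboundedness means that only a bounded time
interval matters for a bounded set of levels. So it suffices to realize the processes on one
probability space with almost surely converging shifts and locally uniformly converging paths. By
the subsequence principle this is needed only along some subsequence of each given subsequence.

For the coupling, all subordinators are driven by the same unit Poisson process on the quadrant: a
point `(u, h)` makes a jump at time `u` whose size is a nonincreasing function of `h`, and a drift
is added. Everything is written for `exp (-σ)`, which is bounded: jumps become factors `ζ h` in
`[0,1]`, and since laws on cubes are determined by moments, only the exponents `Φ k = d k + ∫ (1 - ζ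
^ k)` at integers `k` are needed. The key is a compactness statement, `exists_subseq_levyExponent`:
if the exponents converge, Helly's theorem yields an almost everywhere limit of the monotone
profiles, and the part of `Φ 1` that the limit profile does not carry is its drift. Applied to
compound Poisson approximations it gives the Lévy–Khintchine representation; applied to the given
sequence it gives converging profiles. Uniqueness of the representation is not needed: any pair with
the right exponent reproduces the law.

Path convergence is `tendsto_lintegral_iSup_levyZ`. Heights up to `H` contribute in mean at most the
integrated difference of the profiles. Heights above `H` give jumps of order `1 / H`; their variance
is small, so together with the drift they are close to a deterministic exponential, whose rate is
controlled by `Φ 1`. The drifts themselves need not converge.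

Laws are transferred to the coupling through rational times: up to null sets the triple is a
measurable function `pathTriple` of countably many coordinates. The shifts are coupled independently
of the Poisson process, by quantile functions. -/

theorem Monotone.isCadlag {T : Type*} [TopologicalSpace T] [LinearOrder T] [OrderTopology T]
    {g : T → ℝ} (hg : Monotone g) (hr : ∀ x, ContinuousWithinAt g (Ici x) x) : IsCadlag g :=
  fun x => ⟨hr x, _, hg.tendsto_nhdsLT x⟩

namespace CadlagSpace

theorem ofPath_toFun {t : ℝ≥0} {g : ℝ≥0 → ℝ} (h : IsCadlag (fun s : Icc (0 : ℝ≥0) t => g s)) :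
    (ofPath t g).toFun = fun s : Icc (0 : ℝ≥0) t => g s := by
  rw [ofPath, dif_pos h]

theorem tendsto_iff {ι : Type*} {l : Filter ι} {t : ℝ≥0} {f : ι → CadlagSpace t}
    {g : CadlagSpace t} :
    Tendsto f l (𝓝 g) ↔ TendstoUniformly (fun i => (f i).toFun) g.toFun l := by
  rw [nhds_induced, tendsto_comap_iff, UniformFun.tendsto_iff_tendstoUniformly]
  rfl

theorem measurable_iff {Ω : Type*} [MeasurableSpace Ω] {t : ℝ≥0} {f : Ω → CadlagSpace t} :
    Measurable f ↔ ∀ s, Measurable fun ω => (f ω).toFun s := by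
  rw [measurable_comap_iff, measurable_pi_iff]
  rfl

end CadlagSpace

/-! ### Continuity of the right-continuous inverse -/

section LocalTime

variable {g : ℝ≥0 → ℝ≥0} {x s : ℝ≥0}

theorem localTime_le (h : x < g s) : localTime g x ≤ s :=
  csInf_le (OrderBot.bddBelow _) h

theorem le_localTime (hg : Monotone g) (hne : ∃ T, x < g T) (h : g s ≤ x) :
    s ≤ localTime g x := by
  refine le_csInf hne fun r hr => ?_
  by_contra! hlt
  exact absurd (hg hlt.le) (not_le.2 (h.trans_lt hr))

theorem exists_lt_of_localTime_lt {b : ℝ≥0} (hne : ∃ T, x < g T) (h : localTime g x < b) :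
    ∃ s < b, x < g s := by
  obtain ⟨s, hs, hsb⟩ := exists_lt_of_csInf_lt hne h
  exact ⟨s, hsb, hs⟩

theorem localTime_mono {x' : ℝ≥0} (hne : ∃ T, x' < g T) (h : x ≤ x') :
    localTime g x ≤ localTime g x' :=
  csInf_le_csInf (OrderBot.bddBelow _) hne fun _ hs => h.trans_lt hs

theorem continuousWithinAt_localTime (hne : ∃ T, x < g T) :
    ContinuousWithinAt (localTime g) (Ici x) x := by
  refine tendsto_order.2 ⟨fun a ha => ?_, fun b hb => ?_⟩
  · obtain ⟨T, hT⟩ := hne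
    filter_upwards [self_mem_nhdsWithin, mem_nhdsWithin_of_mem_nhds (Iio_mem_nhds hT)]
      with x' h1 h2 using ha.trans_le (localTime_mono ⟨T, h2⟩ h1)
  · obtain ⟨s, hsb, hs⟩ := exists_lt_of_localTime_lt hne hb
    filter_upwards [mem_nhdsWithin_of_mem_nhds (Iio_mem_nhds hs)] with x' h2
      using (localTime_le h2).trans_lt hsb

/-- Local times at converging levels converge if the paths converge pointwise to a strictly
increasing path. -/
theorem tendsto_localTime {ι : Type*} {l : Filter ι} {gs : ι → ℝ≥0 → ℝ≥0} {u : ι → ℝ≥0}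
    (hgs : ∀ i, Monotone (gs i)) (hg : StrictMono g) (hne : ∃ T, x < g T)
    (hconv : ∀ s, Tendsto (fun i => gs i s) l (𝓝 (g s))) (hu : Tendsto u l (𝓝 x)) :
    Tendsto (fun i => localTime (gs i) (u i)) l (𝓝 (localTime g x)) := by
  refine tendsto_order.2 ⟨fun a ha => ?_, fun b hb => ?_⟩
  · obtain ⟨s, has, hs⟩ := exists_between ha
    -- A second time `s'` below the local time gives `g s < g s' ≤ x`. This strict inequality, due
    -- to strict monotonicity, survives the passage to the limit.
    obtain ⟨s', hss', hs'⟩ := exists_between hs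
    have h1 : g s' ≤ x := by
      by_contra! h
      exact absurd (localTime_le h) (not_le.2 hs')
    obtain ⟨T, hT⟩ := hne
    filter_upwards [(hconv s).eventually_lt hu ((hg hss').trans_le h1),
      hu.eventually_lt (hconv T) hT] with i h2 h3
    exact has.trans_le (le_localTime (hgs i) ⟨T, h3⟩ h2.le)
  · obtain ⟨s, hsb, hs⟩ := exists_lt_of_localTime_lt hne hb
    filter_upwards [hu.eventually_lt (hconv s) hs] with i h2
      using (localTime_le h2).trans_lt hsb

end LocalTime

section Paths

variable {g : ℝ≥0 → ℝ≥0} {v : ℝ≥0}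

theorem isCadlag_shift (t : ℝ≥0) (hg : Monotone g)
    (hr : ∀ x, ContinuousWithinAt g (Ici x) x) :
    IsCadlag (fun s : Icc (0 : ℝ≥0) t => (v : ℝ) + (g s : ℝ)) := by
  refine Monotone.isCadlag (fun a b hab => ?_) fun x => ?_
  · have := hg (show (a : ℝ≥0) ≤ b from hab)
    gcongr
  · refine continuousWithinAt_const.add ?_
    refine NNReal.continuous_coe.continuousAt.comp_continuousWithinAt ?_
    exact (hr x).comp (f := fun s : Icc (0 : ℝ≥0) t => (s : ℝ≥0))
      continuous_subtype_val.continuousWithinAt fun _ h => h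

theorem isCadlag_localTime (y : ℝ≥0) (hne : ∃ T, y < g T) :
    IsCadlag (fun x : Icc (0 : ℝ≥0) y => (localTime g (x - v) : ℝ)) := by
  have hne' : ∀ x : Icc (0 : ℝ≥0) y, ∃ T, (x : ℝ≥0) - v < g T := fun x =>
    hne.imp fun T hT => (tsub_le_self.trans x.2.2).trans_lt hT
  refine Monotone.isCadlag (fun a b hab => ?_) fun x => ?_
  · exact_mod_cast localTime_mono (hne' b) (tsub_le_tsub_right (show (a : ℝ≥0) ≤ b from hab) v)
  · refine NNReal.continuous_coe.continuousAt.comp_continuousWithinAt ?_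
    refine (continuousWithinAt_localTime (hne' x)).comp
      (f := fun s : Icc (0 : ℝ≥0) y => (s : ℝ≥0) - v) ?_ fun a h => ?_
    · exact (continuous_subtype_val.sub continuous_const).continuousWithinAt
    · exact tsub_le_tsub_right (show (x : ℝ≥0) ≤ a from h) v

end Paths

/-! ### Convergence of the triple of a path -/

section Convergence

variable {ι : Type*} {l : Filter ι} {v : ι → ℝ≥0} {v₀ : ℝ≥0} {gs : ι → ℝ≥0 → ℝ≥0}
  {g : ℝ≥0 → ℝ≥0}

theorem tendsto_ofPath_shift (t : ℝ≥0) (hv : Tendsto v l (𝓝 v₀)) (hgs : ∀ i, Monotone (gs i))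
    (hgsr : ∀ i x, ContinuousWithinAt (gs i) (Ici x) x) (hg : Monotone g)
    (hgr : ∀ x, ContinuousWithinAt g (Ici x) x)
    (hconv : ∀ T : ℝ≥0, TendstoUniformlyOn gs g l (Iic T)) :
    Tendsto (fun i => CadlagSpace.ofPath t (fun s => (v i : ℝ) + (gs i s : ℝ))) l
      (𝓝 (CadlagSpace.ofPath t (fun s => (v₀ : ℝ) + (g s : ℝ)))) := by
  rw [CadlagSpace.tendsto_iff]
  rw [CadlagSpace.ofPath_toFun (g := fun s => (v₀ : ℝ) + (g s : ℝ)) (isCadlag_shift t hg hgr),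
    funext fun i => CadlagSpace.ofPath_toFun (g := fun s => (v i : ℝ) + (gs i s : ℝ))
      (isCadlag_shift t (hgs i) (hgsr i))]
  rw [Metric.tendstoUniformly_iff]
  intro ε hε
  filter_upwards [Metric.tendsto_nhds.1 hv (ε / 2) (half_pos hε),
    Metric.tendstoUniformlyOn_iff.1 (hconv t) (ε / 2) (half_pos hε)] with i h1 h2 s
  have h3 := h2 s s.2.2
  rw [dist_comm, NNReal.dist_eq] at h1
  rw [NNReal.dist_eq] at h3
  rw [Real.dist_eq, add_sub_add_comm]
  exact (abs_add_le _ _).trans_lt (by linarith)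

theorem tendsto_ofPath_localTime (y : ℝ≥0) (hv : Tendsto v l (𝓝 v₀))
    (hgs : ∀ i, Monotone (gs i)) (hg : StrictMono g) (hunb : ∀ x, ∃ T, x < g T)
    (hconv : ∀ s, Tendsto (fun i => gs i s) l (𝓝 (g s))) :
    Tendsto (fun i => CadlagSpace.ofPath y (fun x => (localTime (gs i) (x - v i) : ℝ))) l
      (𝓝 (CadlagSpace.ofPath y (fun x => (localTime g (x - v₀) : ℝ)))) := by
  rw [CadlagSpace.tendsto_iff, CadlagSpace.ofPath_toFun (g := fun x => (localTime g (x - v₀) : ℝ))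
    (isCadlag_localTime y (hunb y))]
  have key : TendstoUniformly (fun i (x : Icc (0 : ℝ≥0) y) => (localTime (gs i) (x - v i) : ℝ))
      (fun x => (localTime g (x - v₀) : ℝ)) l := by
    -- On a compact interval, uniform convergence follows from continuous convergence at each point,
    -- that is, along jointly varying index and level. Both the limit and the approximants are
    -- covered by `tendsto_localTime`.
    rw [← tendstoLocallyUniformly_iff_tendstoUniformly_of_compactSpace,
      tendstoLocallyUniformly_iff_forall_tendsto]
    intro x
    refine Tendsto.mono_right (Tendsto.prodMk_nhds (x := (localTime g (x - v₀) : ℝ))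
      (y := (localTime g (x - v₀) : ℝ)) ?_ ?_) (nhds_le_uniformity _)
    · refine (NNReal.continuous_coe.tendsto _).comp ?_
      refine tendsto_localTime (gs := fun _ => g) (fun _ => hg.monotone) hg (hunb _)
        (fun _ => tendsto_const_nhds) ?_
      exact ((continuous_subtype_val.tendsto x).comp tendsto_snd).sub tendsto_const_nhds
    · refine (NNReal.continuous_coe.tendsto _).comp ?_
      refine tendsto_localTime (gs := fun p : ι × Icc (0 : ℝ≥0) y => gs p.1)
        (fun _ => hgs _) hg (hunb _) (fun s => (hconv s).comp tendsto_fst) ?_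
      exact ((continuous_subtype_val.tendsto x).comp tendsto_snd).sub (hv.comp tendsto_fst)
  obtain ⟨T, hT⟩ := hunb y
  intro u hu
  -- Some approximating paths may stay below `y`, where `ofPath` may take its default value;
  -- eventually they exceed `y` at time `T`.
  filter_upwards [key u hu, (hconv T).eventually_const_lt hT] with i h1 hi
  rwa [CadlagSpace.ofPath_toFun (g := fun x => (localTime (gs i) (x - v i) : ℝ))
    (isCadlag_localTime y ⟨T, hi⟩)]

/-- An open set that meets a closure meets the set itself, so limit points of the range need no
separate treatment. -/
theorem mem_shiftedRange_of_isOpen {v : ℝ≥0} {g : ℝ≥0 → ℝ≥0} {G : Set ℝ≥0} (hG : IsOpen G) :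
    (((fun r => v + r) '' closure (range g)) ∩ G).Nonempty ↔ ∃ s, v + g s ∈ G := by
  constructor
  · rintro ⟨_, ⟨r, hr, rfl⟩, hrG⟩
    have hopen : IsOpen ((fun r => v + r) ⁻¹' G) := hG.preimage (by fun_prop)
    obtain ⟨_, h1, s, rfl⟩ := mem_closure_iff.1 hr _ hopen hrG
    exact ⟨s, h1⟩
  · rintro ⟨s, hs⟩
    exact ⟨_, ⟨g s, subset_closure ⟨s, rfl⟩, rfl⟩, hs⟩

theorem tendsto_shiftedRange (hv : Tendsto v l (𝓝 v₀))
    (hgs : ∀ i, Monotone (gs i)) (hunb : ∀ x, ∃ T, x < g T)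
    (hconv : ∀ T : ℝ≥0, TendstoUniformlyOn gs g l (Iic T)) :
    Tendsto (fun i => shiftedRange (v i) (gs i)) l (𝓝 (shiftedRange v₀ g)) := by
  have hpt : ∀ s, Tendsto (fun i => gs i s) l (𝓝 (g s)) := fun s =>
    (hconv s).tendsto_at self_mem_Iic
  refine TopologicalSpace.tendsto_nhds_generateFrom_iff.2 ?_
  rintro U (⟨K, hK, rfl⟩ | ⟨G, hG, rfl⟩) hU
  · change ((fun r => v₀ + r) '' closure (range g)) ∩ K = ∅ at hU
    have hd : Disjoint K ((fun r => v₀ + r) '' closure (range g)) := by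
      rw [disjoint_comm, disjoint_iff_inter_eq_empty, hU]
    obtain ⟨δ, hδ, hdisj⟩ := hd.exists_thickenings hK (isClosed_shiftedRange v₀ g)
    obtain ⟨M, hM⟩ := hK.bddAbove
    -- Once a path is above `M + 1`, it stays at distance more than `1` from `K`, since shifts are
    -- nonnegative. So only times up to `T` can bring it close to `K`.
    obtain ⟨T, hT⟩ := hunb (M + 1)
    filter_upwards [Metric.tendsto_nhds.1 hv (δ / 2) (half_pos hδ),
      Metric.tendstoUniformlyOn_iff.1 (hconv T) (δ / 2) (half_pos hδ),
      (hpt T).eventually_const_lt hT] with i h1 h2 h3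
    change ((fun r => v i + r) '' closure (range (gs i))) ∩ K = ∅
    by_contra hne
    -- Passing to an open neighbourhood of `K` yields an actual value of the path in it. The bound
    -- `δ` serves times before `T`, the bound `1` times after.
    have hopen : IsOpen (Metric.thickening (min δ 1) K) := Metric.isOpen_thickening
    obtain ⟨s, hs⟩ := (mem_shiftedRange_of_isOpen hopen).1 ((nonempty_iff_ne_empty.2 hne).mono
      (inter_subset_inter_right _ (Metric.self_subset_thickening (by positivity) K)))
    rcases le_total s T with hsT | hsT
    · refine disjoint_left.1 hdisj (Metric.thickening_mono (min_le_left _ _) _ hs) ?_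
      refine Metric.mem_thickening_iff.2 ⟨v₀ + g s, ⟨_, subset_closure ⟨s, rfl⟩, rfl⟩, ?_⟩
      have h4 := h2 s hsT
      rw [dist_comm] at h4
      rw [NNReal.dist_eq, abs_lt] at h1 h4 ⊢
      push_cast
      constructor <;> linarith
    · obtain ⟨k, hk, hdist⟩ := Metric.mem_thickening_iff.1
        (Metric.thickening_mono (min_le_right _ _) _ hs)
      have h5 : M + 1 < v i + gs i s := (h3.trans_le (hgs i hsT)).trans_le le_add_self
      have h6 : (M : ℝ) + 1 < ((v i + gs i s : ℝ≥0) : ℝ) := by exact_mod_cast h5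
      have h7 : (k : ℝ) ≤ M := by exact_mod_cast hM hk
      rw [NNReal.dist_eq] at hdist
      linarith [le_abs_self (((v i + gs i s : ℝ≥0) : ℝ) - k)]
  · obtain ⟨s, hs⟩ := (mem_shiftedRange_of_isOpen hG).1 hU
    filter_upwards [(hv.add (hpt s)).eventually (hG.mem_nhds hs)] with i hi
    exact (mem_shiftedRange_of_isOpen hG).2 ⟨s, hi⟩

theorem tendsto_shiftedTriple (t y : ℝ≥0) (hv : Tendsto v l (𝓝 v₀)) (hgs : ∀ i, Monotone (gs i))
    (hgsr : ∀ i x, ContinuousWithinAt (gs i) (Ici x) x) (hg : StrictMono g)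
    (hgr : ∀ x, ContinuousWithinAt g (Ici x) x) (hunb : ∀ x, ∃ T, x < g T)
    (hconv : ∀ T : ℝ≥0, TendstoUniformlyOn gs g l (Iic T)) :
    Tendsto (fun i => shiftedTriple t y (v i) (gs i)) l (𝓝 (shiftedTriple t y v₀ g)) :=
  (tendsto_ofPath_shift t hv hgs hgsr hg.monotone hgr hconv).prodMk_nhds
    ((tendsto_ofPath_localTime y hv hgs hg hunb fun s =>
      (hconv s).tendsto_at self_mem_Iic).prodMk_nhds (tendsto_shiftedRange hv hgs hunb hconv))

end Convergence

/-! ### Measurability of the triple of a path -/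

/-! ### The Borel σ-field of the Fell topology is generated by hitting events -/

namespace FellCloseds

variable {X : Type*} [TopologicalSpace X] [SecondCountableTopology X] [LocallyCompactSpace X]
  [T2Space X]

/-- A compact set disjoint from a closed set is covered by finitely many basic open sets with
compact closures disjoint from that closed set. -/
theorem exists_finite_basis_cover {K F : Set X} (hK : IsCompact K) (hF : IsClosed F)
    (h : F ∩ K = ∅) :
    ∃ s : Set (Set X), s.Finite ∧ s ⊆ TopologicalSpace.countableBasis X ∧ K ⊆ ⋃₀ s ∧
      IsCompact (⋃ b ∈ s, closure b) ∧ F ∩ (⋃ b ∈ s, closure b) = ∅ := by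
  have hB := TopologicalSpace.isBasis_countableBasis X
  have hx : ∀ x ∈ K, ∃ b ∈ TopologicalSpace.countableBasis X, x ∈ b ∧ IsCompact (closure b) ∧
      closure b ⊆ Fᶜ := by
    intro x hxK
    have hxF : Fᶜ ∈ 𝓝 x := hF.isOpen_compl.mem_nhds fun hxF =>
      (h ▸ (⟨hxF, hxK⟩ : x ∈ F ∩ K) : x ∈ (∅ : Set X))
    obtain ⟨N, hN, hNF, hNc⟩ := local_compact_nhds hxF
    obtain ⟨b, hb, hxb, hbN⟩ := hB.mem_nhds_iff.1 hN
    have hcl : closure b ⊆ N := closure_minimal hbN hNc.isClosed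
    exact ⟨b, hb, hxb, hNc.of_isClosed_subset isClosed_closure hcl, hcl.trans hNF⟩
  choose! b hb hxb hbc hbF using hx
  obtain ⟨t, htK, hKt⟩ := hK.elim_nhds_subcover b fun x hx =>
    (hB.isOpen (hb x hx)).mem_nhds (hxb x hx)
  refine ⟨b '' t, t.finite_toSet.image b, ?_, ?_, ?_, ?_⟩
  · rintro _ ⟨x, hx, rfl⟩
    exact hb x (htK x hx)
  · simpa [sUnion_image] using hKt
  · rw [biUnion_image]
    exact t.finite_toSet.isCompact_biUnion fun x hx => hbc x (htK x hx)
  · rw [biUnion_image, eq_empty_iff_forall_notMem]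
    rintro z ⟨hzF, hz⟩
    obtain ⟨x, hx, hzx⟩ := mem_iUnion₂.1 hz
    exact hbF x (htK x hx) hzx hzF

/-- The Fell topology has a countable subbasis. -/
theorem eq_generateFrom_countable :
    instTopologicalSpace X = TopologicalSpace.generateFrom
      ({U | ∃ s : Set (Set X), (s.Finite ∧ s ⊆ TopologicalSpace.countableBasis X) ∧
          IsCompact (⋃ b ∈ s, closure b) ∧
          {F : TopologicalSpace.Closeds X | (F : Set X) ∩ (⋃ b ∈ s, closure b) = ∅} = U} ∪
        {U | ∃ G ∈ TopologicalSpace.countableBasis X,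
          {F : TopologicalSpace.Closeds X | ((F : Set X) ∩ G).Nonempty} = U}) := by
  have hB := TopologicalSpace.isBasis_countableBasis X
  refine le_antisymm (le_generateFrom ?_) (le_generateFrom ?_)
  · rintro U (⟨s, -, hc, rfl⟩ | ⟨G, hG, rfl⟩)
    · exact .basic _ (.inl ⟨_, hc, rfl⟩)
    · exact .basic _ (.inr ⟨G, hB.isOpen hG, rfl⟩)
  · rintro U (⟨K, hK, rfl⟩ | ⟨G, hG, rfl⟩)
    · refine (@isOpen_iff_forall_mem_open _ (TopologicalSpace.generateFrom _) _).2 fun F hF => ?_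
      obtain ⟨s, hs, hsB, hKs, hc, hFs⟩ := exists_finite_basis_cover hK F.isClosed hF
      refine ⟨_, fun F' hF' => ?_, .basic _ (.inl ⟨s, ⟨hs, hsB⟩, hc, rfl⟩), hFs⟩
      refine subset_empty_iff.1 (subset_trans ?_ (subset_of_eq hF'))
      refine inter_subset_inter_right _ (hKs.trans ?_)
      rw [sUnion_eq_biUnion]
      exact iUnion₂_mono fun b _ => subset_closure
    · refine (@isOpen_iff_forall_mem_open _ (TopologicalSpace.generateFrom _) _).2 fun F hF => ?_
      obtain ⟨x, hxF, hxG⟩ := hF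
      obtain ⟨b, hb, hxb, hbG⟩ := hB.exists_subset_of_mem_open hxG hG
      exact ⟨_, fun F' hF' => Nonempty.mono (inter_subset_inter_right _ hbG) hF',
        .basic _ (.inr ⟨b, hb, rfl⟩), ⟨x, hxF, hxb⟩⟩

/-- A closed set misses a compact set if and only if it misses some finite union of basic open sets
that covers the compact set. There are countably many such unions, so the missing events are also
measurable. -/
theorem measurable_of_forall_isOpen {Ω : Type*} [MeasurableSpace Ω] {f : Ω → FellCloseds X}
    (h : ∀ G : Set X, IsOpen G → MeasurableSet
      {ω | (TopologicalSpace.Closeds.carrier (f ω) ∩ G).Nonempty}) :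
    Measurable f := by
  have hcount : ({U | ∃ s : Set (Set X), (s.Finite ∧ s ⊆ TopologicalSpace.countableBasis X) ∧
          IsCompact (⋃ b ∈ s, closure b) ∧
          {F : TopologicalSpace.Closeds X | (F : Set X) ∩ (⋃ b ∈ s, closure b) = ∅} = U} ∪
        {U | ∃ G ∈ TopologicalSpace.countableBasis X,
          {F : TopologicalSpace.Closeds X | ((F : Set X) ∩ G).Nonempty} = U}).Countable := by
    have hc := TopologicalSpace.countable_countableBasis X
    refine Countable.union ?_ (hc.image _)
    refine ((Set.countable_ofPred_finite_subset hc).image fun s =>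
      {F : TopologicalSpace.Closeds X | (F : Set X) ∩ (⋃ b ∈ s, closure b) = ∅}).mono ?_
    rintro U ⟨s, hs, -, rfl⟩
    exact ⟨s, hs, rfl⟩
  have : SecondCountableTopology (FellCloseds X) := ⟨_, hcount, eq_generateFrom_countable⟩
  have hgen := borel_eq_generateFrom_of_subbasis (eq_generateFrom_countable (X := X))
  change @Measurable _ _ _ (borel (FellCloseds X)) f
  rw [hgen]
  refine measurable_generateFrom ?_
  rintro U (⟨s, -, hc, rfl⟩ | ⟨G, hG, rfl⟩)
  · have heq : f ⁻¹' {F : TopologicalSpace.Closeds X |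
        (F : Set X) ∩ (⋃ b ∈ s, closure b) = ∅} =
        ⋃ s' ∈ {s' : Set (Set X) | (s'.Finite ∧ s' ⊆ TopologicalSpace.countableBasis X) ∧
          (⋃ b ∈ s, closure b) ⊆ ⋃₀ s'},
          {ω | (TopologicalSpace.Closeds.carrier (f ω) ∩ ⋃₀ s').Nonempty}ᶜ := by
      ext ω
      simp only [mem_iUnion, exists_prop]
      constructor
      · intro hω
        obtain ⟨s', hs', hsB, hCs, -, hFs⟩ :=
          exists_finite_basis_cover hc (TopologicalSpace.Closeds.isClosed (f ω)) hω
        refine ⟨s', ⟨⟨hs', hsB⟩, hCs⟩, fun hne => ?_⟩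
        refine (hne.mono ?_).ne_empty hFs
        refine inter_subset_inter_right _ ?_
        rw [sUnion_eq_biUnion]
        exact iUnion₂_mono fun b _ => subset_closure
      · rintro ⟨s', ⟨-, hCs⟩, hne⟩
        refine subset_empty_iff.1 (subset_trans ?_
          (subset_of_eq (not_nonempty_iff_eq_empty.1 hne)))
        exact inter_subset_inter_right _ hCs
    refine (congrArg MeasurableSet heq).mpr ?_
    refine MeasurableSet.biUnion ?_ fun s' hs' => (h _ ?_).compl
    · exact (Set.countable_ofPred_finite_subset
        (TopologicalSpace.countable_countableBasis X)).mono fun _ hs' => hs'.1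
    · exact isOpen_sUnion fun b hb =>
        (TopologicalSpace.isBasis_countableBasis X).isOpen (hs'.1.2 hb)
  · exact h G ((TopologicalSpace.isBasis_countableBasis X).isOpen hG)

end FellCloseds

/-! ### Measurability of local times, ranges and triples -/

section Measurability

variable {Ω : Type*} [MeasurableSpace Ω] {v x : Ω → ℝ≥0} {g : Ω → ℝ≥0 → ℝ≥0}

theorem exists_nnrat_between {a b : ℝ≥0} (h : a < b) : ∃ q : ℚ≥0, a < q ∧ (q : ℝ≥0) < b := by
  obtain ⟨q, hq0, h1, h2⟩ := (NNReal.lt_iff_exists_rat_btwn a b).1 h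
  lift q to ℚ≥0 using hq0
  refine ⟨q, ?_, ?_⟩
  · have h1' : (a : ℝ) < q := by simpa using NNReal.coe_lt_coe.2 h1
    exact_mod_cast h1'
  · have h2' : (q : ℝ) < b :=
      (show (q : ℝ) < b ∧ 0 < b by simpa using NNReal.coe_lt_coe.2 h2).1
    exact_mod_cast h2'

/-- Monotonicity reduces the infimum to rational times. The second alternative is the convention
`sInf ∅ = 0` for a level that is never exceeded. -/
theorem localTime_lt_iff {g : ℝ≥0 → ℝ≥0} (hg : Monotone g) (x b : ℝ≥0) :
    localTime g x < b ↔
      (∃ q : ℚ≥0, (q : ℝ≥0) < b ∧ x < g q) ∨ (0 < b ∧ ∀ n : ℕ, g n ≤ x) := by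
  by_cases hne : ∃ T, x < g T
  · constructor
    · intro h
      obtain ⟨s, hsb, hs⟩ := exists_lt_of_localTime_lt hne h
      obtain ⟨q, hq, hqb⟩ := exists_nnrat_between hsb
      exact .inl ⟨q, hqb, hs.trans_le (hg hq.le)⟩
    · rintro (⟨q, hqb, hq⟩ | ⟨-, hn⟩)
      · exact (localTime_le hq).trans_lt hqb
      · obtain ⟨T, hT⟩ := hne
        obtain ⟨n, hn'⟩ := exists_nat_ge T
        exact absurd (hn n) (not_le.2 (hT.trans_le (hg hn')))
  · push Not at hne
    have h0 : localTime g x = 0 := by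
      have : {t : ℝ≥0 | g t > x} = ∅ := eq_empty_iff_forall_notMem.2 fun t ht =>
        absurd (hne t) (not_le.2 ht)
      rw [localTime, this, NNReal.sInf_empty]
    rw [h0]
    constructor
    · exact fun h => .inr ⟨h, fun n => hne n⟩
    · rintro (⟨q, -, hq⟩ | ⟨h, -⟩)
      · exact absurd (hne q) (not_le.2 hq)
      · exact h

theorem measurable_localTime (hx : Measurable x) (hg : ∀ s, Measurable fun ω => g ω s)
    (hm : ∀ ω, Monotone (g ω)) : Measurable fun ω => localTime (g ω) (x ω) := by
  refine measurable_of_Iio fun b => ?_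
  have : (fun ω => localTime (g ω) (x ω)) ⁻¹' Iio b =
      (⋃ q : ℚ≥0, ({ω | (q : ℝ≥0) < b} ∩ {ω | x ω < g ω q})) ∪
        ({ω | 0 < b} ∩ ⋂ n : ℕ, {ω | g ω n ≤ x ω}) := by
    ext ω
    simp [localTime_lt_iff (hm ω)]
  rw [this]
  refine (MeasurableSet.iUnion fun q => ?_).union
    ((MeasurableSet.const _).inter (MeasurableSet.iInter fun n => measurableSet_le (hg _) hx))
  exact (MeasurableSet.const _).inter (measurableSet_lt hx (hg _))

theorem mem_range_isOpen_iff {g : ℝ≥0 → ℝ≥0} (hr : ∀ x, ContinuousWithinAt g (Ici x) x)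
    (v : ℝ≥0) {G : Set ℝ≥0} (hG : IsOpen G) :
    (∃ s, v + g s ∈ G) ↔ ∃ q : ℚ≥0, v + g q ∈ G := by
  refine ⟨fun ⟨s, hs⟩ => ?_, fun ⟨q, hq⟩ => ⟨q, hq⟩⟩
  have h1 : ∀ᶠ r in 𝓝[≥] s, v + g r ∈ G :=
    ((continuousWithinAt_const.add (hr s)).eventually (hG.mem_nhds hs))
  obtain ⟨u, hu, hsub⟩ := mem_nhdsGE_iff_exists_Ico_subset.1 h1
  obtain ⟨q, hq, hqu⟩ := exists_nnrat_between (show s < u from hu)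
  exact ⟨q, hsub ⟨hq.le, hqu⟩⟩

/-- The dichotomy `hz` keeps `ofPath` out of its default branch: the local time is càdlàg if the
path is unbounded, and it vanishes by convention if the path does. -/
theorem measurable_shiftedTriple (t y : ℝ≥0) (hv : Measurable v)
    (hg : ∀ s, Measurable fun ω => g ω s) (hm : ∀ ω, Monotone (g ω))
    (hr : ∀ ω x, ContinuousWithinAt (g ω) (Ici x) x)
    (hz : ∀ ω, (∀ x, ∃ T, x < g ω T) ∨ ∀ s, g ω s = 0) :
    Measurable fun ω => shiftedTriple t y (v ω) (g ω) := by
  refine Measurable.prodMk ?_ (Measurable.prodMk ?_ ?_)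
  · refine CadlagSpace.measurable_iff.2 fun s => ?_
    have : ∀ ω, (CadlagSpace.ofPath t (fun s => (v ω : ℝ) + (g ω s : ℝ))).toFun s =
        (v ω : ℝ) + (g ω s : ℝ) := fun ω => by
      rw [CadlagSpace.ofPath_toFun (g := fun s => (v ω : ℝ) + (g ω s : ℝ))
        (isCadlag_shift t (hm ω) (hr ω))]
    simp_rw [this]
    exact hv.coe_nnreal_real.add (hg s).coe_nnreal_real
  · refine CadlagSpace.measurable_iff.2 fun s => ?_
    have : ∀ ω, (CadlagSpace.ofPath y (fun x => (localTime (g ω) (x - v ω) : ℝ))).toFun s =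
        (localTime (g ω) (s - v ω) : ℝ) := fun ω => by
      rw [CadlagSpace.ofPath_toFun (g := fun x => (localTime (g ω) (x - v ω) : ℝ))]
      rcases hz ω with h | h
      · exact isCadlag_localTime y (h y)
      · have : ∀ x, localTime (g ω) x = 0 := fun x => by simp [localTime, h]
        simp only [this, NNReal.coe_zero]
        exact isCadlag_zero
    simp_rw [this]
    exact (measurable_localTime (measurable_const.sub hv) hg hm).coe_nnreal_real
  · refine FellCloseds.measurable_of_forall_isOpen fun G hG => ?_
    have : {ω | (TopologicalSpace.Closeds.carrier (shiftedRange (v ω) (g ω)) ∩ G).Nonempty} =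
        ⋃ q : ℚ≥0, (fun ω => v ω + g ω q) ⁻¹' G := by
      ext ω
      rw [mem_iUnion]
      exact (mem_shiftedRange_of_isOpen hG).trans (mem_range_isOpen_iff (hr ω) _ hG)
    rw [this]
    exact MeasurableSet.iUnion fun q => (hv.add (hg q)) hG.measurableSet

end Measurability

/-! ### Right-continuous regularization -/

/-- The right-continuous regularization of a function on the nonnegative rationals. -/
noncomputable def rightReg (g : ℚ≥0 → ℝ≥0) (s : ℝ≥0) : ℝ≥0 :=
  ⨅ q : {q : ℚ≥0 // s < q}, g q

section RightReg

variable {g g' : ℚ≥0 → ℝ≥0}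

instance (s : ℝ≥0) : Nonempty {q : ℚ≥0 // s < (q : ℝ≥0)} := by
  obtain ⟨q, hq, -⟩ := exists_nnrat_between (lt_add_one s)
  exact ⟨⟨q, hq⟩⟩

theorem rightReg_le {s : ℝ≥0} {q : ℚ≥0} (h : s < q) : rightReg g s ≤ g q :=
  ciInf_le (OrderBot.bddBelow _) (⟨q, h⟩ : {q : ℚ≥0 // s < (q : ℝ≥0)})

theorem le_rightReg (hg : Monotone g) {s : ℝ≥0} {q : ℚ≥0} (h : (q : ℝ≥0) ≤ s) :
    g q ≤ rightReg g s :=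
  le_ciInf fun r => hg (by exact_mod_cast (h.trans r.2.le))

theorem rightReg_mono (g : ℚ≥0 → ℝ≥0) : Monotone (rightReg g) := fun _ _ h =>
  le_ciInf fun r => rightReg_le (h.trans_lt r.2)

theorem rightReg_rightCont (g : ℚ≥0 → ℝ≥0) (x : ℝ≥0) :
    ContinuousWithinAt (rightReg g) (Ici x) x := by
  refine tendsto_order.2 ⟨fun a ha => ?_, fun b hb => ?_⟩
  · filter_upwards [self_mem_nhdsWithin] with x' h1 using ha.trans_le (rightReg_mono g h1)
  · obtain ⟨q, hq⟩ := exists_lt_of_ciInf_lt hb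
    filter_upwards [mem_nhdsWithin_of_mem_nhds (Iio_mem_nhds q.2)] with x' h2
      using (rightReg_le h2).trans_lt hq

/-- Right-continuity lets a path be recovered from its rational values, so that the law at rational
times determines the law of the triple. -/
theorem rightReg_eq {h : ℝ≥0 → ℝ≥0} (hm : Monotone h)
    (hr : ∀ x, ContinuousWithinAt h (Ici x) x) : rightReg (fun q => h q) = h := by
  funext s
  refine le_antisymm ?_ (le_ciInf fun r => hm r.2.le)
  refine le_of_forall_gt fun b hb => ?_
  obtain ⟨u, hu, hsub⟩ := mem_nhdsGE_iff_exists_Ico_subset.1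
    ((hr s).eventually (Iio_mem_nhds hb))
  obtain ⟨q, hq, hqu⟩ := exists_nnrat_between (show s < u from hu)
  exact (rightReg_le (g := fun q : ℚ≥0 => h q) hq).trans_lt (hsub ⟨hq.le, hqu⟩)

theorem rightReg_strictMono (hg : StrictMono g) : StrictMono (rightReg g) := by
  intro a b hab
  obtain ⟨q, haq, hqb⟩ := exists_nnrat_between hab
  obtain ⟨r, hqr, hrb⟩ := exists_nnrat_between hqb
  exact (rightReg_le haq).trans_lt ((hg (by exact_mod_cast hqr)).trans_le
    (le_rightReg hg.monotone hrb.le))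

theorem measurable_rightReg {Ω : Type*} [MeasurableSpace Ω] {g : Ω → ℚ≥0 → ℝ≥0}
    (hg : ∀ q, Measurable fun ω => g ω q) (s : ℝ≥0) : Measurable fun ω => rightReg (g ω) s :=
  Measurable.iInf fun q => hg q

theorem rightReg_tendstoUniformlyOn {ι : Type*} {l : Filter ι} {gs : ι → ℚ≥0 → ℝ≥0}
    (T : ℝ≥0) (hgs : ∀ i, Monotone (gs i)) (hg : Monotone g)
    (h : TendstoUniformlyOn gs g l {q | (q : ℝ≥0) ≤ T + 1}) :
    TendstoUniformlyOn (fun i => rightReg (gs i)) (rightReg g) l (Iic T) := by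
  rw [Metric.tendstoUniformlyOn_iff] at h ⊢
  have key : ∀ (f f' : ℚ≥0 → ℝ≥0) (ε : ℝ), Monotone f' → (∀ q : ℚ≥0, (q : ℝ≥0) ≤ T + 1 →
      dist (f q) (f' q) < ε) → ∀ s ≤ T, (rightReg f s : ℝ) ≤ rightReg f' s + ε := by
    intro f f' ε hf' hε s hs
    have hε0 : 0 ≤ ε := dist_nonneg.trans (hε 0 (by simp)).le
    lift ε to ℝ≥0 using hε0
    norm_cast
    refine le_of_forall_pos_le_add fun δ hδ => ?_
    obtain ⟨q, hq⟩ := exists_lt_of_ciInf_lt (lt_add_of_pos_right (rightReg f' s) hδ)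
    -- The near-minimizer `q` for `f'` may lie beyond `T + 1`, where nothing is known; `min q r` is
    -- still above `s`, and monotonicity keeps it near-minimizing.
    obtain ⟨r, hsr, hrT⟩ := exists_nnrat_between (hs.trans_lt (lt_add_one T))
    have hsm : s < ((min (q : ℚ≥0) r : ℚ≥0) : ℝ≥0) := by
      rw [NNRat.cast_min]
      exact lt_min q.2 hsr
    have hmT : ((min (q : ℚ≥0) r : ℚ≥0) : ℝ≥0) ≤ T + 1 := by
      rw [NNRat.cast_min]
      exact (min_le_right _ _).trans hrT.le
    have h1 := hε _ hmT
    rw [NNReal.dist_eq] at h1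
    have h2 : f (min q r) ≤ f' (min q r) + ε := by
      rw [← NNReal.coe_le_coe]
      push_cast
      linarith [le_abs_self ((f (min q r) : ℝ) - f' (min q r))]
    calc rightReg f s ≤ f (min q r) := rightReg_le hsm
      _ ≤ f' (min q r) + ε := h2
      _ ≤ f' q + ε := by gcongr; exact hf' (min_le_left _ _)
      _ ≤ rightReg f' s + δ + ε := by gcongr
      _ = rightReg f' s + ε + δ := by ring
  intro ε hε
  filter_upwards [h (ε / 2) (half_pos hε)] with i hi s hs
  rw [NNReal.dist_eq, abs_sub_lt_iff]
  have h1 := key _ _ _ (hgs i) hi s hs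
  have h2 := key _ _ _ hg (fun q hq => by rw [dist_comm]; exact hi q hq) s hs
  constructor <;> linarith

end RightReg

/-! ### Products over the points of a Poisson process

A Poisson process with intensity `Measure.sum ρ`, where the `ρ j` are probability measures, is
realized by independent cells: the `j`-th cell holds a Poisson number of independent points with
law `ρ j`. -/

section PoissonProduct

variable {E : Type*} [MeasurableSpace E]

/-- The product of `F` over the points of a cell. -/
def cellProd (F : E → ℝ) (c : ℕ × (ℕ → E)) : ℝ := ∏ i ∈ Finset.range c.1, F (c.2 i)

/-- The sum of `f` over the points of a cell. -/
noncomputable def cellSum (f : E → ENNReal) (c : ℕ × (ℕ → E)) : ENNReal :=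
  ∑ i ∈ Finset.range c.1, f (c.2 i)

/-- The law of a cell with a unit Poisson number of independent points with law `ρ`. -/
noncomputable def cellMeasure (ρ : Measure E) [IsProbabilityMeasure ρ] : Measure (ℕ × (ℕ → E)) :=
  (poissonMeasure 1).prod (Measure.infinitePi fun _ : ℕ => ρ)

instance (ρ : Measure E) [IsProbabilityMeasure ρ] : IsProbabilityMeasure (cellMeasure ρ) := by
  unfold cellMeasure; infer_instance

theorem measurable_cellProd {F : E → ℝ} (hF : Measurable F) : Measurable (cellProd F) := by
  refine measurable_from_prod_countable_right fun n => ?_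
  exact Finset.measurable_fun_prod (Finset.range n)
    fun i _ => hF.comp (measurable_pi_apply (X := fun _ : ℕ => E) i)

theorem measurable_cellSum {f : E → ENNReal} (hf : Measurable f) : Measurable (cellSum f) := by
  refine measurable_from_prod_countable_right fun n => ?_
  exact Finset.measurable_fun_sum (Finset.range n)
    fun i _ => hf.comp (measurable_pi_apply (X := fun _ : ℕ => E) i)

theorem cellProd_nonneg {F : E → ℝ} (h0 : ∀ x, 0 ≤ F x) (c : ℕ × (ℕ → E)) : 0 ≤ cellProd F c :=
  Finset.prod_nonneg fun _ _ => h0 _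

theorem cellProd_le_one {F : E → ℝ} (h0 : ∀ x, 0 ≤ F x) (h1 : ∀ x, F x ≤ 1)
    (c : ℕ × (ℕ → E)) : cellProd F c ≤ 1 :=
  Finset.prod_le_one (fun _ _ => h0 _) fun _ _ => h1 _

theorem abs_prod_sub_prod_le {ι : Type*} (s : Finset ι) {a b : ι → ℝ}
    (ha0 : ∀ i, 0 ≤ a i) (ha1 : ∀ i, a i ≤ 1) (hb0 : ∀ i, 0 ≤ b i) (hb1 : ∀ i, b i ≤ 1) :
    |∏ i ∈ s, a i - ∏ i ∈ s, b i| ≤ ∑ i ∈ s, |a i - b i| := by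
  classical
  induction s using Finset.induction_on with
  | empty => simp
  | insert i s hi ih =>
    rw [Finset.prod_insert hi, Finset.prod_insert hi, Finset.sum_insert hi]
    have hA0 : 0 ≤ ∏ i ∈ s, a i := Finset.prod_nonneg fun i _ => ha0 i
    have hA1 : ∏ i ∈ s, a i ≤ 1 := Finset.prod_le_one (fun i _ => ha0 i) fun i _ => ha1 i
    calc |a i * ∏ i ∈ s, a i - b i * ∏ i ∈ s, b i|
        = |(a i - b i) * ∏ i ∈ s, a i + b i * (∏ i ∈ s, a i - ∏ i ∈ s, b i)| := by ring_nf
      _ ≤ |(a i - b i) * ∏ i ∈ s, a i| + |b i * (∏ i ∈ s, a i - ∏ i ∈ s, b i)| := abs_add_le _ _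
      _ ≤ |a i - b i| + ∑ i ∈ s, |a i - b i| := by
        rw [abs_mul, abs_mul, abs_of_nonneg hA0, abs_of_nonneg (hb0 i)]
        gcongr
        · exact mul_le_of_le_one_right (abs_nonneg _) hA1
        · exact (mul_le_of_le_one_left (abs_nonneg _) (hb1 i)).trans ih

/-- Given the number `n` of points, independence gives the mean `(∫ F) ^ n`; the generating function
of the unit Poisson law at `a = ∫ F` is `exp (a - 1)`. -/
theorem integral_cellProd (ρ : Measure E) [IsProbabilityMeasure ρ] {F : E → ℝ}
    (hF : Measurable F) (h0 : ∀ x, 0 ≤ F x) (h1 : ∀ x, F x ≤ 1) :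
    ∫ c, cellProd F c ∂(cellMeasure ρ) = Real.exp (-∫ x, (1 - F x) ∂ρ) := by
  have hFint : Integrable F ρ := .of_bound hF.aestronglyMeasurable 1 (.of_forall fun x => by
    rw [Real.norm_of_nonneg (h0 x)]; exact h1 x)
  have hint : Integrable (cellProd F) (cellMeasure ρ) :=
    .of_bound (measurable_cellProd hF).aestronglyMeasurable 1 (.of_forall fun c => by
      rw [Real.norm_of_nonneg (cellProd_nonneg h0 c)]; exact cellProd_le_one h0 h1 c)
  rw [cellMeasure] at hint ⊢
  rw [integral_prod _ hint]
  have hinner : ∀ n : ℕ, ∫ x, cellProd F (n, x) ∂(Measure.infinitePi fun _ : ℕ => ρ) =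
      (∫ x, F x ∂ρ) ^ n := by
    intro n
    have hind := (iIndepFun_infinitePi (P := fun _ : ℕ => ρ) (X := fun _ => F)
      fun _ => hF).precomp (g := fun i : Fin n => (i : ℕ)) Fin.val_injective
    have := hind.integral_fun_prod_eq_prod_integral
      fun i => (hF.comp (measurable_pi_apply _)).aestronglyMeasurable
    simp only [cellProd, Finset.prod_range]
    refine this.trans ?_
    have he : ∀ i : ℕ, ∫ ω : ℕ → E, F (ω i) ∂(Measure.infinitePi fun _ : ℕ => ρ) =
        ∫ x, F x ∂ρ := fun i => by
      rw [← integral_map (f := F) (φ := fun ω : ℕ → E => ω i)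
        (measurable_pi_apply i).aemeasurable hF.aestronglyMeasurable]
      exact congrArg (fun m => ∫ x, F x ∂m) (Measure.infinitePi_map_eval _ i)
    simp [he]
  simp_rw [hinner]
  rw [integral_poissonMeasure, integral_sub (integrable_const _) hFint]
  have hexp := (NormedSpace.expSeries_div_hasSum_exp (𝔸 := ℝ) (∫ x, F x ∂ρ)).tsum_eq
  rw [← Real.exp_eq_exp_ℝ] at hexp
  simp only [NNReal.coe_one, one_pow, mul_one, smul_eq_mul, integral_const, probReal_univ]
  rw [neg_sub, sub_eq_neg_add, Real.exp_add, ← hexp, ← tsum_mul_left]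
  congr with n
  ring

/-- Since `(n + 1) / (n + 1)! = 1 / n!`, the series of the mean is the series of the total mass. -/
theorem lintegral_id_poissonMeasure_one : ∫⁻ n : ℕ, (n : ENNReal) ∂(poissonMeasure 1) = 1 := by
  have hone : ∑' n : ℕ, poissonMeasure 1 {n} = 1 := by
    have := lintegral_countable' (μ := poissonMeasure 1) fun _ : ℕ => (1 : ENNReal)
    simpa using this.symm
  rw [lintegral_countable', tsum_eq_zero_add' ENNReal.summable, ← hone]
  simp only [CharP.cast_eq_zero, zero_mul, zero_add]
  congr with n
  rw [poissonMeasure_singleton, poissonMeasure_singleton, ← ENNReal.ofReal_natCast,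
    ← ENNReal.ofReal_mul (by positivity)]
  congr 1
  rw [Nat.factorial_succ]
  push_cast
  field_simp
  simp

theorem lintegral_cellSum (ρ : Measure E) [IsProbabilityMeasure ρ] {f : E → ENNReal}
    (hf : Measurable f) : ∫⁻ c, cellSum f c ∂(cellMeasure ρ) = ∫⁻ x, f x ∂ρ := by
  rw [cellMeasure, lintegral_prod _ (measurable_cellSum hf).aemeasurable]
  have he : ∀ i : ℕ, ∫⁻ ω : ℕ → E, f (ω i) ∂(Measure.infinitePi fun _ : ℕ => ρ) =
      ∫⁻ x, f x ∂ρ := fun i => by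
    rw [← lintegral_map hf (measurable_pi_apply i)]
    exact congrArg (fun m => ∫⁻ x, f x ∂m) (Measure.infinitePi_map_eval _ i)
  have hinner : ∀ n : ℕ, ∫⁻ x, cellSum f (n, x) ∂(Measure.infinitePi fun _ : ℕ => ρ) =
      n * ∫⁻ x, f x ∂ρ := fun n => by
    refine (lintegral_finsetSum (Finset.range n) fun i _ =>
      hf.comp (measurable_pi_apply (X := fun _ : ℕ => E) i)).trans ?_
    simp [he]
  simp_rw [hinner]
  rw [lintegral_mul_const _ (by fun_prop), lintegral_id_poissonMeasure_one, one_mul]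

variable (ρ : ℕ → Measure E) [∀ j, IsProbabilityMeasure (ρ j)]

/-- The law of the cells of a Poisson process with intensity `Measure.sum ρ`. -/
noncomputable def poissonCells : Measure (ℕ → ℕ × (ℕ → E)) :=
  Measure.infinitePi fun j => cellMeasure (ρ j)

instance : IsProbabilityMeasure (poissonCells ρ) := by
  unfold poissonCells; infer_instance

/-- The product of `F : E → [0,1]` over the points of a Poisson process. -/
noncomputable def poissonProd (F : E → ℝ) (ω : ℕ → ℕ × (ℕ → E)) : ℝ :=
  ⨅ B : ℕ, ∏ j ∈ Finset.range B, cellProd F (ω j)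

/-- The sum of `f` over the points of a Poisson process. -/
noncomputable def poissonSum (f : E → ENNReal) (ω : ℕ → ℕ × (ℕ → E)) : ENNReal :=
  ∑' j : ℕ, cellSum f (ω j)

theorem measurable_poissonProd {F : E → ℝ} (hF : Measurable F) : Measurable (poissonProd F) :=
  Measurable.iInf fun _ => Finset.measurable_fun_prod _ fun j _ =>
    (measurable_cellProd hF).comp (measurable_pi_apply j)

/-- Campbell's formula. With `ofReal_abs_poissonProd_sub_le` it bounds the mean distance of two
processes driven by the same points by an integral over the intensity. -/
theorem lintegral_poissonSum {f : E → ENNReal} (hf : Measurable f) :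
    ∫⁻ ω, poissonSum f ω ∂(poissonCells ρ) = ∫⁻ x, f x ∂(Measure.sum ρ) := by
  refine (lintegral_tsum fun j =>
    ((measurable_cellSum hf).comp (measurable_pi_apply j)).aemeasurable).trans ?_
  rw [lintegral_sum_measure]
  congr with j
  rw [← lintegral_cellSum _ hf]
  refine (lintegral_map (measurable_cellSum hf) (measurable_pi_apply j)).symm.trans ?_
  exact congrArg (fun m => ∫⁻ x, cellSum f x ∂m) (Measure.infinitePi_map_eval _ j)


theorem prod_cellProd_nonneg {F : E → ℝ} (h0 : ∀ x, 0 ≤ F x) (ω : ℕ → ℕ × (ℕ → E)) (B : ℕ) :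
    0 ≤ ∏ j ∈ Finset.range B, cellProd F (ω j) :=
  Finset.prod_nonneg fun _ _ => cellProd_nonneg h0 _

/-- Factors in `[0,1]` make the partial products decrease, so the infimum in `poissonProd` is their
limit. -/
theorem tendsto_poissonProd {F : E → ℝ} (h0 : ∀ x, 0 ≤ F x) (h1 : ∀ x, F x ≤ 1)
    (ω : ℕ → ℕ × (ℕ → E)) :
    Tendsto (fun B => ∏ j ∈ Finset.range B, cellProd F (ω j)) atTop (𝓝 (poissonProd F ω)) := by
  refine tendsto_atTop_ciInf (antitone_nat_of_succ_le fun B => ?_)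
    ⟨0, by rintro _ ⟨B, rfl⟩; exact prod_cellProd_nonneg h0 ω B⟩
  rw [Finset.prod_range_succ]
  exact mul_le_of_le_one_right (prod_cellProd_nonneg h0 ω B) (cellProd_le_one h0 h1 _)

theorem poissonProd_nonneg {F : E → ℝ} (h0 : ∀ x, 0 ≤ F x) (ω : ℕ → ℕ × (ℕ → E)) :
    0 ≤ poissonProd F ω :=
  le_ciInf fun B => prod_cellProd_nonneg h0 ω B

theorem poissonProd_le_one {F : E → ℝ} (h0 : ∀ x, 0 ≤ F x) (ω : ℕ → ℕ × (ℕ → E)) :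
    poissonProd F ω ≤ 1 :=
  (ciInf_le ⟨0, by rintro _ ⟨B, rfl⟩; exact prod_cellProd_nonneg h0 ω B⟩ 0).trans (by simp)

theorem poissonProd_mono {F G : E → ℝ} (h0 : ∀ x, 0 ≤ F x) (hFG : ∀ x, F x ≤ G x)
    (ω : ℕ → ℕ × (ℕ → E)) : poissonProd F ω ≤ poissonProd G ω :=
  ciInf_mono ⟨0, by rintro _ ⟨B, rfl⟩; exact prod_cellProd_nonneg h0 ω B⟩ fun _ =>
    Finset.prod_le_prod (fun _ _ => cellProd_nonneg h0 _) fun _ _ =>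
      Finset.prod_le_prod (fun _ _ => h0 _) fun _ _ => hFG _

theorem poissonProd_mul {F G : E → ℝ} (hF0 : ∀ x, 0 ≤ F x) (hF1 : ∀ x, F x ≤ 1)
    (hG0 : ∀ x, 0 ≤ G x) (hG1 : ∀ x, G x ≤ 1) (ω : ℕ → ℕ × (ℕ → E)) :
    poissonProd (fun x => F x * G x) ω = poissonProd F ω * poissonProd G ω := by
  refine tendsto_nhds_unique (tendsto_poissonProd (fun x => mul_nonneg (hF0 x) (hG0 x))
    (fun x => mul_le_one₀ (hF1 x) (hG0 x) (hG1 x)) ω) ?_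
  refine ((tendsto_poissonProd hF0 hF1 ω).mul (tendsto_poissonProd hG0 hG1 ω)).congr fun B => ?_
  simp only [cellProd, Finset.prod_mul_distrib]

theorem poissonProd_one (ω : ℕ → ℕ × (ℕ → E)) : poissonProd (fun _ => 1) ω = 1 := by
  simp [poissonProd, cellProd]

theorem poissonProd_finset_prod {ι : Type*} (s : Finset ι) {F : ι → E → ℝ}
    (h0 : ∀ i x, 0 ≤ F i x) (h1 : ∀ i x, F i x ≤ 1) (ω : ℕ → ℕ × (ℕ → E)) :
    poissonProd (fun x => ∏ i ∈ s, F i x) ω = ∏ i ∈ s, poissonProd (F i) ω := by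
  classical
  induction s using Finset.induction_on with
  | empty => simp [poissonProd_one]
  | insert i s hi ih =>
    simp_rw [Finset.prod_insert hi]
    rw [poissonProd_mul (h0 i) (h1 i) (fun x => Finset.prod_nonneg fun i _ => h0 i x)
      (fun x => Finset.prod_le_one (fun i _ => h0 i x) fun i _ => h1 i x), ih]

theorem poissonProd_pow {F : E → ℝ} (h0 : ∀ x, 0 ≤ F x) (h1 : ∀ x, F x ≤ 1) (k : ℕ)
    (ω : ℕ → ℕ × (ℕ → E)) : poissonProd (fun x => F x ^ k) ω = poissonProd F ω ^ k := by
  have := poissonProd_finset_prod (Finset.range k) (F := fun _ => F) (fun _ => h0) (fun _ => h1) ω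
  simpa using this

/-- The difference of two Poisson products is at most the sum of the differences. -/
theorem ofReal_abs_poissonProd_sub_le {F G : E → ℝ} (hF0 : ∀ x, 0 ≤ F x) (hF1 : ∀ x, F x ≤ 1)
    (hG0 : ∀ x, 0 ≤ G x) (hG1 : ∀ x, G x ≤ 1) {f : E → ENNReal}
    (hf : ∀ x, ENNReal.ofReal |F x - G x| ≤ f x) (ω : ℕ → ℕ × (ℕ → E)) :
    ENNReal.ofReal |poissonProd F ω - poissonProd G ω| ≤ poissonSum f ω := by
  have hlim := ((tendsto_poissonProd hF0 hF1 ω).sub (tendsto_poissonProd hG0 hG1 ω)).abs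
  refine le_of_tendsto ((ENNReal.continuous_ofReal.tendsto _).comp hlim) (.of_forall fun B => ?_)
  calc ENNReal.ofReal |∏ j ∈ Finset.range B, cellProd F (ω j) -
        ∏ j ∈ Finset.range B, cellProd G (ω j)|
      ≤ ENNReal.ofReal (∑ j ∈ Finset.range B, ∑ i ∈ Finset.range (ω j).1,
          |F ((ω j).2 i) - G ((ω j).2 i)|) := by
        refine ENNReal.ofReal_le_ofReal ((abs_prod_sub_prod_le _ (fun _ => cellProd_nonneg hF0 _)
          (fun _ => cellProd_le_one hF0 hF1 _) (fun _ => cellProd_nonneg hG0 _)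
          (fun _ => cellProd_le_one hG0 hG1 _)).trans ?_)
        exact Finset.sum_le_sum fun j _ => abs_prod_sub_prod_le _ (fun _ => hF0 _) (fun _ => hF1 _)
          (fun _ => hG0 _) (fun _ => hG1 _)
    _ = ∑ j ∈ Finset.range B, ∑ i ∈ Finset.range (ω j).1,
          ENNReal.ofReal |F ((ω j).2 i) - G ((ω j).2 i)| := by
        rw [ENNReal.ofReal_sum_of_nonneg fun _ _ => Finset.sum_nonneg fun _ _ => abs_nonneg _]
        refine Finset.sum_congr rfl fun j _ => ?_
        rw [ENNReal.ofReal_sum_of_nonneg fun _ _ => abs_nonneg _]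
    _ ≤ ∑ j ∈ Finset.range B, cellSum f (ω j) := by
        refine Finset.sum_le_sum fun j _ => Finset.sum_le_sum fun i _ => hf _
    _ ≤ poissonSum f ω := ENNReal.sum_le_tsum _

/-- The Laplace functional of a Poisson process. -/
theorem integral_poissonProd {F : E → ℝ} (hF : Measurable F) (h0 : ∀ x, 0 ≤ F x)
    (h1 : ∀ x, F x ≤ 1) (hint : Integrable (fun x => 1 - F x) (Measure.sum ρ)) :
    ∫ ω, poissonProd F ω ∂(poissonCells ρ) = Real.exp (-∫ x, (1 - F x) ∂(Measure.sum ρ)) := by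
  have hfin : ∀ B : ℕ, ∫ ω, ∏ j ∈ Finset.range B, cellProd F (ω j) ∂(poissonCells ρ) =
      Real.exp (-∑ j ∈ Finset.range B, ∫ x, (1 - F x) ∂(ρ j)) := by
    intro B
    have hind := (iIndepFun_infinitePi (P := fun j => cellMeasure (ρ j)) (X := fun _ => cellProd F)
      fun _ => measurable_cellProd hF).precomp (g := fun i : Fin B => (i : ℕ)) Fin.val_injective
    have := hind.integral_fun_prod_eq_prod_integral
      fun i => ((measurable_cellProd hF).comp (measurable_pi_apply _)).aestronglyMeasurable
    simp only [Finset.prod_range, Finset.sum_range]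
    rw [← Finset.sum_neg_distrib, Real.exp_sum]
    refine this.trans ?_
    refine Finset.prod_congr rfl fun j _ => ?_
    rw [← integral_cellProd _ hF h0 h1]
    refine (integral_map (f := cellProd F) (μ := Measure.infinitePi fun j => cellMeasure (ρ j))
      (φ := fun ω => ω (j : ℕ)) (measurable_pi_apply (j : ℕ)).aemeasurable
      (measurable_cellProd hF).aestronglyMeasurable).symm.trans ?_
    exact congrArg (fun m => ∫ x, cellProd F x ∂m) (Measure.infinitePi_map_eval _ (j : ℕ))
  have hl1 : Tendsto (fun B : ℕ => ∫ ω, ∏ j ∈ Finset.range B, cellProd F (ω j) ∂(poissonCells ρ))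
      atTop (𝓝 (∫ ω, poissonProd F ω ∂(poissonCells ρ))) := by
    refine tendsto_integral_of_dominated_convergence (fun _ => 1) (fun B => ?_)
      (integrable_const _) (fun B => .of_forall fun ω => ?_)
      (.of_forall fun ω => tendsto_poissonProd h0 h1 ω)
    · exact (Finset.measurable_fun_prod _ fun j _ =>
        (measurable_cellProd hF).comp (measurable_pi_apply j)).aestronglyMeasurable
    · rw [Real.norm_of_nonneg (prod_cellProd_nonneg h0 ω B)]
      exact Finset.prod_le_one (fun _ _ => cellProd_nonneg h0 _)
        fun _ _ => cellProd_le_one h0 h1 _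
  refine tendsto_nhds_unique hl1 ?_
  simp_rw [hfin]
  exact (Real.continuous_exp.tendsto _).comp
    (hasSum_integral_measure hint).tendsto_sum_nat.neg

end PoissonProduct

/-! ### The multiplicative subordinator of a jump profile -/

/-- A jump profile: `ζ h = exp (-Q h)`, where `Q h` is the size of the jump that is caused by a
point at height `h` of a Poisson process with unit intensity on `(0,∞) × (0,∞)`. -/
structure IsJumpProfile (ζ : ℝ → ℝ) : Prop where
  measurable : Measurable ζ
  nonneg : ∀ h, 0 ≤ ζ h
  le_one : ∀ h, ζ h ≤ 1
  integrable : IntegrableOn (fun h => 1 - ζ h) (Ioi 0)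

/-- The Laplace exponent, at natural numbers, of the subordinator with drift `d` and jump
profile `ζ`. -/
noncomputable def levyExponent (d : ℝ) (ζ : ℝ → ℝ) (k : ℕ) : ℝ :=
  d * k + ∫ h in Ioi 0, (1 - ζ h ^ k)

theorem one_sub_pow_le {z : ℝ} (h0 : 0 ≤ z) (h1 : z ≤ 1) (k : ℕ) :
    1 - z ^ k ≤ k * (1 - z) := by
  have := one_add_mul_le_pow (a := z - 1) (by linarith) k
  rw [add_sub_cancel] at this
  linarith

theorem IsJumpProfile.integrable_pow {ζ : ℝ → ℝ} (hζ : IsJumpProfile ζ) (k : ℕ) :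
    IntegrableOn (fun h => 1 - ζ h ^ k) (Ioi 0) := by
  refine (hζ.integrable.const_mul (k : ℝ)).mono'
    ((measurable_const.sub (hζ.measurable.pow_const k)).aestronglyMeasurable)
    (.of_forall fun h => ?_)
  rw [Real.norm_of_nonneg (sub_nonneg.2 (pow_le_one₀ (hζ.nonneg h) (hζ.le_one h)))]
  exact one_sub_pow_le (hζ.nonneg h) (hζ.le_one h) k

theorem levyExponent_zero (d : ℝ) (ζ : ℝ → ℝ) : levyExponent d ζ 0 = 0 := by
  simp [levyExponent]

theorem levyExponent_nonneg {d : ℝ} (hd : 0 ≤ d) {ζ : ℝ → ℝ} (hζ : IsJumpProfile ζ) (k : ℕ) :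
    0 ≤ levyExponent d ζ k :=
  add_nonneg (by positivity) (integral_nonneg fun h =>
    sub_nonneg.2 (pow_le_one₀ (hζ.nonneg h) (hζ.le_one h)))

/-- The unit cells of the quadrant `(0,∞) × (0,∞)`. -/
def quadrantCell (j : ℕ) : Set (ℝ × ℝ) :=
  Ioc (j.unpair.1 : ℝ) (j.unpair.1 + 1) ×ˢ Ioc (j.unpair.2 : ℝ) (j.unpair.2 + 1)

theorem measurableSet_quadrantCell (j : ℕ) : MeasurableSet (quadrantCell j) :=
  measurableSet_Ioc.prod measurableSet_Ioc

instance (j : ℕ) : IsProbabilityMeasure ((volume : Measure (ℝ × ℝ)).restrict (quadrantCell j)) := by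
  constructor
  rw [Measure.restrict_apply_univ, quadrantCell, Measure.volume_eq_prod, Measure.prod_prod]
  simp

theorem mem_Ioc_natCast_iff {x : ℝ} (n : ℕ) :
    x ∈ Ioc (n : ℝ) (n + 1) ↔ 0 < x ∧ ⌈x⌉₊ = n + 1 := by
  constructor
  · rintro ⟨h1, h2⟩
    refine ⟨(Nat.cast_nonneg n).trans_lt h1, (Nat.ceil_eq_iff (by simp)).2 ⟨by simpa using h1, ?_⟩⟩
    exact_mod_cast h2
  · rintro ⟨h0, h⟩
    have := (Nat.ceil_eq_iff (by simp)).1 h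
    exact ⟨by simpa using this.1, by exact_mod_cast this.2⟩

theorem iUnion_quadrantCell : ⋃ j, quadrantCell j = Ioi (0 : ℝ) ×ˢ Ioi (0 : ℝ) := by
  ext ⟨u, h⟩
  simp only [mem_iUnion, quadrantCell, mem_prod, mem_Ioc_natCast_iff, mem_Ioi]
  constructor
  · rintro ⟨j, ⟨h1, -⟩, h2, -⟩
    exact ⟨h1, h2⟩
  · rintro ⟨h1, h2⟩
    refine ⟨Nat.pair (⌈u⌉₊ - 1) (⌈h⌉₊ - 1), ⟨h1, ?_⟩, h2, ?_⟩
    · have := Nat.ceil_pos.2 h1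
      simp; omega
    · have := Nat.ceil_pos.2 h2
      simp; omega

theorem pairwise_disjoint_quadrantCell : Pairwise (Function.onFun Disjoint quadrantCell) := by
  intro i j hij
  refine disjoint_left.2 fun ⟨u, h⟩ hi hj => hij ?_
  simp only [quadrantCell, mem_prod, mem_Ioc_natCast_iff] at hi hj
  rw [← Nat.pair_unpair i, ← Nat.pair_unpair j]
  congr 1 <;> omega

/-- The law of the cells of a Poisson process with unit intensity on the quadrant. -/
noncomputable def quadrantLaw : Measure (ℕ → ℕ × (ℕ → ℝ × ℝ)) :=
  poissonCells fun j => (volume : Measure (ℝ × ℝ)).restrict (quadrantCell j)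

instance : IsProbabilityMeasure quadrantLaw := by
  unfold quadrantLaw; infer_instance

theorem sum_restrict_quadrantCell :
    Measure.sum (fun j => (volume : Measure (ℝ × ℝ)).restrict (quadrantCell j)) =
      ((volume : Measure ℝ).restrict (Ioi 0)).prod ((volume : Measure ℝ).restrict (Ioi 0)) := by
  rw [← Measure.restrict_iUnion pairwise_disjoint_quadrantCell measurableSet_quadrantCell,
    iUnion_quadrantCell, Measure.prod_restrict, Measure.volume_eq_prod]

/-- The factor contributed at time `q` by a point `(u, h)`. -/
noncomputable def jumpFactor (ζ : ℝ → ℝ) (q : ℝ) (p : ℝ × ℝ) : ℝ :=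
  if p.1 ≤ q then ζ p.2 else 1

/-- The process `exp (-σ q)`, where `σ` is the subordinator with drift `d` and jump
profile `ζ`. -/
noncomputable def levyZ (d : ℝ) (ζ : ℝ → ℝ) (q : ℝ) (ω : ℕ → ℕ × (ℕ → ℝ × ℝ)) : ℝ :=
  Real.exp (-(d * q)) * poissonProd (jumpFactor ζ q) ω

section LevyZ

variable {d : ℝ} {ζ : ℝ → ℝ}

theorem IsJumpProfile.measurable_jumpFactor (hζ : IsJumpProfile ζ) (q : ℝ) :
    Measurable (jumpFactor ζ q) :=
  Measurable.ite (measurableSet_le measurable_fst measurable_const)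
    (hζ.measurable.comp measurable_snd) measurable_const

theorem IsJumpProfile.jumpFactor_nonneg (hζ : IsJumpProfile ζ) (q : ℝ) (p : ℝ × ℝ) :
    0 ≤ jumpFactor ζ q p := by
  unfold jumpFactor; split_ifs
  exacts [hζ.nonneg _, zero_le_one]

theorem IsJumpProfile.jumpFactor_le_one (hζ : IsJumpProfile ζ) (q : ℝ) (p : ℝ × ℝ) :
    jumpFactor ζ q p ≤ 1 := by
  unfold jumpFactor; split_ifs
  exacts [hζ.le_one _, le_rfl]

theorem IsJumpProfile.measurable_levyZ (hζ : IsJumpProfile ζ) (d q : ℝ) :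
    Measurable (levyZ d ζ q) :=
  (measurable_poissonProd (hζ.measurable_jumpFactor q)).const_mul _

theorem IsJumpProfile.levyZ_nonneg (hζ : IsJumpProfile ζ) (d q : ℝ)
    (ω : ℕ → ℕ × (ℕ → ℝ × ℝ)) : 0 ≤ levyZ d ζ q ω :=
  mul_nonneg (Real.exp_pos _).le (poissonProd_nonneg (hζ.jumpFactor_nonneg q) ω)

theorem IsJumpProfile.levyZ_le_one (hζ : IsJumpProfile ζ) (hd : 0 ≤ d) {q : ℝ} (hq : 0 ≤ q)
    (ω : ℕ → ℕ × (ℕ → ℝ × ℝ)) : levyZ d ζ q ω ≤ 1 :=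
  mul_le_one₀ (Real.exp_le_one_iff.2 (by nlinarith)) (poissonProd_nonneg (hζ.jumpFactor_nonneg q) ω)
    (poissonProd_le_one (hζ.jumpFactor_nonneg q) ω)

theorem IsJumpProfile.levyZ_antitone (hζ : IsJumpProfile ζ) (hd : 0 ≤ d)
    (ω : ℕ → ℕ × (ℕ → ℝ × ℝ)) : Antitone fun q => levyZ d ζ q ω := by
  intro q r hqr
  refine mul_le_mul (Real.exp_le_exp.2 (by nlinarith)) (poissonProd_mono
    (hζ.jumpFactor_nonneg r) (fun p => ?_) ω) (poissonProd_nonneg (hζ.jumpFactor_nonneg r) ω)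
    (Real.exp_pos _).le
  unfold jumpFactor
  split_ifs with h1 h2 h2
  · exact le_rfl
  · exact hζ.le_one _
  · exact absurd (h2.trans hqr) h1
  · exact le_rfl

/-- The joint moments of `exp (-σ q)`. -/
theorem IsJumpProfile.integral_prod_levyZ (hζ : IsJumpProfile ζ) {ι : Type*} (s : Finset ι)
    (q : ι → ℝ) (hq : ∀ i, 0 ≤ q i) (k : ι → ℕ) :
    ∫ ω, ∏ i ∈ s, levyZ d ζ (q i) ω ^ k i ∂quadrantLaw =
      Real.exp (-∫ u in Ioi 0, levyExponent d ζ (∑ i ∈ s, if u ≤ q i then k i else 0)) := by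
  -- A point `(u, h)` acts on exactly the times `q i ≥ u`, so its factor in the mixed product is `ζ
  -- h ^ Λ u`. The drift gives the linear part, as the integral of `Λ` is `∑ k i * q i`.
  set Λ : ℝ → ℕ := fun u => ∑ i ∈ s, if u ≤ q i then k i else 0 with hΛ
  have hΛm : Measurable Λ := Finset.measurable_fun_sum _ fun i _ =>
    Measurable.ite (measurableSet_le measurable_id measurable_const) measurable_const
      measurable_const
  have hind : ∀ (i : ι), IntegrableOn (fun u => (((if u ≤ q i then k i else 0 : ℕ)) : ℝ)) (Ioi 0) ∧
      ∫ u in Ioi 0, (((if u ≤ q i then k i else 0 : ℕ)) : ℝ) = k i * q i := by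
    intro i
    have heq : (fun u => (((if u ≤ q i then k i else 0 : ℕ)) : ℝ)) =
        (Iic (q i)).indicator fun _ => (k i : ℝ) := by
      ext u; by_cases h : u ≤ q i <;> simp [h]
    rw [heq]
    refine ⟨?_, ?_⟩
    · rw [IntegrableOn, integrable_indicator_iff measurableSet_Iic, IntegrableOn,
        Measure.restrict_restrict measurableSet_Iic, Iic_inter_Ioi]
      exact integrable_const _
    · rw [integral_indicator measurableSet_Iic, Measure.restrict_restrict measurableSet_Iic,
        Iic_inter_Ioi]
      simp [hq i, mul_comm]
  have hΛint : IntegrableOn (fun u => (Λ u : ℝ)) (Ioi 0) := by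
    simp only [hΛ, Nat.cast_sum]
    exact integrable_finsetSum _ fun i _ => (hind i).1
  have hΛval : ∫ u in Ioi 0, (Λ u : ℝ) = ∑ i ∈ s, k i * q i := by
    simp only [hΛ, Nat.cast_sum]
    rw [integral_finsetSum _ fun i _ => (hind i).1]
    exact Finset.sum_congr rfl fun i _ => (hind i).2
  set F : ℝ × ℝ → ℝ := fun p => ∏ i ∈ s, jumpFactor ζ (q i) p ^ k i with hF
  have hFeq : ∀ p, F p = ζ p.2 ^ Λ p.1 := by
    intro p
    simp only [hF, hΛ, ← Finset.prod_pow_eq_pow_sum]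
    refine Finset.prod_congr rfl fun i _ => ?_
    unfold jumpFactor; split_ifs <;> simp
  have hFm : Measurable F := Finset.measurable_fun_prod _ fun i _ =>
    (hζ.measurable_jumpFactor (q i)).pow_const _
  have hF0 : ∀ p, 0 ≤ F p := fun p => hFeq p ▸ pow_nonneg (hζ.nonneg _) _
  have hF1 : ∀ p, F p ≤ 1 := fun p => hFeq p ▸ pow_le_one₀ (hζ.nonneg _) (hζ.le_one _)
  have hint : Integrable (fun p => 1 - F p)
      (Measure.sum fun j => (volume : Measure (ℝ × ℝ)).restrict (quadrantCell j)) := by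
    rw [sum_restrict_quadrantCell]
    refine (hΛint.mul_prod hζ.integrable).mono' (measurable_const.sub hFm).aestronglyMeasurable
      (.of_forall fun p => ?_)
    rw [Real.norm_of_nonneg (sub_nonneg.2 (hF1 p)), hFeq]
    exact one_sub_pow_le (hζ.nonneg _) (hζ.le_one _) _
  have hprod : ∀ ω, ∏ i ∈ s, levyZ d ζ (q i) ω ^ k i =
      Real.exp (-(d * ∑ i ∈ s, k i * q i)) * poissonProd F ω := by
    intro ω
    have h1 : poissonProd F ω = ∏ i ∈ s, poissonProd (jumpFactor ζ (q i)) ω ^ k i := by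
      rw [hF, poissonProd_finset_prod s
        (fun i p => pow_nonneg (hζ.jumpFactor_nonneg _ p) _)
        (fun i p => pow_le_one₀ (hζ.jumpFactor_nonneg _ p) (hζ.jumpFactor_le_one _ p))]
      exact Finset.prod_congr rfl fun i _ =>
        poissonProd_pow (hζ.jumpFactor_nonneg _) (hζ.jumpFactor_le_one _) _ _
    have h2 : Real.exp (-(d * ∑ i ∈ s, k i * q i)) =
        ∏ i ∈ s, Real.exp (-(d * q i)) ^ k i := by
      rw [Finset.mul_sum, ← Finset.sum_neg_distrib, Real.exp_sum]
      refine Finset.prod_congr rfl fun i _ => ?_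
      rw [← Real.exp_nat_mul]
      congr 1; ring
    rw [h1, h2, ← Finset.prod_mul_distrib]
    exact Finset.prod_congr rfl fun i _ => mul_pow _ _ _
  simp_rw [hprod]
  rw [integral_const_mul, quadrantLaw, integral_poissonProd _ hFm hF0 hF1 hint, ← Real.exp_add]
  congr 1
  rw [sum_restrict_quadrantCell] at hint ⊢
  rw [integral_prod _ hint]
  simp only [levyExponent, hFeq]
  simp only [hFeq] at hint
  rw [integral_add (hΛint.const_mul d) hint.integral_prod_left, integral_const_mul, hΛval]
  ring

theorem IsJumpProfile.integral_levyZ_pow (hζ : IsJumpProfile ζ) {q : ℝ} (hq : 0 ≤ q) (k : ℕ) :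
    ∫ ω, levyZ d ζ q ω ^ k ∂quadrantLaw = Real.exp (-(q * levyExponent d ζ k)) := by
  have := hζ.integral_prod_levyZ (d := d) (Finset.univ (α := Unit)) (fun _ => q) (fun _ => hq)
    fun _ => k
  simp only [Finset.univ_unique, Finset.prod_singleton, Finset.sum_singleton] at this
  rw [this]
  congr 2
  have heq : (fun u => levyExponent d ζ (if u ≤ q then k else 0)) =
      (Iic q).indicator fun _ => levyExponent d ζ k := by
    ext u; by_cases h : u ≤ q <;> simp [h, levyExponent_zero]
  rw [heq, integral_indicator measurableSet_Iic, Measure.restrict_restrict measurableSet_Iic,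
    Iic_inter_Ioi]
  simp [hq]

end LevyZ

/-! ### Uniform convergence in mean of the multiplicative subordinators -/

section Variance

variable {d : ℝ} {ζ : ℝ → ℝ}

theorem levyExponent_one (d : ℝ) (ζ : ℝ → ℝ) :
    levyExponent d ζ 1 = d + ∫ h in Ioi 0, (1 - ζ h) := by
  simp [levyExponent]

theorem IsJumpProfile.integrable_sq (hζ : IsJumpProfile ζ) :
    IntegrableOn (fun h => (1 - ζ h) ^ 2) (Ioi 0) := by
  refine hζ.integrable.mono' ((measurable_const.sub hζ.measurable).pow_const 2).aestronglyMeasurable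
    (.of_forall fun h => ?_)
  rw [Real.norm_of_nonneg (sq_nonneg _)]
  nlinarith [hζ.nonneg h, hζ.le_one h]

/-- The defect of the exponent from additivity, here the second moment of `1 - ζ`, controls the
variance of the multiplicative process. -/
theorem IsJumpProfile.levyExponent_two (hζ : IsJumpProfile ζ) :
    levyExponent d ζ 2 = 2 * levyExponent d ζ 1 - ∫ h in Ioi 0, (1 - ζ h) ^ 2 := by
  have h1 : ∀ h, 1 - ζ h ^ 2 = 2 * (1 - ζ h) - (1 - ζ h) ^ 2 := fun h => by ring
  rw [levyExponent_one, levyExponent]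
  simp_rw [h1]
  rw [integral_sub (hζ.integrable.const_mul 2) hζ.integrable_sq, integral_const_mul]
  push_cast
  ring

/-- A Chebyshev type bound: `exp (-σ q)` is close to a constant if the jumps are small. -/
theorem IsJumpProfile.lintegral_abs_levyZ_sub_le (hζ : IsJumpProfile ζ) (hd : 0 ≤ d) {q : ℝ}
    (hq : 0 ≤ q) {c : ℝ} (hc : 0 < c) :
    ∫⁻ ω, ENNReal.ofReal |levyZ d ζ q ω - Real.exp (-(q * levyExponent d ζ 1))| ∂quadrantLaw ≤
      ENNReal.ofReal (q * (∫ h in Ioi 0, (1 - ζ h) ^ 2) / c + c) := by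
  set β := levyExponent d ζ 1
  set v := ∫ h in Ioi 0, (1 - ζ h) ^ 2 with hv
  have hv0 : 0 ≤ v := integral_nonneg fun h => sq_nonneg _
  set a := Real.exp (-(q * β)) with ha
  have hm := hζ.measurable_levyZ d q
  have hbd : ∀ k : ℕ, Integrable (fun ω => levyZ d ζ q ω ^ k) quadrantLaw := fun k =>
    .of_bound (hm.pow_const k).aestronglyMeasurable 1 (.of_forall fun ω => by
      rw [Real.norm_of_nonneg (pow_nonneg (hζ.levyZ_nonneg d q ω) k)]
      exact pow_le_one₀ (hζ.levyZ_nonneg d q ω) (hζ.levyZ_le_one hd hq ω))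
  have hsq : ∀ ω, (levyZ d ζ q ω - a) ^ 2 =
      levyZ d ζ q ω ^ 2 - 2 * a * levyZ d ζ q ω ^ 1 + a ^ 2 := fun ω => by ring
  have hint2 : Integrable (fun ω => (levyZ d ζ q ω - a) ^ 2) quadrantLaw := by
    simp_rw [hsq]
    exact ((hbd 2).sub ((hbd 1).const_mul _)).add (integrable_const _)
  -- The variance is `exp (-q (2β - v)) - exp (-2qβ)`, which is at most `q v` because `1 - exp (-q
  -- v) ≤ q v`.
  have hvar : ∫ ω, (levyZ d ζ q ω - a) ^ 2 ∂quadrantLaw ≤ q * v := by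
    have hsub : Integrable (fun ω => levyZ d ζ q ω ^ 2 - 2 * a * levyZ d ζ q ω ^ 1) quadrantLaw :=
      (hbd 2).sub ((hbd 1).const_mul _)
    simp_rw [hsq]
    rw [integral_add hsub (integrable_const _), integral_sub (hbd 2) ((hbd 1).const_mul _), integral_const_mul,
      hζ.integral_levyZ_pow hq, hζ.integral_levyZ_pow hq, integral_const, probReal_univ, one_smul,
      hζ.levyExponent_two]
    have h2 : a ^ 2 = Real.exp (-(q * (2 * β))) := by
      rw [ha, ← Real.exp_nat_mul]; congr 1; push_cast; ring
    have hb2 : 0 ≤ 2 * β - v := by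
      rw [← hζ.levyExponent_two]; exact levyExponent_nonneg hd hζ 2
    have h3 : Real.exp (-(q * (2 * β - v))) * (1 - q * v) ≤ Real.exp (-(q * (2 * β))) := by
      have : Real.exp (-(q * (2 * β))) = Real.exp (-(q * (2 * β - v))) * Real.exp (-(q * v)) := by
        rw [← Real.exp_add]; congr 1; ring
      rw [this]
      gcongr
      linarith [Real.add_one_le_exp (-(q * v))]
    have h4 : Real.exp (-(q * (2 * β - v))) ≤ 1 := Real.exp_le_one_iff.2 (by nlinarith)
    have h5 : 0 ≤ q * v := by positivity
    change Real.exp (-(q * (2 * β - v))) - 2 * a * a + a ^ 2 ≤ q * v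
    nlinarith
  have hint1 : Integrable (fun ω => |levyZ d ζ q ω - a|) quadrantLaw := by
    have := ((hbd 1).sub (integrable_const a)).abs
    simpa using this
  rw [← ofReal_integral_eq_lintegral_ofReal hint1 (.of_forall fun _ => abs_nonneg _)]
  refine ENNReal.ofReal_le_ofReal ?_
  calc ∫ ω, |levyZ d ζ q ω - a| ∂quadrantLaw
      ≤ ∫ ω, ((levyZ d ζ q ω - a) ^ 2 / c + c) ∂quadrantLaw := by
        refine integral_mono hint1 ((hint2.div_const c).add (integrable_const c)) fun ω => ?_
        have h6 : |levyZ d ζ q ω - a| * c ≤ (levyZ d ζ q ω - a) ^ 2 + c * c := by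
          rw [← sq_abs]
          nlinarith [abs_nonneg (levyZ d ζ q ω - a),
            sq_nonneg (|levyZ d ζ q ω - a| - c)]
        change |levyZ d ζ q ω - a| ≤ (levyZ d ζ q ω - a) ^ 2 / c + c
        rw [div_add' _ _ _ hc.ne', le_div_iff₀ hc]
        exact h6
    _ = (∫ ω, (levyZ d ζ q ω - a) ^ 2 ∂quadrantLaw) / c + c := by
        rw [integral_add (hint2.div_const c) (integrable_const c), integral_div]
        simp
    _ ≤ q * v / c + c := by gcongr

/-- Uniform closeness of an antitone function to an exponential follows from closeness on a
grid. -/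
theorem abs_antitone_sub_exp_le {Y : ℝ → ℝ} (hY : Antitone Y) {β : ℝ} (hβ : 0 ≤ β) (T m : ℕ)
    (hm : 0 < m) {q : ℝ} (hq : 0 ≤ q) (hqT : q ≤ T) :
    |Y q - Real.exp (-(q * β))| ≤
      ∑ j ∈ Finset.range (T * m + 2), |Y (j / m) - Real.exp (-(j / m * β))| + β / m := by
  have hm' : (0 : ℝ) < m := by exact_mod_cast hm
  -- Both functions decrease in `q`, so the values at `j / m` and `(j + 1) / m` enclose those at
  -- `q`. As `j + 1 ≤ T * m + 1`, the grid needs `T * m + 2` points.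
  set j := ⌊q * m⌋₊ with hj
  have hj1 : (j : ℝ) / m ≤ q := by
    rw [div_le_iff₀ hm']; exact Nat.floor_le (by positivity)
  have hj2 : q ≤ ((j + 1 : ℕ) : ℝ) / m := by
    rw [le_div_iff₀ hm']; push_cast; exact (Nat.lt_floor_add_one _).le
  have hjT : j ≤ T * m := by
    rw [hj]
    refine Nat.floor_le_of_le ?_
    push_cast
    gcongr
  have hsum : ∀ i ∈ Finset.range (T * m + 2), |Y (i / m) - Real.exp (-(i / m * β))| ≤
      ∑ j ∈ Finset.range (T * m + 2), |Y (j / m) - Real.exp (-(j / m * β))| := fun i hi =>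
    Finset.single_le_sum (f := fun j : ℕ => |Y (j / m) - Real.exp (-(j / m * β))|)
      (fun _ _ => abs_nonneg _) hi
  have hs1 := hsum j (Finset.mem_range.2 (by omega))
  have hs2 := hsum (j + 1) (Finset.mem_range.2 (by omega))
  have hgap : Real.exp (-(j / m * β)) - Real.exp (-(((j + 1 : ℕ) : ℝ) / m * β)) ≤ β / m := by
    have h1 : Real.exp (-(((j + 1 : ℕ) : ℝ) / m * β)) =
        Real.exp (-(j / m * β)) * Real.exp (-(β / m)) := by
      rw [← Real.exp_add]; congr 1; push_cast; field_simp; ring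
    have h2 : Real.exp (-(j / m * β)) ≤ 1 := Real.exp_le_one_iff.2 (by
      have : 0 ≤ (j : ℝ) / m * β := by positivity
      linarith)
    have h3 := Real.add_one_le_exp (-(β / m))
    have h4 : Real.exp (-(β / m)) ≤ 1 := Real.exp_le_one_iff.2 (by
      have : 0 ≤ β / m := by positivity
      linarith)
    rw [h1]
    nlinarith [Real.exp_pos (-(j / m * β))]
  have he1 : Real.exp (-(q * β)) ≤ Real.exp (-(j / m * β)) := Real.exp_le_exp.2 (by nlinarith)
  have he2 : Real.exp (-(((j + 1 : ℕ) : ℝ) / m * β)) ≤ Real.exp (-(q * β)) :=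
    Real.exp_le_exp.2 (by nlinarith)
  have hY1 := hY hj1
  have hY2 := hY hj2
  rw [abs_le] at hs1 hs2 ⊢
  constructor <;> linarith

/-- The majorant `f` is the sum of the errors at the grid points plus the oscillation of the
exponential between them. The factor `T + 1` appears because the last grid point lies beyond `T`. -/
theorem IsJumpProfile.exists_le_of_small_jumps (hζ : IsJumpProfile ζ) (hd : 0 ≤ d) (T m : ℕ)
    (hm : 0 < m) {c : ℝ} (hc : 0 < c) :
    ∃ f : (ℕ → ℕ × (ℕ → ℝ × ℝ)) → ENNReal, Measurable f ∧
      (∀ q : ℝ, 0 ≤ q → q ≤ T → ∀ ω,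
        ENNReal.ofReal |levyZ d ζ q ω - Real.exp (-(q * levyExponent d ζ 1))| ≤ f ω) ∧
      ∫⁻ ω, f ω ∂quadrantLaw ≤ ENNReal.ofReal ((T * m + 2) *
        ((T + 1) * (∫ h in Ioi 0, (1 - ζ h) ^ 2) / c + c) + levyExponent d ζ 1 / m) := by
  set β := levyExponent d ζ 1
  set v := ∫ h in Ioi 0, (1 - ζ h) ^ 2 with hv
  have hv0 : 0 ≤ v := integral_nonneg fun h => sq_nonneg _
  have hβ : 0 ≤ β := levyExponent_nonneg hd hζ 1
  have hmeas : ∀ j : ℕ, Measurable fun ω =>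
      ENNReal.ofReal |levyZ d ζ (j / m) ω - Real.exp (-(j / m * β))| := fun j =>
    (((hζ.measurable_levyZ d _).sub_const _).abs).ennreal_ofReal
  refine ⟨fun ω => ∑ j ∈ Finset.range (T * m + 2),
    ENNReal.ofReal |levyZ d ζ (j / m) ω - Real.exp (-(j / m * β))| + ENNReal.ofReal (β / m),
    (Finset.measurable_fun_sum _ fun j _ => hmeas j).add_const _, fun q hq hqT ω => ?_, ?_⟩
  · beta_reduce
    rw [← ENNReal.ofReal_sum_of_nonneg fun _ _ => abs_nonneg _, ← ENNReal.ofReal_add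
      (Finset.sum_nonneg fun _ _ => abs_nonneg _) (by positivity)]
    exact ENNReal.ofReal_le_ofReal
      (abs_antitone_sub_exp_le (hζ.levyZ_antitone hd ω) hβ T m hm hq hqT)
  · rw [lintegral_add_right _ measurable_const, lintegral_finsetSum _ fun j _ => hmeas j,
      lintegral_const, measure_univ, mul_one]
    have hm' : (0 : ℝ) < m := by exact_mod_cast hm
    have hle : ∀ j ∈ Finset.range (T * m + 2), ∫⁻ ω, ENNReal.ofReal
        |levyZ d ζ (j / m) ω - Real.exp (-(j / m * β))| ∂quadrantLaw ≤
        ENNReal.ofReal ((T + 1) * v / c + c) := by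
      intro j hj
      refine (hζ.lintegral_abs_levyZ_sub_le hd (by positivity) hc).trans
        (ENNReal.ofReal_le_ofReal ?_)
      have : (j : ℝ) / m ≤ T + 1 := by
        rw [div_le_iff₀ hm']
        have h1 : j ≤ T * m + 1 := by have := Finset.mem_range.1 hj; omega
        have h2 : (j : ℝ) ≤ T * m + 1 := by exact_mod_cast h1
        have h3 : (1 : ℝ) ≤ m := by exact_mod_cast hm
        linarith
      gcongr
    refine (add_le_add_left (Finset.sum_le_sum hle) _).trans ?_
    rw [Finset.sum_const, Finset.card_range, nsmul_eq_mul,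
      ENNReal.ofReal_add (p := (T * m + 2) * ((T + 1) * v / c + c)) (by positivity)
      (by positivity), ENNReal.ofReal_mul (by positivity)]
    gcongr
    rw [← ENNReal.ofReal_natCast]
    exact ENNReal.ofReal_le_ofReal (by push_cast; exact le_rfl)

end Variance

/-! ### Separation of large and small jumps, and the coupling estimate -/

section Truncation

/-- The part of a jump profile that comes from heights at most `H`, that is, from large jumps. -/
noncomputable def lowProfile (H : ℝ) (ζ : ℝ → ℝ) (h : ℝ) : ℝ := if h ≤ H then ζ h else 1

/-- The part of a jump profile that comes from heights above `H`, that is, from small jumps. -/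
noncomputable def highProfile (H : ℝ) (ζ : ℝ → ℝ) (h : ℝ) : ℝ := if h ≤ H then 1 else ζ h

variable {d : ℝ} {ζ : ℝ → ℝ}

theorem IsJumpProfile.of_le (hζ : IsJumpProfile ζ) {ξ : ℝ → ℝ} (hm : Measurable ξ)
    (h1 : ∀ h, ξ h ≤ 1) (hle : ∀ h, ζ h ≤ ξ h) : IsJumpProfile ξ where
  measurable := hm
  nonneg h := (hζ.nonneg h).trans (hle h)
  le_one := h1
  integrable := hζ.integrable.mono' (measurable_const.sub hm).aestronglyMeasurable
    (.of_forall fun h => by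
      rw [Real.norm_of_nonneg (sub_nonneg.2 (h1 h))]
      exact sub_le_sub_left (hle h) 1)

theorem IsJumpProfile.lowPart (hζ : IsJumpProfile ζ) (H : ℝ) : IsJumpProfile (lowProfile H ζ) := by
  refine hζ.of_le (Measurable.ite measurableSet_Iic hζ.measurable measurable_const)
    (fun h => ?_) fun h => ?_ <;> unfold lowProfile <;> split_ifs
  exacts [hζ.le_one h, le_rfl, le_rfl, hζ.le_one h]

theorem IsJumpProfile.highPart (hζ : IsJumpProfile ζ) (H : ℝ) : IsJumpProfile (highProfile H ζ) := by
  refine hζ.of_le (Measurable.ite measurableSet_Iic measurable_const hζ.measurable)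
    (fun h => ?_) fun h => ?_ <;> unfold highProfile <;> split_ifs
  exacts [le_rfl, hζ.le_one h, hζ.le_one h, le_rfl]

/-- Each point belongs to one of the two height ranges. The drift goes with the small jumps, because
in a limit small jumps may turn into drift. -/
theorem IsJumpProfile.levyZ_eq_mul (hζ : IsJumpProfile ζ) (d H q : ℝ)
    (ω : ℕ → ℕ × (ℕ → ℝ × ℝ)) :
    levyZ d ζ q ω = levyZ 0 (lowProfile H ζ) q ω * levyZ d (highProfile H ζ) q ω := by
  have h1 : jumpFactor ζ q = fun p =>
      jumpFactor (lowProfile H ζ) q p * jumpFactor (highProfile H ζ) q p := by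
    funext p
    unfold jumpFactor lowProfile highProfile
    split_ifs <;> simp
  unfold levyZ
  rw [h1, poissonProd_mul ((hζ.lowPart H).jumpFactor_nonneg q)
    ((hζ.lowPart H).jumpFactor_le_one q) ((hζ.highPart H).jumpFactor_nonneg q)
    ((hζ.highPart H).jumpFactor_le_one q)]
  simp only [zero_mul, neg_zero, Real.exp_zero]
  ring

/-- The rate of the small-jump part is a difference of two quantities that converge, which avoids
any convergence of the drifts or of integrals up to infinity. -/
theorem IsJumpProfile.levyExponent_highPart (hζ : IsJumpProfile ζ) (d : ℝ) (H : ℝ) :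
    levyExponent d (highProfile H ζ) 1 =
      levyExponent d ζ 1 - ∫ h in Ioc 0 H, (1 - ζ h) := by
  have hI : Ioc 0 H = Iic H ∩ Ioi 0 := Iic_inter_Ioi.symm
  rw [levyExponent_one, levyExponent_one, hI, ← Measure.restrict_restrict measurableSet_Iic,
    ← integral_indicator measurableSet_Iic, add_sub_assoc, ← integral_sub hζ.integrable
    (hζ.integrable.indicator measurableSet_Iic)]
  congr 2 with h
  by_cases hh : h ≤ H <;> simp [highProfile, hh]

/-- Markov's inequality: `1 - ζ` is nonincreasing, so its integral over `(0, h]` is at least `h`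
times its value at `h`. Hence `1 - ζ h` is of order `1 / h`, uniformly over profiles with bounded
exponent. -/
theorem IsJumpProfile.mul_one_sub_le (hζ : IsJumpProfile ζ) (hmono : Monotone ζ) (hd : 0 ≤ d)
    {h : ℝ} (hh : 0 ≤ h) : h * (1 - ζ h) ≤ levyExponent d ζ 1 := by
  have h1 : ∫ x in Ioc 0 h, (1 - ζ h) ≤ ∫ x in Ioc 0 h, (1 - ζ x) :=
    setIntegral_mono_on (integrable_const _) (hζ.integrable.mono_set Ioc_subset_Ioi_self)
      measurableSet_Ioc fun x hx => sub_le_sub_left (hmono hx.2) 1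
  have h2 : ∫ x in Ioc 0 h, (1 - ζ x) ≤ ∫ x in Ioi 0, (1 - ζ x) :=
    setIntegral_mono_set hζ.integrable (.of_forall fun x => sub_nonneg.2 (hζ.le_one x))
      Ioc_subset_Ioi_self.eventuallyLE
  rw [levyExponent_one]
  simp only [integral_const, MeasurableSet.univ, measureReal_restrict_apply, univ_inter,
    Real.volume_real_Ioc_of_le hh, sub_zero, smul_eq_mul] at h1
  linarith

/-- Above `H` one factor of the square is at most `C / H`, and the other has integral at most `C`.
-/
theorem IsJumpProfile.integral_sq_highPart_le (hζ : IsJumpProfile ζ) (hmono : Monotone ζ)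
    (hd : 0 ≤ d) {H : ℝ} (hH : 0 < H) {C : ℝ} (hC : levyExponent d ζ 1 ≤ C) :
    ∫ h in Ioi 0, (1 - highProfile H ζ h) ^ 2 ≤ C ^ 2 / H := by
  have hC0 : 0 ≤ C := (levyExponent_nonneg hd hζ 1).trans hC
  have h1 : ∀ h ∈ Ioi (0 : ℝ), (1 - highProfile H ζ h) ^ 2 ≤ C / H * (1 - ζ h) := by
    intro h hh
    have h0 := hζ.le_one h
    unfold highProfile
    split_ifs with hhH
    · have : 0 ≤ C / H * (1 - ζ h) := mul_nonneg (by positivity) (by linarith)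
      simpa using this
    · push Not at hhH
      have h2 : H * (1 - ζ h) ≤ C :=
        (mul_le_mul_of_nonneg_right hhH.le (by linarith)).trans
          ((hζ.mul_one_sub_le hmono hd (le_of_lt hh)).trans hC)
      have h3 : 1 - ζ h ≤ C / H := by rw [le_div_iff₀ hH]; linarith
      rw [sq]
      exact mul_le_mul_of_nonneg_right h3 (by linarith)
  calc ∫ h in Ioi 0, (1 - highProfile H ζ h) ^ 2
      ≤ ∫ h in Ioi 0, C / H * (1 - ζ h) :=
        setIntegral_mono_on (hζ.highPart H).integrable_sq (hζ.integrable.const_mul _)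
          measurableSet_Ioi h1
    _ = C / H * ∫ h in Ioi 0, (1 - ζ h) := integral_const_mul _ _
    _ ≤ C / H * C := by
        rw [levyExponent_one] at hC
        gcongr
        linarith
    _ = C ^ 2 / H := by ring

theorem IsJumpProfile.levyExponent_highPart_le (hζ : IsJumpProfile ζ) (d H : ℝ) :
    levyExponent d (highProfile H ζ) 1 ≤ levyExponent d ζ 1 := by
  rw [hζ.levyExponent_highPart]
  have : 0 ≤ ∫ h in Ioc 0 H, (1 - ζ h) := integral_nonneg fun h => sub_nonneg.2 (hζ.le_one h)
  linarith

/-- The process with small jumps only is uniformly close to an exponential function. -/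
theorem IsJumpProfile.exists_highPart_le (hζ : IsJumpProfile ζ) (hmono : Monotone ζ)
    (hd : 0 ≤ d) {C : ℝ} (hC : levyExponent d ζ 1 ≤ C) (T m : ℕ) (hm : 0 < m) :
    ∃ f : (ℕ → ℕ × (ℕ → ℝ × ℝ)) → ENNReal, Measurable f ∧
      (∀ q : ℝ, 0 ≤ q → q ≤ T → ∀ ω,
        ENNReal.ofReal |levyZ d (highProfile (m ^ 4) ζ) q ω -
          Real.exp (-(q * levyExponent d (highProfile (m ^ 4) ζ) 1))| ≤ f ω) ∧
      ∫⁻ ω, f ω ∂quadrantLaw ≤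
        ENNReal.ofReal (((T + 2) * ((T + 1) * C ^ 2 + 1) + C) / m) := by
  have hm' : (1 : ℝ) ≤ m := by exact_mod_cast hm
  have hm0 : (0 : ℝ) < m := by linarith
  have hC0 : 0 ≤ C := (levyExponent_nonneg hd hζ 1).trans hC
  -- The height `m ^ 4` makes the variance of order `m ^ (-4)`; with `c = m ^ (-2)` each of the
  -- roughly `T m` grid points costs order `m ^ (-2)`, and the oscillation is at most `C / m`. The
  -- total is of order `1 / m`.
  obtain ⟨f, hf, hfle, hfint⟩ := (hζ.highPart (m ^ 4)).exists_le_of_small_jumps hd T m hm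
    (c := 1 / m ^ 2) (by positivity)
  refine ⟨f, hf, hfle, hfint.trans (ENNReal.ofReal_le_ofReal ?_)⟩
  have hv := hζ.integral_sq_highPart_le hmono hd (H := m ^ 4) (by positivity) hC
  have hb := (hζ.levyExponent_highPart_le d (m ^ 4)).trans hC
  calc (T * m + 2) * ((T + 1) * (∫ h in Ioi 0, (1 - highProfile (m ^ 4) ζ h) ^ 2) /
        (1 / (m : ℝ) ^ 2) + 1 / (m : ℝ) ^ 2) + levyExponent d (highProfile (m ^ 4) ζ) 1 / m
      ≤ (T * m + 2 * m) * ((T + 1) * (C ^ 2 / (m : ℝ) ^ 4) /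
        (1 / (m : ℝ) ^ 2) + 1 / (m : ℝ) ^ 2) + C / m := by
        gcongr
        linarith
    _ = ((T + 2) * ((T + 1) * C ^ 2 + 1) + C) / m := by
        field_simp

theorem abs_mul_sub_mul_le {a b a' b' : ℝ} (ha0 : 0 ≤ a') (ha1 : a' ≤ 1) (hb0 : 0 ≤ b)
    (hb1 : b ≤ 1) : |a * b - a' * b'| ≤ |a - a'| + |b - b'| := by
  calc |a * b - a' * b'| = |(a - a') * b + a' * (b - b')| := by ring_nf
    _ ≤ |(a - a') * b| + |a' * (b - b')| := abs_add_le _ _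
    _ ≤ |a - a'| + |b - b'| := by
      rw [abs_mul, abs_mul, abs_of_nonneg hb0, abs_of_nonneg ha0]
      gcongr
      · exact mul_le_of_le_one_right (abs_nonneg _) hb1
      · exact mul_le_of_le_one_left (abs_nonneg _) ha1

theorem abs_exp_neg_sub_exp_neg_le {a b : ℝ} (ha : 0 ≤ a) (hb : 0 ≤ b) :
    |Real.exp (-a) - Real.exp (-b)| ≤ |a - b| := by
  have key : ∀ a b : ℝ, 0 ≤ a → Real.exp (-a) - Real.exp (-b) ≤ |a - b| := by
    intro a b ha
    have h1 : Real.exp (-b) = Real.exp (-a) * Real.exp (a - b) := by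
      rw [← Real.exp_add]; ring_nf
    have h2 := Real.add_one_le_exp (a - b)
    have h3 : Real.exp (-a) ≤ 1 := Real.exp_le_one_iff.2 (by linarith)
    have h4 := Real.exp_pos (-a)
    rw [h1]
    nlinarith [neg_abs_le (a - b), abs_nonneg (a - b)]
  refine abs_sub_le_iff.2 ⟨key a b ha, ?_⟩
  rw [abs_sub_comm]
  exact key b a hb

variable {d' : ℝ} {ζ' : ℝ → ℝ}

/-- The expected uniform distance of two multiplicative subordinators that are driven by the same
Poisson process. -/
theorem lintegral_iSup_levyZ_le (hζ : IsJumpProfile ζ) (hmono : Monotone ζ) (hd : 0 ≤ d)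
    (hζ' : IsJumpProfile ζ') (hmono' : Monotone ζ') (hd' : 0 ≤ d') {C : ℝ}
    (hC : levyExponent d ζ 1 ≤ C) (hC' : levyExponent d' ζ' 1 ≤ C) (T m : ℕ) (hm : 0 < m) :
    ∫⁻ ω, ⨆ q : ℚ≥0, ⨆ _ : (q : ℝ) ≤ T, ENNReal.ofReal |levyZ d ζ q ω - levyZ d' ζ' q ω|
        ∂quadrantLaw ≤
      T * (∫⁻ h in Ioc 0 ((m : ℝ) ^ 4), ENNReal.ofReal |ζ h - ζ' h|) +
      2 * ENNReal.ofReal (((T + 2) * ((T + 1) * C ^ 2 + 1) + C) / m) +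
      ENNReal.ofReal (T * |levyExponent d (highProfile (m ^ 4) ζ) 1 -
        levyExponent d' (highProfile (m ^ 4) ζ') 1|) := by
  set H : ℝ := (m : ℝ) ^ 4
  set K := ENNReal.ofReal (((T + 2) * ((T + 1) * C ^ 2 + 1) + C) / m)
  set β := levyExponent d (highProfile H ζ) 1
  set β' := levyExponent d' (highProfile H ζ') 1
  obtain ⟨f, hf, hfle, hfint⟩ := hζ.exists_highPart_le hmono hd hC T m hm
  obtain ⟨f', hf', hfle', hfint'⟩ := hζ'.exists_highPart_le hmono' hd' hC' T m hm
  -- The cost of a single point: the large-jump factors of the two processes can differ only at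
  -- points with time at most `T` and height at most `H`.
  set g : ℝ × ℝ → ENNReal := fun p =>
    (Iic (T : ℝ)).indicator 1 p.1 * (Iic H).indicator (fun h => ENNReal.ofReal |ζ h - ζ' h|) p.2
    with hg
  have hm1 : Measurable ((Iic (T : ℝ)).indicator (1 : ℝ → ENNReal)) :=
    measurable_one.indicator measurableSet_Iic
  have hm2 : Measurable ((Iic H).indicator fun h => ENNReal.ofReal |ζ h - ζ' h|) :=
    ((hζ.measurable.sub hζ'.measurable).abs.ennreal_ofReal).indicator measurableSet_Iic
  have hgm : Measurable g := (hm1.comp measurable_fst).mul (hm2.comp measurable_snd)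
  have hgint : ∫⁻ ω, poissonSum g ω ∂quadrantLaw =
      T * ∫⁻ h in Ioc 0 H, ENNReal.ofReal |ζ h - ζ' h| := by
    rw [quadrantLaw, lintegral_poissonSum _ hgm, sum_restrict_quadrantCell,
      lintegral_prod_mul hm1.aemeasurable hm2.aemeasurable,
      lintegral_indicator measurableSet_Iic, lintegral_indicator measurableSet_Iic,
      Measure.restrict_restrict measurableSet_Iic, Measure.restrict_restrict measurableSet_Iic,
      Iic_inter_Ioi, Iic_inter_Ioi]
    simp
  calc _ ≤ ∫⁻ ω, ((poissonSum g ω + f ω) + f' ω) + ENNReal.ofReal (T * |β - β'|) ∂quadrantLaw := by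
        refine lintegral_mono fun ω => iSup₂_le fun q hqT => ?_
        have hq : (0 : ℝ) ≤ q := by positivity
        have h1 : |levyZ d ζ q ω - levyZ d' ζ' q ω| ≤
            |poissonProd (jumpFactor (lowProfile H ζ) q) ω -
              poissonProd (jumpFactor (lowProfile H ζ') q) ω| +
            |levyZ d (highProfile H ζ) q ω - Real.exp (-(q * β))| +
            |levyZ d' (highProfile H ζ') q ω - Real.exp (-(q * β'))| + T * |β - β'| := by
          rw [hζ.levyZ_eq_mul d H q ω, hζ'.levyZ_eq_mul d' H q ω]
          refine (abs_mul_sub_mul_le ((hζ'.lowPart H).levyZ_nonneg _ _ _)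
            ((hζ'.lowPart H).levyZ_le_one le_rfl hq _) ((hζ.highPart H).levyZ_nonneg _ _ _)
            ((hζ.highPart H).levyZ_le_one hd hq _)).trans ?_
          have h2 : |levyZ 0 (lowProfile H ζ) q ω - levyZ 0 (lowProfile H ζ') q ω| =
              |poissonProd (jumpFactor (lowProfile H ζ) q) ω -
              poissonProd (jumpFactor (lowProfile H ζ') q) ω| := by simp [levyZ]
          have h3 : |Real.exp (-(q * β)) - Real.exp (-(q * β'))| ≤ T * |β - β'| := by
            refine (abs_exp_neg_sub_exp_neg_le
              (mul_nonneg hq (levyExponent_nonneg hd (hζ.highPart H) 1))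
              (mul_nonneg hq (levyExponent_nonneg hd' (hζ'.highPart H) 1))).trans ?_
            rw [← mul_sub, abs_mul, abs_of_nonneg hq]
            gcongr
          rw [h2]
          have h4 := abs_sub_le (levyZ d (highProfile H ζ) q ω) (Real.exp (-(q * β)))
            (levyZ d' (highProfile H ζ') q ω)
          have h5 := abs_sub_le (Real.exp (-(q * β))) (Real.exp (-(q * β')))
            (levyZ d' (highProfile H ζ') q ω)
          rw [abs_sub_comm (Real.exp (-(q * β')))] at h5
          linarith
        refine (ENNReal.ofReal_le_ofReal h1).trans ?_
        rw [ENNReal.ofReal_add (by positivity) (by positivity),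
          ENNReal.ofReal_add (by positivity) (by positivity),
          ENNReal.ofReal_add (by positivity) (by positivity)]
        refine add_le_add (add_le_add (add_le_add ?_ (hfle q hq hqT ω)) (hfle' q hq hqT ω)) le_rfl
        refine ofReal_abs_poissonProd_sub_le ((hζ.lowPart H).jumpFactor_nonneg _)
          ((hζ.lowPart H).jumpFactor_le_one _) ((hζ'.lowPart H).jumpFactor_nonneg _)
          ((hζ'.lowPart H).jumpFactor_le_one _) (fun p => ?_) ω
        unfold jumpFactor lowProfile
        by_cases hp1 : p.1 ≤ q
        · by_cases hp2 : p.2 ≤ H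
          · simp [hg, hp1, hp2, hp1.trans hqT]
          · simp [hp1, hp2]
        · simp [hp1]
    _ ≤ _ := by
        rw [lintegral_add_right _ measurable_const, lintegral_add_right _ hf',
          lintegral_add_right _ hf, hgint, lintegral_const, measure_univ, mul_one, two_mul,
          ← add_assoc]
        gcongr

/-- Multiplicative subordinators that are driven by the same Poisson process converge locally
uniformly in mean if their jump profiles converge almost everywhere and their exponents
converge. -/
theorem tendsto_lintegral_iSup_levyZ {ds : ℕ → ℝ} {ζs : ℕ → ℝ → ℝ}
    (hds : ∀ n, 0 ≤ ds n) (hζs : ∀ n, IsJumpProfile (ζs n)) (hmonos : ∀ n, Monotone (ζs n))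
    (hd : 0 ≤ d) (hζ : IsJumpProfile ζ) (hmono : Monotone ζ)
    (hlim : ∀ᵐ h ∂(volume.restrict (Ioi (0 : ℝ))), Tendsto (fun n => ζs n h) atTop (𝓝 (ζ h)))
    (hβ : Tendsto (fun n => levyExponent (ds n) (ζs n) 1) atTop (𝓝 (levyExponent d ζ 1)))
    (T : ℕ) :
    Tendsto (fun n => ∫⁻ ω, ⨆ q : ℚ≥0, ⨆ _ : (q : ℝ) ≤ T,
      ENNReal.ofReal |levyZ (ds n) (ζs n) q ω - levyZ d ζ q ω| ∂quadrantLaw) atTop (𝓝 0) := by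
  obtain ⟨C₀, hC₀⟩ := hβ.bddAbove_range
  set C := max C₀ (levyExponent d ζ 1) with hCdef
  have hCs : ∀ n, levyExponent (ds n) (ζs n) 1 ≤ C := fun n =>
    (hC₀ ⟨n, rfl⟩).trans (le_max_left _ _)
  set K := (T + 2) * ((T + 1) * C ^ 2 + 1) + C
  have hbound := fun (m : ℕ) (hm : 0 < m) n => lintegral_iSup_levyZ_le (hζs n) (hmonos n) (hds n)
    hζ hmono hd (hCs n) (le_max_right _ _) T m hm
  have hIoc : ∀ m : ℕ, ∀ᵐ h ∂(volume.restrict (Ioc (0 : ℝ) ((m : ℝ) ^ 4))),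
      Tendsto (fun n => ζs n h) atTop (𝓝 (ζ h)) := fun m =>
    ae_restrict_of_ae_restrict_of_subset Ioc_subset_Ioi_self hlim
  have hfirst : ∀ m : ℕ, Tendsto (fun n => ∫⁻ h in Ioc 0 ((m : ℝ) ^ 4),
      ENNReal.ofReal |ζs n h - ζ h|) atTop (𝓝 0) := by
    intro m
    have := tendsto_lintegral_of_dominated_convergence
      (μ := volume.restrict (Ioc (0 : ℝ) ((m : ℝ) ^ 4)))
      (F := fun n h => ENNReal.ofReal |ζs n h - ζ h|) (f := fun _ => 0) (fun _ => 1)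
      (fun n => ((hζs n).measurable.sub hζ.measurable).abs.ennreal_ofReal)
      (fun n => .of_forall fun h => ?_) (by simp) ?_
    · simpa using this
    · rw [ENNReal.ofReal_le_one, abs_le]
      constructor <;> linarith [(hζs n).nonneg h, (hζs n).le_one h, hζ.nonneg h, hζ.le_one h]
    · filter_upwards [hIoc m] with h hh
      have h0 : Tendsto (fun n => |ζs n h - ζ h|) atTop (𝓝 0) := by
        have := (hh.sub_const (ζ h)).abs
        simpa using this
      have := (ENNReal.continuous_ofReal.tendsto _).comp h0
      simpa [Function.comp_def] using this
  have hthird : ∀ m : ℕ, Tendsto (fun n => ENNReal.ofReal (T * |levyExponent (ds n)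
      (highProfile ((m : ℝ) ^ 4) (ζs n)) 1 - levyExponent d (highProfile ((m : ℝ) ^ 4) ζ) 1|))
      atTop (𝓝 0) := by
    intro m
    have hI : Tendsto (fun n => ∫ h in Ioc 0 ((m : ℝ) ^ 4), (1 - ζs n h)) atTop
        (𝓝 (∫ h in Ioc 0 ((m : ℝ) ^ 4), (1 - ζ h))) := by
      refine tendsto_integral_of_dominated_convergence (fun _ => 1)
        (fun n => (measurable_const.sub (hζs n).measurable).aestronglyMeasurable)
        (integrable_const _) (fun n => .of_forall fun h => ?_) ?_
      · rw [Real.norm_of_nonneg (sub_nonneg.2 ((hζs n).le_one h))]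
        linarith [(hζs n).nonneg h]
      · filter_upwards [hIoc m] with h hh using hh.const_sub 1
    -- The rate of the small-jump part converges as the full exponent minus an integral over a
    -- bounded range, where dominated convergence applies.
    have hsub := ((hβ.sub hI).sub_const (levyExponent d (highProfile ((m : ℝ) ^ 4) ζ) 1)).abs
    rw [← hζ.levyExponent_highPart, sub_self, abs_zero] at hsub
    have := (ENNReal.continuous_ofReal.tendsto _).comp (hsub.const_mul (T : ℝ))
    simp only [mul_zero, ENNReal.ofReal_zero] at this
    refine this.congr fun n => ?_
    rw [Function.comp, (hζs n).levyExponent_highPart]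
  have hK : Tendsto (fun m : ℕ => 2 * ENNReal.ofReal (K / m)) atTop (𝓝 0) := by
    have h1 := (ENNReal.continuous_ofReal.tendsto _).comp
      (tendsto_const_div_atTop_nhds_zero_nat K)
    have h2 := ENNReal.Tendsto.const_mul (a := 2) h1 (.inr (by simp))
    simpa using h2
  refine ENNReal.tendsto_nhds_zero.2 fun ε hε => ?_
  -- The truncation level is fixed first, from a bound uniform in `n`; the other two terms then
  -- vanish as `n` grows.
  obtain ⟨m, hmε, hm⟩ := (((tendsto_order.1 hK).2 (ε) hε).and (eventually_gt_atTop 0)).exists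
  have hlim2 : Tendsto (fun n => T * (∫⁻ h in Ioc 0 ((m : ℝ) ^ 4), ENNReal.ofReal |ζs n h - ζ h|) +
      2 * ENNReal.ofReal (K / m) + ENNReal.ofReal (T * |levyExponent (ds n)
      (highProfile ((m : ℝ) ^ 4) (ζs n)) 1 - levyExponent d (highProfile ((m : ℝ) ^ 4) ζ) 1|))
      atTop (𝓝 (2 * ENNReal.ofReal (K / m))) := by
    have h1 := ENNReal.Tendsto.const_mul (a := T) (hfirst m) (.inr (by simp))
    have h2 := (h1.add (tendsto_const_nhds (x := 2 * ENNReal.ofReal (K / m)))).add (hthird m)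
    simpa using h2
  filter_upwards [(tendsto_order.1 hlim2).2 ε hmε] with n hn
  exact (hbound m hm n).trans hn.le

end Truncation

/-! ### Helly selection and quantile functions -/

/-- Helly's selection theorem for monotone functions with values in `[0,1]`. -/
theorem exists_subseq_tendsto_of_monotone {ζs : ℕ → ℝ → ℝ} (hmono : ∀ n, Monotone (ζs n))
    (h01 : ∀ n h, ζs n h ∈ Icc (0 : ℝ) 1) :
    ∃ φ : ℕ → ℕ, StrictMono φ ∧ ∃ ζ : ℝ → ℝ, Monotone ζ ∧ (∀ h, ζ h ∈ Icc (0 : ℝ) 1) ∧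
      ∀ᵐ h : ℝ, Tendsto (fun n => ζs (φ n) h) atTop (𝓝 (ζ h)) := by
  -- Compactness of `[0,1] ^ ℚ` replaces the diagonal argument. The limit is extended from the
  -- right, and convergence holds at its continuity points, that is, off a countable set.
  obtain ⟨z, φ, hφ, hz⟩ := CompactSpace.tendsto_subseq
    fun n => fun q : ℚ => (⟨ζs n q, h01 n q⟩ : Icc (0 : ℝ) 1)
  have hzq : ∀ q : ℚ, Tendsto (fun n => ζs (φ n) q) atTop (𝓝 (z q : ℝ)) := fun q =>
    (continuous_subtype_val.tendsto _).comp (tendsto_pi_nhds.1 hz q)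
  have hne : ∀ h : ℝ, Nonempty {q : ℚ // h < q} := fun h =>
    let ⟨q, hq⟩ := exists_rat_gt h; ⟨⟨q, hq⟩⟩
  have hbdd : ∀ h : ℝ, BddBelow (range fun q : {q : ℚ // h < q} => (z q : ℝ)) := fun h =>
    ⟨0, by rintro _ ⟨q, rfl⟩; exact (z q).2.1⟩
  set ζ : ℝ → ℝ := fun h => ⨅ q : {q : ℚ // h < q}, (z q : ℝ) with hζ
  have hle : ∀ {h : ℝ} {q : ℚ}, h < q → ζ h ≤ z q := fun {h q} hq =>
    ciInf_le (hbdd h) (⟨q, hq⟩ : {q : ℚ // h < q})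
  have hmonoζ : Monotone ζ := fun h h' hh => le_ciInf fun q => hle (hh.trans_lt q.2)
  refine ⟨φ, hφ, ζ, hmonoζ, fun h => ⟨le_ciInf fun q => (z q).2.1, ?_⟩, ?_⟩
  · obtain ⟨q⟩ := hne h
    exact (hle q.2).trans (z q).2.2
  filter_upwards [hmonoζ.countable_not_continuousAt.ae_notMem volume] with h hh
  have hcont : ContinuousAt ζ h := not_not.1 hh
  refine tendsto_order.2 ⟨fun a ha => ?_, fun b hb => ?_⟩
  · obtain ⟨h', hh', hah'⟩ : ∃ h' < h, a < ζ h' := by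
      have := (hcont.eventually (lt_mem_nhds ha)).filter_mono (nhdsWithin_le_nhds (s := Iio h))
      exact (this.and self_mem_nhdsWithin).exists.imp fun _ hx => ⟨hx.2, hx.1⟩
    obtain ⟨q, hq1, hq2⟩ := exists_rat_btwn hh'
    filter_upwards [(hzq q).eventually (lt_mem_nhds (hah'.trans_le (hle hq1)))] with n hn
      using hn.trans_le (hmono _ hq2.le)
  · obtain ⟨q, hq⟩ := exists_lt_of_ciInf_lt hb
    filter_upwards [(hzq q).eventually (gt_mem_nhds hq)] with n hn
      using (hmono _ q.2.le).trans_lt hn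

/-- The quantile function of a probability measure on `[0,1]`. -/
theorem exists_monotone_map_eq (μ : Measure ℝ) [IsProbabilityMeasure μ]
    (hμ : ∀ᵐ x ∂μ, x ∈ Icc (0 : ℝ) 1) :
    ∃ Q : ℝ → ℝ, Monotone Q ∧ (∀ u, Q u ∈ Icc (0 : ℝ) 1) ∧
      (volume.restrict (Ioc (0 : ℝ) 1)).map Q = μ := by
  -- The alternative `x = 1` keeps the set nonempty for every real `u`, so that the quantile
  -- function has values in `[0,1]` on the whole line.
  set S : ℝ → Set ℝ := fun u => {x | x ∈ Icc (0 : ℝ) 1 ∧ (u ≤ cdf μ x ∨ x = 1)} with hS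
  have h1S : ∀ u, (1 : ℝ) ∈ S u := fun u => ⟨by simp, .inr rfl⟩
  have hbdd : ∀ u, BddBelow (S u) := fun u => ⟨0, fun x hx => hx.1.1⟩
  set Q : ℝ → ℝ := fun u => sInf (S u)
  have hQ01 : ∀ u, Q u ∈ Icc (0 : ℝ) 1 := fun u =>
    ⟨le_csInf ⟨1, h1S u⟩ fun x hx => hx.1.1, csInf_le (hbdd u) (h1S u)⟩
  have hQm : Monotone Q := fun u v huv => csInf_le_csInf (hbdd u) ⟨1, h1S v⟩
    fun x hx => ⟨hx.1, hx.2.imp_left huv.trans⟩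
  have hiff : ∀ u x : ℝ, x ∈ Ico (0 : ℝ) 1 → (Q u ≤ x ↔ u ≤ cdf μ x) := by
    intro u x hx
    refine ⟨fun h => ?_, fun h => csInf_le (hbdd u) ⟨⟨hx.1, hx.2.le⟩, .inl h⟩⟩
    have hr : Tendsto (cdf μ) (𝓝[>] x) (𝓝 (cdf μ x)) :=
      ((cdf μ).right_continuous x).mono_left (nhdsWithin_mono x Ioi_subset_Ici_self)
    refine ge_of_tendsto hr ?_
    filter_upwards [Ioo_mem_nhdsGT hx.2] with y hy
    obtain ⟨x', hx', hx'y⟩ := exists_lt_of_csInf_lt ⟨1, h1S u⟩ (h.trans_lt hy.1)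
    rcases hx'.2 with h2 | h2
    · exact h2.trans (monotone_cdf μ hx'y.le)
    · exact absurd (h2 ▸ hx'y) (not_lt.2 hy.2.le)
  refine ⟨Q, hQm, hQ01, ?_⟩
  have : IsProbabilityMeasure (volume.restrict (Ioc (0 : ℝ) 1)) := ⟨by simp⟩
  have : IsProbabilityMeasure ((volume.restrict (Ioc (0 : ℝ) 1)).map Q) :=
    Measure.isProbabilityMeasure_map hQm.measurable.aemeasurable
  refine Measure.ext_of_Iic _ _ fun a => ?_
  rw [Measure.map_apply hQm.measurable measurableSet_Iic]
  rcases lt_or_ge a 0 with ha | ha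
  · have h1 : Q ⁻¹' Iic a = ∅ := eq_empty_of_forall_notMem fun u hu =>
      absurd ((hQ01 u).1.trans hu) (not_le.2 ha)
    have h2 : μ (Iic a) = 0 := by
      refine measure_mono_null (fun x hx => ?_) hμ
      exact fun h => absurd (h.1.trans hx) (not_le.2 ha)
    rw [h1, h2, measure_empty]
  rcases lt_or_ge a 1 with ha1 | ha1
  · have h1 : Q ⁻¹' Iic a = Iic (cdf μ a) := by
      ext u; exact hiff u a ⟨ha, ha1⟩
    rw [h1, Measure.restrict_apply measurableSet_Iic, inter_comm, ← ofReal_cdf]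
    have : Ioc (0 : ℝ) 1 ∩ Iic (cdf μ a) = Ioc 0 (cdf μ a) := by
      rw [Ioc_inter_Iic, min_eq_right (cdf_le_one μ a)]
    rw [this, Real.volume_Ioc, sub_zero]
  · have h1 : Q ⁻¹' Iic a = univ := eq_univ_of_forall fun u => (hQ01 u).2.trans ha1
    have h2 : μ (Iic a) = 1 := by
      rw [prob_compl_eq_zero_iff measurableSet_Iic |>.symm]
      refine measure_mono_null (fun x hx => ?_) hμ
      exact fun h => hx (h.2.trans ha1)
    rw [h1, h2, measure_univ]

/-! ### The Lévy–Khintchine representation -/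

theorem sub_one_sub_pow_nonneg {z : ℝ} (h0 : 0 ≤ z) (h1 : z ≤ 1) (k : ℕ) :
    0 ≤ k * (1 - z) - (1 - z ^ k) := sub_nonneg.2 (one_sub_pow_le h0 h1 k)

/-- A quadratic bound is the point: `1 - ζ h` is only known to be of order `1 / h`, which has no
integrable majorant, but its square has one. -/
theorem sub_one_sub_pow_le {z : ℝ} (h0 : 0 ≤ z) (h1 : z ≤ 1) (k : ℕ) :
    k * (1 - z) - (1 - z ^ k) ≤ k ^ 2 * (1 - z) ^ 2 := by
  induction k with
  | zero => simp
  | succ k ih =>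
    have h2 : z ^ k * z ≤ (1 - k * (1 - z) + k ^ 2 * (1 - z) ^ 2) * z :=
      mul_le_mul_of_nonneg_right (by linarith) h0
    have h3 : 0 ≤ (k : ℝ) ^ 2 * (1 - z) ^ 3 := by
      have : 0 ≤ 1 - z := by linarith
      positivity
    have h4 : 0 ≤ (k + 1 : ℝ) * (1 - z) ^ 2 := by positivity
    rw [pow_succ]
    push_cast
    nlinarith

/-- The linear term, which contains the drift, is separated from a second-order remainder to which
dominated convergence applies. -/
theorem IsJumpProfile.levyExponent_eq {d : ℝ} {ζ : ℝ → ℝ} (hζ : IsJumpProfile ζ) (k : ℕ) :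
    levyExponent d ζ k = k * levyExponent d ζ 1 -
      ∫ h in Ioi 0, (k * (1 - ζ h) - (1 - ζ h ^ k)) := by
  rw [integral_sub (hζ.integrable.const_mul _) (hζ.integrable_pow k), integral_const_mul,
    levyExponent_one, levyExponent]
  ring

/-- Compactness: if the exponents of multiplicative subordinators converge, then along a
subsequence the jump profiles converge almost everywhere, and the limit is the exponent of a
multiplicative subordinator. -/
theorem exists_subseq_levyExponent {ds : ℕ → ℝ} {ζs : ℕ → ℝ → ℝ} {Φ : ℕ → ℝ}
    (hds : ∀ n, 0 ≤ ds n) (hζs : ∀ n, IsJumpProfile (ζs n)) (hmonos : ∀ n, Monotone (ζs n))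
    (hΦ : ∀ k, Tendsto (fun n => levyExponent (ds n) (ζs n) k) atTop (𝓝 (Φ k))) :
    ∃ φ : ℕ → ℕ, StrictMono φ ∧ ∃ (d : ℝ) (ζ : ℝ → ℝ), 0 ≤ d ∧ IsJumpProfile ζ ∧ Monotone ζ ∧
      levyExponent d ζ = Φ ∧
      ∀ᵐ h ∂(volume.restrict (Ioi (0 : ℝ))),
        Tendsto (fun n => ζs (φ n) h) atTop (𝓝 (ζ h)) := by
  obtain ⟨φ, hφ, ζ, hmono, h01, hlim⟩ := exists_subseq_tendsto_of_monotone hmonos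
    fun n h => ⟨(hζs n).nonneg h, (hζs n).le_one h⟩
  have hlim' : ∀ᵐ h ∂(volume.restrict (Ioi (0 : ℝ))),
      Tendsto (fun n => ζs (φ n) h) atTop (𝓝 (ζ h)) := ae_restrict_of_ae hlim
  have hΦ' : ∀ k, Tendsto (fun n => levyExponent (ds (φ n)) (ζs (φ n)) k) atTop (𝓝 (Φ k)) :=
    fun k => (hΦ k).comp hφ.tendsto_atTop
  have hmeas : Measurable ζ := hmono.measurable
  -- Only an inequality can be expected here: mass of `1 - ζs` may escape to large heights, that is,
  -- to many tiny jumps, and the drifts contribute to `Φ 1` as well.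
  have hfatou : ∫⁻ h in Ioi 0, ENNReal.ofReal (1 - ζ h) ≤ ENNReal.ofReal (Φ 1) := by
    calc ∫⁻ h in Ioi 0, ENNReal.ofReal (1 - ζ h)
        = ∫⁻ h in Ioi 0, liminf (fun n => ENNReal.ofReal (1 - ζs (φ n) h)) atTop := by
          refine lintegral_congr_ae ?_
          filter_upwards [hlim'] with h hh
          exact (((ENNReal.continuous_ofReal.tendsto _).comp (hh.const_sub 1)).liminf_eq).symm
      _ ≤ liminf (fun n => ∫⁻ h in Ioi 0, ENNReal.ofReal (1 - ζs (φ n) h)) atTop :=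
          lintegral_liminf_le fun n => (measurable_const.sub (hζs _).measurable).ennreal_ofReal
      _ ≤ liminf (fun n => ENNReal.ofReal (levyExponent (ds (φ n)) (ζs (φ n)) 1)) atTop := by
          refine liminf_le_liminf (.of_forall fun n => ?_)
          rw [← ofReal_integral_eq_lintegral_ofReal (hζs (φ n)).integrable
            (.of_forall fun h => sub_nonneg.2 ((hζs (φ n)).le_one h)), levyExponent_one]
          exact ENNReal.ofReal_le_ofReal (le_add_of_nonneg_left (hds _))
      _ = ENNReal.ofReal (Φ 1) :=
          ((ENNReal.continuous_ofReal.tendsto _).comp (hΦ' 1)).liminf_eq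
  have hζ : IsJumpProfile ζ := by
    refine ⟨hmeas, fun h => (h01 h).1, fun h => (h01 h).2,
      (measurable_const.sub hmeas).aestronglyMeasurable, ?_⟩
    rw [hasFiniteIntegral_iff_ofReal (.of_forall fun h => sub_nonneg.2 (h01 h).2)]
    exact hfatou.trans_lt ENNReal.ofReal_lt_top
  have hΦ0 : 0 ≤ Φ 1 := ge_of_tendsto' (hΦ 1) fun n => levyExponent_nonneg (hds n) (hζs n) 1
  have hd : ∫ h in Ioi 0, (1 - ζ h) ≤ Φ 1 := by
    rw [← ofReal_integral_eq_lintegral_ofReal hζ.integrable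
      (.of_forall fun h => sub_nonneg.2 (h01 h).2)] at hfatou
    exact (ENNReal.ofReal_le_ofReal_iff hΦ0).1 hfatou
  -- The limit drift collects the prelimit drifts and the escaped mass; it is defined so that the
  -- exponents agree at `1`.
  refine ⟨φ, hφ, Φ 1 - ∫ h in Ioi 0, (1 - ζ h), ζ, sub_nonneg.2 hd, hζ, hmono, ?_, hlim'⟩
  funext k
  obtain ⟨C, hC⟩ := (hΦ' 1).bddAbove_range
  have hCn : ∀ n, levyExponent (ds (φ n)) (ζs (φ n)) 1 ≤ C := fun n => hC ⟨n, rfl⟩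
  have hI : Tendsto (fun n => ∫ h in Ioi 0, (k * (1 - ζs (φ n) h) - (1 - ζs (φ n) h ^ k))) atTop
      (𝓝 (∫ h in Ioi 0, (k * (1 - ζ h) - (1 - ζ h ^ k)))) := by
    refine tendsto_integral_of_dominated_convergence
      -- From `1 - ζs ≤ 1` and `h * (1 - ζs) ≤ C` it follows that `(1 - ζs) ^ 2 * (1 + h ^ 2) ≤ 1 +
      -- C ^ 2`.
      (fun h => (k : ℝ) ^ 2 * ((1 + C ^ 2) * (1 + h ^ 2)⁻¹)) (fun n => ?_) ?_ (fun n => ?_) ?_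
    · exact (((measurable_const.sub (hζs _).measurable).const_mul _).sub
        (measurable_const.sub ((hζs _).measurable.pow_const k))).aestronglyMeasurable
    · exact ((integrable_inv_one_add_sq.const_mul _).const_mul _).integrableOn
    · refine (ae_restrict_mem measurableSet_Ioi).mono fun h hh => ?_
      have hz0 := (hζs (φ n)).nonneg h
      have hz1 := (hζs (φ n)).le_one h
      rw [Real.norm_of_nonneg (sub_one_sub_pow_nonneg hz0 hz1 k)]
      refine (sub_one_sub_pow_le hz0 hz1 k).trans ?_
      gcongr
      rw [← div_eq_mul_inv, le_div_iff₀ (by positivity)]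
      have h1 := ((hζs (φ n)).mul_one_sub_le (hmonos _) (hds _) (le_of_lt hh)).trans (hCn n)
      have h2 : 0 ≤ h * (1 - ζs (φ n) h) := mul_nonneg (le_of_lt hh) (by linarith)
      nlinarith
    · filter_upwards [hlim'] with h hh
      exact ((hh.const_sub 1).const_mul _).sub ((hh.pow k).const_sub 1)
  have h1 : levyExponent (Φ 1 - ∫ h in Ioi 0, (1 - ζ h)) ζ 1 = Φ 1 := by
    rw [levyExponent_one]; ring
  rw [hζ.levyExponent_eq, h1]
  refine tendsto_nhds_unique ?_ (hΦ' k)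
  simp_rw [fun n => (hζs (φ n)).levyExponent_eq (d := ds (φ n)) k]
  exact ((hΦ' 1).const_mul _).sub hI

/-- A sequence of moments all of whose roots are moments of laws on `[0,1]` belongs to a
multiplicative subordinator. -/
theorem exists_levyExponent_eq {Φ : ℕ → ℝ} (μ : ℕ → Measure ℝ) [∀ m, IsProbabilityMeasure (μ m)]
    (hμ : ∀ m, ∀ᵐ x ∂(μ m), x ∈ Icc (0 : ℝ) 1)
    (hΦ : ∀ m k : ℕ, ∫ x, x ^ k ∂(μ m) = Real.exp (-(Φ k / (m + 1)))) :
    ∃ (d : ℝ) (ζ : ℝ → ℝ), 0 ≤ d ∧ IsJumpProfile ζ ∧ Monotone ζ ∧ levyExponent d ζ = Φ := by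
  choose Q hQm hQ01 hQ using fun m => exists_monotone_map_eq (μ m) (hμ m)
  -- Compound Poisson approximation: jumps at rate `m + 1` with multiplicative law `μ m`, realized
  -- by its quantile function stretched over `(0, m + 1]`. Its exponent `(m + 1) (1 - exp (-Φ k / (m
  -- + 1)))` tends to `Φ k`. The value for `h ≤ 0` only serves monotonicity.
  set ζs : ℕ → ℝ → ℝ := fun m h => if h ≤ 0 then 0 else if h ≤ m + 1 then Q m (h / (m + 1)) else 1
    with hζs
  have h01 : ∀ m h, ζs m h ∈ Icc (0 : ℝ) 1 := by
    intro m h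
    simp only [hζs]
    split_ifs
    exacts [by simp, hQ01 _ _, by simp]
  have hmono : ∀ m, Monotone (ζs m) := by
    intro m h h' hh
    have hm : (0 : ℝ) < m + 1 := by positivity
    by_cases h1 : h ≤ 0
    · have : ζs m h = 0 := by simp [hζs, h1]
      rw [this]; exact (h01 m h').1
    by_cases h2 : h' ≤ m + 1
    · have h3 : ζs m h = Q m (h / (m + 1)) := by simp [hζs, h1, hh.trans h2]
      have h4 : ζs m h' = Q m (h' / (m + 1)) := by
        simp [hζs, h2, show ¬ h' ≤ 0 from fun h => h1 (hh.trans h)]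
      rw [h3, h4]
      exact hQm m (by gcongr)
    · have : ζs m h' = 1 := by
        simp [hζs, h2, show ¬ h' ≤ 0 from fun h => h1 (hh.trans h)]
      rw [this]; exact (h01 m h).2
  have hind : ∀ (m k : ℕ) (h : ℝ), h ∈ Ioi (0 : ℝ) → 1 - ζs m h ^ k =
      (Iic ((m : ℝ) + 1)).indicator (fun h => 1 - Q m (h / (m + 1)) ^ k) h := by
    intro m k h hh
    have h1 : ¬ h ≤ 0 := not_le.2 hh
    by_cases h2 : h ≤ m + 1 <;> simp [hζs, h1, h2]
  have hint : ∀ m k : ℕ, IntegrableOn (fun h => 1 - Q m (h / (m + 1)) ^ k)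
      (Ioc 0 ((m : ℝ) + 1)) := by
    intro m k
    refine Integrable.of_bound ((measurable_const.sub
      (((hQm m).measurable.comp (measurable_id.div_const _)).pow_const k)).aestronglyMeasurable) 1
      (.of_forall fun h => ?_)
    have h0 := pow_nonneg (hQ01 m (h / (m + 1))).1 k
    have h1 := pow_le_one₀ (n := k) (hQ01 m (h / (m + 1))).1 (hQ01 m (h / (m + 1))).2
    rw [Real.norm_of_nonneg (sub_nonneg.2 h1)]
    linarith
  have hprof : ∀ m, IsJumpProfile (ζs m) := by
    intro m
    refine ⟨(hmono m).measurable, fun h => (h01 m h).1, fun h => (h01 m h).2, ?_⟩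
    have := hind m 1
    simp only [pow_one] at this
    rw [integrableOn_congr_fun this measurableSet_Ioi, IntegrableOn,
      integrable_indicator_iff measurableSet_Iic, IntegrableOn,
      Measure.restrict_restrict measurableSet_Iic, Iic_inter_Ioi]
    have hm1 := hint m 1
    simp only [pow_one] at hm1
    exact hm1
  have hexp : ∀ m k : ℕ, levyExponent 0 (ζs m) k = (m + 1) * (1 - Real.exp (-(Φ k / (m + 1)))) := by
    intro m k
    have hm : (0 : ℝ) < m + 1 := by positivity
    have hQmom : ∫ u in Ioc (0 : ℝ) 1, Q m u ^ k = Real.exp (-(Φ k / (m + 1))) := by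
      rw [← hΦ m k, ← hQ m, integral_map (f := fun x : ℝ => x ^ k) (hQm m).measurable.aemeasurable
        (measurable_id.pow_const k).aestronglyMeasurable]
    have hQint : IntegrableOn (fun u => Q m u ^ k) (Ioc (0 : ℝ) 1) :=
      Integrable.of_bound ((hQm m).measurable.pow_const k).aestronglyMeasurable 1
        (.of_forall fun u => by
          rw [Real.norm_of_nonneg (pow_nonneg (hQ01 m u).1 k)]
          exact pow_le_one₀ (hQ01 m u).1 (hQ01 m u).2)
    rw [levyExponent, zero_mul, zero_add, setIntegral_congr_fun measurableSet_Ioi (hind m k),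
      integral_indicator measurableSet_Iic, Measure.restrict_restrict measurableSet_Iic,
      Iic_inter_Ioi, ← intervalIntegral.integral_of_le hm.le,
      intervalIntegral.integral_comp_div (fun u => 1 - Q m u ^ k) hm.ne', zero_div,
      div_self hm.ne', intervalIntegral.integral_of_le zero_le_one,
      integral_sub (integrable_const _) hQint, hQmom]
    simp
  have hlim : ∀ k, Tendsto (fun m => levyExponent 0 (ζs m) k) atTop (𝓝 (Φ k)) := by
    intro k
    simp_rw [hexp]
    have h1 : Tendsto (fun m : ℕ => (m : ℝ) + 1) atTop atTop :=
      tendsto_atTop_add_const_right _ _ tendsto_natCast_atTop_atTop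
    have h2 : Tendsto (fun m : ℕ => Φ k ^ 2 / ((m : ℝ) + 1)) atTop (𝓝 0) :=
      tendsto_const_nhds.div_atTop h1
    have h3 : Tendsto (fun m : ℕ => |Φ k| / ((m : ℝ) + 1)) atTop (𝓝 0) :=
      tendsto_const_nhds.div_atTop h1
    refine tendsto_iff_norm_sub_tendsto_zero.2 (squeeze_zero' (.of_forall fun _ => norm_nonneg _)
      ?_ h2)
    filter_upwards [h3.eventually (Iic_mem_nhds zero_lt_one)] with m hm
    have hm0 : (0 : ℝ) < m + 1 := by positivity
    have h4 : |-(Φ k / (m + 1))| ≤ 1 := by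
      rw [abs_neg, abs_div, abs_of_pos hm0]; exact hm
    have h5 := Real.abs_exp_sub_one_sub_id_le h4
    have h6 : (m + 1) * (1 - Real.exp (-(Φ k / (m + 1)))) - Φ k =
        -((m + 1) * (Real.exp (-(Φ k / (m + 1))) - 1 - -(Φ k / (m + 1)))) := by
      field_simp; ring
    rw [h6, norm_neg, norm_mul, Real.norm_of_nonneg hm0.le, Real.norm_eq_abs]
    calc (m + 1) * |Real.exp (-(Φ k / (m + 1))) - 1 - -(Φ k / (m + 1))|
        ≤ (m + 1) * (-(Φ k / (m + 1))) ^ 2 := by gcongr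
      _ = Φ k ^ 2 / (m + 1) := by field_simp
  obtain ⟨φ, -, d, ζ, hd, hζ, hm, hΦeq, -⟩ :=
    exists_subseq_levyExponent (fun _ => le_rfl) hprof hmono hlim
  exact ⟨d, ζ, hd, hζ, hm, hΦeq⟩

/-! ### Laws on cubes are determined by their moments -/

/-- The algebra of polynomial functions on the cube `[0,1]^ι`. -/
noncomputable def cubePolynomials (ι : Type*) :
    StarSubalgebra ℝ ((ι → Icc (0 : ℝ) 1) →ᵇ ℝ) where
  carrier := {f | ∃ p : MvPolynomial ι ℝ, ∀ x, f x = MvPolynomial.eval (fun i => (x i : ℝ)) p}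
  mul_mem' := by
    rintro f g ⟨p, hp⟩ ⟨q, hq⟩
    exact ⟨p * q, fun x => by simp [hp, hq]⟩
  add_mem' := by
    rintro f g ⟨p, hp⟩ ⟨q, hq⟩
    exact ⟨p + q, fun x => by simp [hp, hq]⟩
  algebraMap_mem' r := ⟨MvPolynomial.C r, fun x => by simp⟩
  star_mem' := by
    rintro f ⟨p, hp⟩
    exact ⟨p, fun x => by simpa using hp x⟩

/-- The coordinates separate the points of the cube, so the polynomial functions determine a
measure, and their integrals are finite combinations of mixed moments. -/
theorem cube_ext {ι : Type*} [Countable ι] {μ ν : Measure (ι → Icc (0 : ℝ) 1)}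
    [IsProbabilityMeasure μ] [IsProbabilityMeasure ν]
    (h : ∀ (s : Finset ι) (k : ι → ℕ),
      ∫ x, ∏ i ∈ s, (x i : ℝ) ^ k i ∂μ = ∫ x, ∏ i ∈ s, (x i : ℝ) ^ k i ∂ν) : μ = ν := by
  have hsep : ((cubePolynomials ι).map
      (BoundedContinuousFunction.toContinuousMapStarₐ ℝ)).SeparatesPoints := by
    intro x y hxy
    obtain ⟨i, hi⟩ := Function.ne_iff.1 hxy
    have hc : Continuous fun x : ι → Icc (0 : ℝ) 1 => (x i : ℝ) := by fun_prop
    refine ⟨_, ⟨_, ⟨BoundedContinuousFunction.mkOfCompact ⟨_, hc⟩, ⟨MvPolynomial.X i, fun x => ?_⟩,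
      rfl⟩, rfl⟩, ?_⟩
    · simp
    · exact fun he => hi (Subtype.ext he)
  refine ext_of_forall_mem_subalgebra_integral_eq_of_polish hsep ?_
  rintro g ⟨p, hp⟩
  simp_rw [hp, MvPolynomial.eval_eq]
  have hint : ∀ (m : Measure (ι → Icc (0 : ℝ) 1)) [IsProbabilityMeasure m] (e : ι →₀ ℕ),
      Integrable (fun x => p.coeff e * ∏ i ∈ e.support, (x i : ℝ) ^ e i) m := by
    intro m _ e
    refine Integrable.const_mul (Integrable.of_bound (C := 1) ?_ (.of_forall fun x => ?_)) _
    · exact (Finset.measurable_fun_prod _ fun i _ =>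
        (measurable_subtype_coe.comp (measurable_pi_apply i)).pow_const _).aestronglyMeasurable
    · rw [Real.norm_of_nonneg (Finset.prod_nonneg fun i _ => pow_nonneg (x i).2.1 _)]
      exact Finset.prod_le_one (fun i _ => pow_nonneg (x i).2.1 _)
        fun i _ => pow_le_one₀ (x i).2.1 (x i).2.2
  rw [integral_finsetSum _ fun e _ => hint μ e, integral_finsetSum _ fun e _ => hint ν e]
  refine Finset.sum_congr rfl fun e _ => ?_
  rw [integral_const_mul, integral_const_mul, h]

/-- Two families of random variables with values in `[0,1]` have the same law if they have the same
joint moments. -/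
theorem map_eq_of_moments {ι Ω Ω' : Type*} [Countable ι] [MeasurableSpace Ω] [MeasurableSpace Ω']
    {P : Measure Ω} {P' : Measure Ω'} [IsProbabilityMeasure P] [IsProbabilityMeasure P']
    {X : ι → Ω → ℝ} {Y : ι → Ω' → ℝ} (hX : ∀ i, Measurable (X i)) (hY : ∀ i, Measurable (Y i))
    (hX1 : ∀ i ω, X i ω ∈ Icc (0 : ℝ) 1) (hY1 : ∀ i ω, Y i ω ∈ Icc (0 : ℝ) 1)
    (h : ∀ (s : Finset ι) (k : ι → ℕ),
      ∫ ω, ∏ i ∈ s, X i ω ^ k i ∂P = ∫ ω, ∏ i ∈ s, Y i ω ^ k i ∂P') :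
    P.map (fun ω i => X i ω) = P'.map (fun ω i => Y i ω) := by
  have hXm : Measurable fun ω i => (⟨X i ω, hX1 i ω⟩ : Icc (0 : ℝ) 1) :=
    measurable_pi_iff.2 fun i => (hX i).subtype_mk
  have hYm : Measurable fun ω i => (⟨Y i ω, hY1 i ω⟩ : Icc (0 : ℝ) 1) :=
    measurable_pi_iff.2 fun i => (hY i).subtype_mk
  have hv : Measurable fun (x : ι → Icc (0 : ℝ) 1) i => (x i : ℝ) := by fun_prop
  have h1 : IsProbabilityMeasure (P.map fun ω i => (⟨X i ω, hX1 i ω⟩ : Icc (0 : ℝ) 1)) :=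
    Measure.isProbabilityMeasure_map hXm.aemeasurable
  have h2 : IsProbabilityMeasure (P'.map fun ω i => (⟨Y i ω, hY1 i ω⟩ : Icc (0 : ℝ) 1)) :=
    Measure.isProbabilityMeasure_map hYm.aemeasurable
  have hmom : ∀ (s : Finset ι) (k : ι → ℕ),
      Measurable fun x : ι → Icc (0 : ℝ) 1 => ∏ i ∈ s, (x i : ℝ) ^ k i := fun s k =>
    Finset.measurable_fun_prod _ fun i _ =>
      (measurable_subtype_coe.comp (measurable_pi_apply i)).pow_const _
  have key : P.map (fun ω i => (⟨X i ω, hX1 i ω⟩ : Icc (0 : ℝ) 1)) =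
      P'.map (fun ω i => (⟨Y i ω, hY1 i ω⟩ : Icc (0 : ℝ) 1)) := by
    refine cube_ext fun s k => ?_
    rw [integral_map hXm.aemeasurable (hmom s k).aestronglyMeasurable,
      integral_map hYm.aemeasurable (hmom s k).aestronglyMeasurable]
    exact h s k
  have := congrArg (fun m => m.map fun (x : ι → Icc (0 : ℝ) 1) i => (x i : ℝ)) key
  simpa only [Measure.map_map hv hXm, Measure.map_map hv hYm, Function.comp_def] using this

/-! ### The law of a subordinator -/

/-- The exponent, at natural numbers, of a nonnegative random variable. -/
noncomputable def logLaplace {Ω : Type*} [MeasurableSpace Ω] (X : Ω → ℝ≥0) (P : Measure Ω)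
    (k : ℕ) : ℝ := -Real.log (∫ ω, Real.exp (-(k * (X ω : ℝ))) ∂P)

section Laplace

variable {Ω : Type*} [MeasurableSpace Ω] {P : Measure Ω} [IsProbabilityMeasure P]

theorem integrable_exp_neg {X : Ω → ℝ≥0} (hX : Measurable X) (k : ℕ) :
    Integrable (fun ω => Real.exp (-(k * (X ω : ℝ)))) P :=
  .of_bound (by fun_prop) 1 (.of_forall fun ω => by
    rw [Real.norm_of_nonneg (Real.exp_pos _).le, Real.exp_le_one_iff]
    have : 0 ≤ (k : ℝ) * (X ω : ℝ) := by positivity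
    linarith)

theorem integral_exp_neg_pos {X : Ω → ℝ≥0} (hX : Measurable X) (k : ℕ) :
    0 < ∫ ω, Real.exp (-(k * (X ω : ℝ))) ∂P := by
  refine (integral_pos_iff_support_of_nonneg (fun _ => (Real.exp_pos _).le)
    (integrable_exp_neg hX k)).2 ?_
  have : Function.support (fun ω => Real.exp (-(k * (X ω : ℝ)))) = univ :=
    eq_univ_of_forall fun ω => (Real.exp_pos _).ne'
  rw [this, measure_univ]
  exact zero_lt_one

theorem logLaplace_zero (X : Ω → ℝ≥0) : logLaplace X P 0 = 0 := by
  simp [logLaplace]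

theorem exp_neg_logLaplace {X : Ω → ℝ≥0} (hX : Measurable X) (k : ℕ) :
    Real.exp (-logLaplace X P k) = ∫ ω, Real.exp (-(k * (X ω : ℝ))) ∂P := by
  rw [logLaplace, neg_neg, Real.exp_log (integral_exp_neg_pos hX k)]

end Laplace

theorem TendstoInDistribution.tendsto_integral_exp_neg {Ω : ℕ → Type*}
    [∀ n, MeasurableSpace (Ω n)] {P : (n : ℕ) → Measure (Ω n)} [∀ n, IsProbabilityMeasure (P n)]
    {Ω' : Type*} [MeasurableSpace Ω'] {P' : Measure Ω'} [IsProbabilityMeasure P']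
    {X : (n : ℕ) → Ω n → ℝ≥0} {Y : Ω' → ℝ≥0} (h : TendstoInDistribution X atTop Y P P') (k : ℕ) :
    Tendsto (fun n => ∫ ω, Real.exp (-(k * (X n ω : ℝ))) ∂(P n)) atTop
      (𝓝 (∫ ω, Real.exp (-(k * (Y ω : ℝ))) ∂P')) := by
  have hc : Continuous fun x : ℝ≥0 => Real.exp (-(k * (x : ℝ))) := by fun_prop
  let f : ℝ≥0 →ᵇ ℝ := BoundedContinuousFunction.ofNormedAddCommGroup _ hc 1 fun x => by
    rw [Real.norm_of_nonneg (Real.exp_pos _).le, Real.exp_le_one_iff]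
    have : 0 ≤ (k : ℝ) * (x : ℝ) := by positivity
    linarith
  have := (ProbabilityMeasure.tendsto_iff_forall_integral_tendsto.1 h.tendsto) f
  refine (this.congr fun n => ?_).trans_eq ?_
  · exact integral_map (h.forall_aemeasurable n) hc.aestronglyMeasurable
  · exact congrArg 𝓝 (integral_map h.aemeasurable_limit hc.aestronglyMeasurable)

namespace IsSubordinator

variable {Ω : Type*} [MeasurableSpace Ω] {P : Measure Ω} [IsProbabilityMeasure P]
  {σ : ℝ≥0 → Ω → ℝ≥0}

/-- Increments over a grid of mesh `δ` are independent and all have the law of `σ δ`; this is the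
only input on the process behind its joint moments at rational times. -/
theorem integral_prod_increments (hσ : IsSubordinator σ P) (δ : ℝ≥0) (c : ℕ → ℕ) (J : ℕ) :
    ∫ ω, ∏ l ∈ Finset.range J,
        Real.exp (-(c l * ((σ ((l + 1 : ℕ) * δ) ω : ℝ) - (σ (l * δ) ω : ℝ)))) ∂P =
      ∏ l ∈ Finset.range J, ∫ ω, Real.exp (-(c l * (σ δ ω : ℝ))) ∂P := by
  have hmono : Monotone fun l : ℕ => (l : ℝ≥0) * δ := fun a b hab => by
    have : (a : ℝ≥0) ≤ b := by exact_mod_cast hab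
    exact mul_le_mul_left this δ
  have hind := (hσ.indep_increments.nat hmono).precomp (g := fun i : Fin J => (i : ℕ))
    Fin.val_injective
  have hm : ∀ s, Measurable fun ω => (σ s ω : ℝ) := fun s => (hσ.measurable s).coe_nnreal_real
  have hf : ∀ i : Fin J, Measurable fun x : ℝ => Real.exp (-(c i * x)) := fun i => by fun_prop
  have := iIndepFun.integral_fun_prod_comp (μ := P) (X := fun (i : Fin J) ω =>
      (σ ((((i : ℕ) + 1 : ℕ) : ℝ≥0) * δ) ω : ℝ) - (σ (((i : ℕ) : ℝ≥0) * δ) ω : ℝ))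
    (f := fun (i : Fin J) x => Real.exp (-(c i * x))) hind (fun i => ((hm _).sub (hm _)).aemeasurable) fun i => (hf i).aestronglyMeasurable
  rw [Finset.prod_range]
  simp only [Finset.prod_range]
  refine this.trans (Finset.prod_congr rfl fun i _ => ?_)
  have hid := (hσ.stationary_increments (i * δ) δ).comp (hf i)
  have h1 : ((i : ℕ) : ℝ≥0) * δ + δ = ((i : ℕ) + 1 : ℕ) * δ := by push_cast; ring
  rw [h1] at hid
  exact hid.integral_eq

theorem sum_increments {g : ℝ≥0 → ℝ≥0} (h0 : g 0 = 0) (δ : ℝ≥0) (j : ℕ) :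
    (g (j * δ) : ℝ) = ∑ l ∈ Finset.range j, ((g ((l + 1 : ℕ) * δ) : ℝ) - (g (l * δ) : ℝ)) := by
  rw [Finset.sum_range_sub (fun l : ℕ => (g (l * δ) : ℝ))]
  simp [h0]

theorem integral_exp_nat_mul (hσ : IsSubordinator σ P) (δ : ℝ≥0) (k n : ℕ) :
    ∫ ω, Real.exp (-(k * (σ (n * δ) ω : ℝ))) ∂P =
      (∫ ω, Real.exp (-(k * (σ δ ω : ℝ))) ∂P) ^ n := by
  have := hσ.integral_prod_increments δ (fun _ => k) n
  rw [Finset.prod_const, Finset.card_range] at this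
  rw [← this]
  refine integral_congr_ae ?_
  filter_upwards [hσ.zero] with ω h0
  rw [← Real.exp_sum, Finset.sum_neg_distrib, ← Finset.mul_sum,
    ← sum_increments (g := fun s => σ s ω) h0]

theorem integral_exp_inv (hσ : IsSubordinator σ P) (M : ℕ) (hM : 0 < M) (k : ℕ) :
    ∫ ω, Real.exp (-(k * (σ (M : ℝ≥0)⁻¹ ω : ℝ))) ∂P =
      Real.exp (-(logLaplace (σ 1) P k / M)) := by
  have hM' : (M : ℝ≥0) ≠ 0 := by exact_mod_cast hM.ne'
  have hMr : (M : ℝ) ≠ 0 := by exact_mod_cast hM.ne'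
  have h1 := hσ.integral_exp_nat_mul (M : ℝ≥0)⁻¹ k M
  rw [mul_inv_cancel₀ hM', ← exp_neg_logLaplace (hσ.measurable 1)] at h1
  refine (pow_left_inj₀ (integral_exp_neg_pos (hσ.measurable _) k).le (Real.exp_pos _).le
    hM.ne').1 ?_
  rw [← h1, ← Real.exp_nat_mul]
  congr 1
  field_simp

theorem integral_exp_natCast (hσ : IsSubordinator σ P) (n k : ℕ) :
    ∫ ω, Real.exp (-(k * (σ n ω : ℝ))) ∂P = Real.exp (-(n * logLaplace (σ 1) P k)) := by
  have := hσ.integral_exp_nat_mul 1 k n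
  rw [mul_one, ← exp_neg_logLaplace (hσ.measurable 1), ← Real.exp_nat_mul] at this
  rw [this]
  congr 1
  ring

/-- A subordinator is almost surely identically zero or unbounded. -/
theorem ae_unbounded_or_zero (hσ : IsSubordinator σ P) :
    ∀ᵐ ω ∂P, (∀ x, ∃ T, x < σ T ω) ∨ ∀ s, σ s ω = 0 := by
  set β := logLaplace (σ 1) P 1 with hβ
  have hval : ∀ n : ℕ, ∫ ω, Real.exp (-(σ n ω : ℝ)) ∂P = Real.exp (-(n * β)) := fun n => by
    simpa using hσ.integral_exp_natCast n 1
  have hint : ∀ n : ℕ, Integrable (fun ω => Real.exp (-(σ n ω : ℝ))) P := fun n => by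
    simpa using integrable_exp_neg (P := P) (hσ.measurable n) 1
  have hle : ∀ (n : ℕ) ω, Real.exp (-(σ n ω : ℝ)) ≤ 1 := fun n ω =>
    Real.exp_le_one_iff.2 (by simp)
  -- The mean of `exp (-σ n)` is `exp (-n β)`. For `β = 0` it forces `σ n = 0` almost surely; for `β
  -- > 0` it tends to `0`, so the infimum of `exp (-σ n)` vanishes almost surely.
  rcases eq_or_ne β 0 with h0 | h0
  · have hz : ∀ n : ℕ, ∀ᵐ ω ∂P, σ n ω = 0 := by
      intro n
      have h1 : ∫ ω, (1 - Real.exp (-(σ n ω : ℝ))) ∂P = 0 := by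
        rw [integral_sub (integrable_const _) (hint n), hval, h0]
        simp
      rw [integral_eq_zero_iff_of_nonneg (fun ω => sub_nonneg.2 (hle n ω))
        ((integrable_const _).sub (hint n))] at h1
      filter_upwards [h1] with ω hω
      have h2 : Real.exp (-(σ n ω : ℝ)) = 1 := (sub_eq_zero.1 hω).symm
      simpa using h2
    filter_upwards [ae_all_iff.2 hz, hσ.monotone] with ω hω hm
    refine .inr fun s => ?_
    obtain ⟨n, hn⟩ := exists_nat_ge s
    exact le_antisymm ((hm hn).trans (hω n).le) zero_le
  · have hβ0 : 0 < β := by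
      refine lt_of_le_of_ne ?_ h0.symm
      have h1 : ∫ ω, Real.exp (-(σ (1 : ℕ) ω : ℝ)) ∂P ≤ ∫ _, (1 : ℝ) ∂P :=
        integral_mono (hint 1) (integrable_const _) (hle 1)
      rw [hval] at h1
      simpa using h1
    have hmeas : Measurable fun ω => ⨅ n : ℕ, ENNReal.ofReal (Real.exp (-(σ n ω : ℝ))) :=
      Measurable.iInf fun n => by
        have := hσ.measurable n
        fun_prop
    have hzero : ∫⁻ ω, ⨅ n : ℕ, ENNReal.ofReal (Real.exp (-(σ n ω : ℝ))) ∂P = 0 := by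
      have hlim : Tendsto (fun n : ℕ => ENNReal.ofReal (Real.exp (-(n * β)))) atTop (𝓝 0) := by
        have h1 : Tendsto (fun n : ℕ => Real.exp (-(n * β))) atTop (𝓝 0) :=
          Real.tendsto_exp_neg_atTop_nhds_zero.comp
            (tendsto_natCast_atTop_atTop.atTop_mul_const hβ0)
        simpa [Function.comp_def] using (ENNReal.continuous_ofReal.tendsto _).comp h1
      refine le_antisymm (ge_of_tendsto' hlim fun n => ?_) zero_le
      rw [← hval, ofReal_integral_eq_lintegral_ofReal (hint n)
        (.of_forall fun _ => (Real.exp_pos _).le)]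
      exact lintegral_mono fun ω => iInf_le _ n
    rw [lintegral_eq_zero_iff hmeas] at hzero
    filter_upwards [hzero] with ω hω
    refine .inl fun x => ?_
    have h1 : ⨅ n : ℕ, ENNReal.ofReal (Real.exp (-(σ n ω : ℝ))) <
        ENNReal.ofReal (Real.exp (-(x : ℝ))) := by
      rw [show ⨅ n : ℕ, ENNReal.ofReal (Real.exp (-(σ n ω : ℝ))) = 0 from hω]
      simpa using Real.exp_pos _
    obtain ⟨n, hn⟩ := iInf_lt_iff.1 h1
    refine ⟨n, ?_⟩
    rw [ENNReal.ofReal_lt_ofReal_iff (Real.exp_pos _), Real.exp_lt_exp] at hn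
    exact_mod_cast neg_lt_neg_iff.1 hn

end IsSubordinator

theorem exists_common_denominator {ι : Type*} (s : Finset ι) (q : ι → ℚ≥0) :
    ∃ M : ℕ, 0 < M ∧ ∀ i ∈ s, ∃ j : ℕ, (q i : ℝ≥0) = j * (M : ℝ≥0)⁻¹ := by
  classical
  refine ⟨∏ i ∈ s, (q i).den, Finset.prod_pos fun i _ => (q i).den_pos, fun i hi => ?_⟩
  refine ⟨(q i).num * ∏ j ∈ s.erase i, (q j).den, ?_⟩
  have h1 : ∀ i, ((q i).den : ℝ≥0) ≠ 0 := fun i => by exact_mod_cast (q i).den_pos.ne'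
  have h2 : ((∏ j ∈ s.erase i, (q j).den : ℕ) : ℝ≥0) ≠ 0 := by
    push_cast; exact Finset.prod_ne_zero_iff.2 fun j _ => h1 j
  rw [← Finset.mul_prod_erase s _ hi]
  push_cast at h2 ⊢
  rw [NNRat.cast_def]
  field_simp

/-- The integrand is constant between consecutive grid points, and `Φ 0 = 0` removes everything
after `J / M`. This matches moments computed from grid increments with the Poisson formula. -/
theorem setIntegral_step (Φ : ℕ → ℝ) (hΦ : Φ 0 = 0) {ι : Type*} (s : Finset ι) (j k : ι → ℕ)
    (M : ℕ) (hM : 0 < M) (J : ℕ) (hJ : ∀ i ∈ s, j i ≤ J) :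
    ∫ u in Ioi (0 : ℝ), Φ (∑ i ∈ s, if u ≤ j i / M then k i else 0) =
      ∑ l ∈ Finset.range J, Φ (∑ i ∈ s, if l < j i then k i else 0) / M := by
  have hM' : (0 : ℝ) < M := by exact_mod_cast hM
  set G : ℝ → ℝ := fun u => Φ (∑ i ∈ s, if u ≤ j i / M then k i else 0) with hG
  have hstep : ∀ (l : ℕ), ∀ u ∈ Ioc ((l : ℝ) / M) ((l + 1 : ℕ) / M),
      G u = Φ (∑ i ∈ s, if l < j i then k i else 0) := by
    intro l u hu
    simp only [hG]
    congr 1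
    refine Finset.sum_congr rfl fun i _ => if_congr ?_ rfl rfl
    constructor
    · intro h
      have h1 : (l : ℝ) / M < j i / M := hu.1.trans_le h
      rw [div_lt_div_iff_of_pos_right hM'] at h1
      exact_mod_cast h1
    · intro h
      refine hu.2.trans ?_
      have : ((l + 1 : ℕ) : ℝ) ≤ j i := by exact_mod_cast h
      gcongr
  have hmono : ∀ l : ℕ, (l : ℝ) / M ≤ (l + 1 : ℕ) / M := fun l => by
    gcongr; simp
  have h1 : ∫ u in Ioi (0 : ℝ), G u = ∫ u in Ioc (0 : ℝ) (J / M), G u := by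
    refine setIntegral_eq_of_subset_of_forall_sdiff_eq_zero measurableSet_Ioi Ioc_subset_Ioi_self
      fun u hu => ?_
    have huJ : (J : ℝ) / M < u := by
      by_contra! h
      exact hu.2 ⟨hu.1, h⟩
    have : ∑ i ∈ s, (if u ≤ j i / M then k i else 0) = 0 := by
      refine Finset.sum_eq_zero fun i hi => if_neg (not_le.2 (lt_of_le_of_lt ?_ huJ))
      have : (j i : ℝ) ≤ J := by exact_mod_cast hJ i hi
      gcongr
    simp only [hG, this, hΦ]
  have h2 := intervalIntegral.sum_integral_adjacent_intervals (μ := volume) (f := G)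
    (a := fun l : ℕ => (l : ℝ) / M) (n := J) fun l _ => by
      rw [intervalIntegrable_iff_integrableOn_Ioc_of_le (hmono l)]
      exact (integrableOn_congr_fun (hstep l) measurableSet_Ioc).2 (integrable_const _)
  rw [h1, ← intervalIntegral.integral_of_le (by positivity)]
  simp only [CharP.cast_eq_zero, zero_div] at h2
  rw [← h2]
  refine Finset.sum_congr rfl fun l _ => ?_
  rw [intervalIntegral.integral_of_le (hmono l), setIntegral_congr_fun measurableSet_Ioc (hstep l)]
  simp only [integral_const, measureReal_restrict_apply, MeasurableSet.univ, univ_inter,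
    Real.volume_real_Ioc_of_le (hmono l), smul_eq_mul]
  push_cast
  field_simp
  ring

namespace IsSubordinator

variable {Ω : Type*} [MeasurableSpace Ω] {P : Measure Ω} [IsProbabilityMeasure P]
  {σ : ℝ≥0 → Ω → ℝ≥0}

/-- The joint moments of `exp (-σ q)` at rational times. -/
theorem integral_prod_exp (hσ : IsSubordinator σ P) {ι : Type*} (s : Finset ι) (q : ι → ℚ≥0)
    (k : ι → ℕ) :
    ∫ ω, ∏ i ∈ s, Real.exp (-(σ (q i) ω : ℝ)) ^ k i ∂P =
      Real.exp (-∫ u in Ioi (0 : ℝ),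
        logLaplace (σ 1) P (∑ i ∈ s, if u ≤ (q i : ℝ) then k i else 0)) := by
  obtain ⟨M, hM, hq⟩ := exists_common_denominator s q
  choose! j hj using hq
  set J := s.sup j with hJdef
  have hJ : ∀ i ∈ s, j i ≤ J := fun i hi => Finset.le_sup hi
  -- The weight of the `l`-th grid increment after exchanging sums: it enters `σ (q i)` exactly when
  -- `l < j i`.
  set c : ℕ → ℕ := fun l => ∑ i ∈ s, if l < j i then k i else 0 with hc
  have hqr : ∀ i ∈ s, (q i : ℝ) = j i / M := fun i hi => by
    have := congrArg NNReal.toReal (hj i hi)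
    push_cast at this
    have hcast : ((q i : ℝ≥0) : ℝ) = (q i : ℝ) := by norm_cast
    rw [← hcast, this, div_eq_mul_inv]
  have hleft : (fun ω => ∏ i ∈ s, Real.exp (-(σ (q i) ω : ℝ)) ^ k i) =ᵐ[P] fun ω =>
      ∏ l ∈ Finset.range J, Real.exp (-(c l * ((σ ((l + 1 : ℕ) * (M : ℝ≥0)⁻¹) ω : ℝ) -
        (σ (l * (M : ℝ≥0)⁻¹) ω : ℝ)))) := by
    filter_upwards [hσ.zero] with ω h0
    rw [← Real.exp_sum]
    simp_rw [← Real.exp_nat_mul]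
    rw [← Real.exp_sum]
    congr 1
    set x : ℕ → ℝ := fun l => (σ ((l + 1 : ℕ) * (M : ℝ≥0)⁻¹) ω : ℝ) -
        (σ (l * (M : ℝ≥0)⁻¹) ω : ℝ) with hx
    have h1 : ∀ i ∈ s, (σ (q i) ω : ℝ) = ∑ l ∈ Finset.range J, if l < j i then x l else 0 := by
      intro i hi
      rw [hj i hi, sum_increments (g := fun s => σ s ω) h0, ← Finset.sum_filter]
      refine Finset.sum_congr ?_ fun _ _ => rfl
      ext l
      simp only [Finset.mem_range, Finset.mem_filter]
      exact ⟨fun h => ⟨h.trans_le (hJ i hi), h⟩, fun h => h.2⟩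
    calc ∑ i ∈ s, (k i : ℝ) * -(σ (q i) ω : ℝ)
        = ∑ i ∈ s, ∑ l ∈ Finset.range J, -((if l < j i then k i else 0 : ℕ) * x l) := by
          refine Finset.sum_congr rfl fun i hi => ?_
          rw [h1 i hi, mul_neg, Finset.mul_sum, ← Finset.sum_neg_distrib]
          refine Finset.sum_congr rfl fun l _ => ?_
          split_ifs <;> simp
      _ = ∑ l ∈ Finset.range J, -(c l * x l) := by
          rw [Finset.sum_comm]
          refine Finset.sum_congr rfl fun l _ => ?_
          rw [Finset.sum_neg_distrib, ← Finset.sum_mul, hc]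
          push_cast
          rfl
  rw [integral_congr_ae hleft, hσ.integral_prod_increments]
  simp_rw [hσ.integral_exp_inv M hM]
  rw [← Real.exp_sum, Finset.sum_neg_distrib,
    ← setIntegral_step _ (logLaplace_zero _) s j k M hM J hJ]
  congr 2
  refine integral_congr_ae (.of_forall fun u => ?_)
  simp only
  congr 1
  exact Finset.sum_congr rfl fun i hi => by rw [hqr i hi]

/-- The Lévy–Khintchine representation of a subordinator. -/
theorem exists_levyExponent_eq (hσ : IsSubordinator σ P) :
    ∃ (d : ℝ) (ζ : ℝ → ℝ), 0 ≤ d ∧ IsJumpProfile ζ ∧ Monotone ζ ∧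
      levyExponent d ζ = logLaplace (σ 1) P := by
  have hm : ∀ m : ℕ, Measurable fun ω => Real.exp (-(σ ((m + 1 : ℕ) : ℝ≥0)⁻¹ ω : ℝ)) := fun m => by
    have := hσ.measurable ((m + 1 : ℕ) : ℝ≥0)⁻¹
    fun_prop
  have hprob : ∀ m : ℕ, IsProbabilityMeasure
      (P.map fun ω => Real.exp (-(σ ((m + 1 : ℕ) : ℝ≥0)⁻¹ ω : ℝ))) := fun m =>
    Measure.isProbabilityMeasure_map (hm m).aemeasurable
  -- Infinite divisibility: the increment over time `1 / (m + 1)` supplies the law with moments `exp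
  -- (-Φ k / (m + 1))`.
  refine _root_.exists_levyExponent_eq
    (fun m => P.map fun ω => Real.exp (-(σ ((m + 1 : ℕ) : ℝ≥0)⁻¹ ω : ℝ))) (fun m => ?_)
    fun m k => ?_
  · refine (ae_map_iff (hm m).aemeasurable measurableSet_Icc).2 (.of_forall fun ω => ?_)
    exact ⟨(Real.exp_pos _).le, Real.exp_le_one_iff.2 (by simp)⟩
  · rw [integral_map (f := fun x : ℝ => x ^ k) (hm m).aemeasurable
      (measurable_id.pow_const k).aestronglyMeasurable]
    have := hσ.integral_exp_inv (m + 1) (Nat.succ_pos m) k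
    rw [Nat.cast_succ (R := ℝ)] at this
    rw [← this]
    refine integral_congr_ae (.of_forall fun ω => ?_)
    simp only [← Real.exp_nat_mul]
    congr 1
    ring

/-- A subordinator has, at rational times, the law of the subordinator that is constructed from a
Poisson process. -/
theorem map_eq_map_levyZ (hσ : IsSubordinator σ P) {d : ℝ} {ζ : ℝ → ℝ} (hd : 0 ≤ d)
    (hζ : IsJumpProfile ζ) (h : levyExponent d ζ = logLaplace (σ 1) P) :
    P.map (fun ω (q : ℚ≥0) => Real.exp (-(σ q ω : ℝ))) =
      quadrantLaw.map (fun ω (q : ℚ≥0) => levyZ d ζ q ω) := by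
  refine map_eq_of_moments (fun q => ?_) (fun q => hζ.measurable_levyZ d q)
    (fun q ω => ⟨(Real.exp_pos _).le, Real.exp_le_one_iff.2 (by simp)⟩)
    (fun q ω => ⟨hζ.levyZ_nonneg d q ω, hζ.levyZ_le_one hd (by positivity) ω⟩) fun s k => ?_
  · have := hσ.measurable q
    fun_prop
  · rw [hσ.integral_prod_exp, hζ.integral_prod_levyZ s _ (fun q => by positivity), h]

end IsSubordinator

/-! ### The triple as a measurable function of countably many coordinates -/

/-- The inverse of `x ↦ exp (-x)` on `[0,∞)`. -/
noncomputable def negLog (z : ℝ) : ℝ≥0 := (-Real.log z).toNNReal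

theorem negLog_exp_neg (x : ℝ≥0) : negLog (Real.exp (-(x : ℝ))) = x := by
  simp [negLog]

theorem measurable_negLog : Measurable negLog := by unfold negLog; fun_prop

theorem dist_negLog_le {c a b : ℝ} (hc : 0 < c) (ha : c ≤ a) (hb : c ≤ b) :
    dist (negLog a) (negLog b) ≤ |a - b| / c := by
  have key : ∀ a b : ℝ, c ≤ a → c ≤ b → Real.log a - Real.log b ≤ |a - b| / c := by
    intro a b ha hb
    have ha0 : 0 < a := hc.trans_le ha
    have hb0 : 0 < b := hc.trans_le hb
    rw [← Real.log_div ha0.ne' hb0.ne']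
    calc Real.log (a / b) ≤ a / b - 1 := Real.log_le_sub_one_of_pos (by positivity)
      _ = (a - b) / b := by field_simp
      _ ≤ |a - b| / b := by gcongr; exact le_abs_self _
      _ ≤ |a - b| / c := by gcongr
  have h1 : |-Real.log a - -Real.log b| ≤ |a - b| / c := by
    refine abs_sub_le_iff.2 ⟨?_, ?_⟩
    · have := key b a hb ha
      rw [abs_sub_comm] at this
      linarith
    · have := key a b ha hb
      linarith
  rw [NNReal.dist_eq]
  refine le_trans ?_ h1
  simp only [negLog, Real.coe_toNNReal']
  exact abs_max_sub_max_le_abs _ _ _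

/-- The paths for which the triple depends measurably on the path. -/
def IsRegularPath (g : ℚ≥0 → ℝ≥0) : Prop :=
  Monotone g ∧ ((∀ n : ℕ, ∃ q, (n : ℝ≥0) < g q) ∨ ∀ q, g q = 0)

theorem measurableSet_isRegularPath : MeasurableSet {g | IsRegularPath g} := by
  have h1 : {g | IsRegularPath g} = (⋂ (q : ℚ≥0) (r : ℚ≥0) (_ : q ≤ r), {g | g q ≤ g r}) ∩
      ((⋂ n : ℕ, ⋃ q : ℚ≥0, {g | (n : ℝ≥0) < g q}) ∪ ⋂ q : ℚ≥0, {g | g q = 0}) := by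
    ext g
    simp [IsRegularPath, Monotone]
  rw [h1]
  refine MeasurableSet.inter ?_ (MeasurableSet.union ?_ ?_)
  · exact MeasurableSet.iInter fun q => MeasurableSet.iInter fun r => MeasurableSet.iInter fun _ =>
      measurableSet_le (measurable_pi_apply q) (measurable_pi_apply r)
  · exact MeasurableSet.iInter fun n => MeasurableSet.iUnion fun q =>
      measurableSet_lt measurable_const (measurable_pi_apply q)
  · exact MeasurableSet.iInter fun q =>
      measurableSet_eq_fun (measurable_pi_apply q) measurable_const

open Classical in
/-- The triple of the path with values `-log (z q)` at rational times `q`, shifted by `-log w`. -/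
noncomputable def pathTriple (t y : ℝ≥0) (p : ℝ × (ℚ≥0 → ℝ)) :
    CadlagSpace t × CadlagSpace y × FellCloseds ℝ≥0 :=
  if IsRegularPath (fun q => negLog (p.2 q)) then
    shiftedTriple t y (negLog p.1) (rightReg fun q => negLog (p.2 q))
  else shiftedTriple t y 0 fun _ => 0

theorem pathTriple_of_isRegularPath (t y : ℝ≥0) {p : ℝ × (ℚ≥0 → ℝ)}
    (h : IsRegularPath fun q => negLog (p.2 q)) :
    pathTriple t y p = shiftedTriple t y (negLog p.1) (rightReg fun q => negLog (p.2 q)) :=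
  if_pos h

theorem IsRegularPath.rightReg_unbounded_or_zero {g : ℚ≥0 → ℝ≥0} (h : IsRegularPath g) :
    (∀ x, ∃ T, x < rightReg g T) ∨ ∀ s, rightReg g s = 0 := by
  refine h.2.imp (fun hu x => ?_) fun hz s => ?_
  · obtain ⟨n, hn⟩ := exists_nat_ge x
    obtain ⟨q, hq⟩ := hu n
    exact ⟨q, (hn.trans_lt hq).trans_le (le_rightReg h.1 le_rfl)⟩
  · simp [rightReg, hz]

theorem measurable_pathTriple (t y : ℝ≥0) : Measurable (pathTriple t y) := by
  have hm : ∀ q : ℚ≥0, Measurable fun p : ℝ × (ℚ≥0 → ℝ) => negLog (p.2 q) := fun q =>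
    measurable_negLog.comp ((measurable_pi_apply q).comp measurable_snd)
  have hs : MeasurableSet {p : ℝ × (ℚ≥0 → ℝ) | IsRegularPath fun q => negLog (p.2 q)} :=
    (measurable_pi_iff.2 hm) measurableSet_isRegularPath
  refine measurable_of_restrict_of_restrict_compl hs ?_ ?_
  · have h1 : {p : ℝ × (ℚ≥0 → ℝ) | IsRegularPath fun q => negLog (p.2 q)}.domRestrict
        (pathTriple t y) = fun p => shiftedTriple t y (negLog p.1.1)
          (rightReg fun q => negLog (p.1.2 q)) := by
      funext p
      exact pathTriple_of_isRegularPath t y p.2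
    rw [h1]
    refine measurable_shiftedTriple t y
      (measurable_negLog.comp (measurable_fst.comp measurable_subtype_coe))
      (fun s => measurable_rightReg (fun q => (hm q).comp measurable_subtype_coe) s)
      (fun p => rightReg_mono _) (fun p => rightReg_rightCont _)
      fun p => IsRegularPath.rightReg_unbounded_or_zero p.2
  · have h1 : {p : ℝ × (ℚ≥0 → ℝ) | IsRegularPath fun q => negLog (p.2 q)}ᶜ.domRestrict
        (pathTriple t y) = fun _ => shiftedTriple t y 0 fun _ => 0 := by
      funext p
      exact if_neg p.2
    rw [h1]
    exact measurable_const

/-! ### Transfer of a subordinator and its shift to the coupling space -/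

section Subordinator

variable {Ω : Type*} [MeasurableSpace Ω] {P : Measure Ω} [IsProbabilityMeasure P]
  {σ : ℝ≥0 → Ω → ℝ≥0} {V : Ω → ℝ≥0}

/-- The coordinates on which the triple of a subordinator depends. -/
noncomputable def expCoords (σ : ℝ≥0 → Ω → ℝ≥0) (V : Ω → ℝ≥0) (ω : Ω) : ℝ × (ℚ≥0 → ℝ) :=
  (Real.exp (-(V ω : ℝ)), fun q => Real.exp (-(σ q ω : ℝ)))

theorem IsSubordinator.measurable_expCoords (hσ : IsSubordinator σ P) (hV : Measurable V) :
    Measurable (expCoords σ V) := by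
  refine Measurable.prodMk (by fun_prop) (measurable_pi_iff.2 fun q => ?_)
  have := hσ.measurable q
  fun_prop

theorem IsSubordinator.ae_isRegularPath (hσ : IsSubordinator σ P) :
    ∀ᵐ ω ∂P, IsRegularPath fun q => negLog (Real.exp (-(σ (q : ℚ≥0) ω : ℝ))) := by
  filter_upwards [hσ.monotone, hσ.ae_unbounded_or_zero] with ω hm hu
  simp only [negLog_exp_neg]
  refine ⟨fun q r hqr => hm (by exact_mod_cast hqr), hu.imp (fun h n => ?_) fun h q => h q⟩
  obtain ⟨T, hT⟩ := h n
  obtain ⟨q, hq, -⟩ := exists_nnrat_between (lt_add_one T)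
  exact ⟨q, hT.trans_le (hm hq.le)⟩

/-- Almost every path is the right-continuous regularization of its rational values, so expectations
of the triple depend only on the law of `expCoords`. -/
theorem IsSubordinator.ae_eq_pathTriple (hσ : IsSubordinator σ P) (t y : ℝ≥0) :
    ∀ᵐ ω ∂P, shiftedTriple t y (V ω) (fun s => σ s ω) = pathTriple t y (expCoords σ V ω) := by
  filter_upwards [hσ.monotone, hσ.cadlag, hσ.ae_isRegularPath] with ω hm hc hreg
  have hr : ∀ x, ContinuousWithinAt (fun s => σ s ω) (Ici x) x := fun x => by
    have := (continuous_real_toNNReal.continuousAt).comp_continuousWithinAt (hc x).1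
    simpa [Function.comp_def] using this
  rw [pathTriple_of_isRegularPath t y hreg]
  simp only [expCoords, negLog_exp_neg]
  rw [rightReg_eq hm hr]

theorem IsSubordinator.aemeasurable_shiftedTriple (hσ : IsSubordinator σ P) (hV : Measurable V)
    (t y : ℝ≥0) : AEMeasurable (fun ω => shiftedTriple t y (V ω) (fun s => σ s ω)) P :=
  ⟨_, (measurable_pathTriple t y).comp (hσ.measurable_expCoords hV), hσ.ae_eq_pathTriple t y⟩

/-- The coupling: coordinates built from a uniform variable and a Poisson process. -/
noncomputable def coupledCoords (Q : ℝ → ℝ) (d : ℝ) (ζ : ℝ → ℝ)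
    (p : ℝ × (ℕ → ℕ × (ℕ → ℝ × ℝ))) : ℝ × (ℚ≥0 → ℝ) :=
  (Q p.1, fun q => levyZ d ζ q p.2)

/-- The law of the uniform variable and the Poisson process of the coupling. -/
noncomputable def couplingLaw : Measure (ℝ × (ℕ → ℕ × (ℕ → ℝ × ℝ))) :=
  (volume.restrict (Ioc (0 : ℝ) 1)).prod quadrantLaw

instance : IsProbabilityMeasure (volume.restrict (Ioc (0 : ℝ) 1)) := ⟨by simp⟩

instance : IsProbabilityMeasure couplingLaw := by unfold couplingLaw; infer_instance

variable {Q : ℝ → ℝ} {d : ℝ} {ζ : ℝ → ℝ}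

theorem IsJumpProfile.measurable_coupledCoords (hζ : IsJumpProfile ζ) (hQ : Measurable Q) (d : ℝ) :
    Measurable (coupledCoords Q d ζ) :=
  (hQ.comp measurable_fst).prodMk
    (measurable_pi_iff.2 fun q => (hζ.measurable_levyZ d q).comp measurable_snd)

/-- By independence the joint law is a product, and each factor is reproduced separately: the shift
by its quantile function, the path by the Poisson construction. -/
theorem IsSubordinator.map_expCoords (hσ : IsSubordinator σ P) (hV : Measurable V)
    (hind : IndepFun (fun ω s => σ s ω) V P) (hd : 0 ≤ d) (hζ : IsJumpProfile ζ)
    (h : levyExponent d ζ = logLaplace (σ 1) P) (hQ : Measurable Q)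
    (hQV : (volume.restrict (Ioc (0 : ℝ) 1)).map Q = P.map fun ω => Real.exp (-(V ω : ℝ))) :
    P.map (expCoords σ V) = couplingLaw.map (coupledCoords Q d ζ) := by
  have hm1 : Measurable fun x : ℝ≥0 => Real.exp (-(x : ℝ)) := by fun_prop
  have hm2 : Measurable fun (g : ℝ≥0 → ℝ≥0) (q : ℚ≥0) => Real.exp (-(g q : ℝ)) := by fun_prop
  have hσm : Measurable fun ω (q : ℚ≥0) => Real.exp (-(σ q ω : ℝ)) :=
    measurable_pi_iff.2 fun q => by
      have := hσ.measurable q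
      fun_prop
  have hind' : IndepFun (fun ω => Real.exp (-(V ω : ℝ)))
      (fun ω (q : ℚ≥0) => Real.exp (-(σ q ω : ℝ))) P := (hind.comp hm2 hm1).symm
  have hZ : Measurable fun ω (q : ℚ≥0) => levyZ d ζ q ω :=
    measurable_pi_iff.2 fun q => hζ.measurable_levyZ d q
  have h1 := (indepFun_iff_map_prod_eq_prod_map_map (by fun_prop) hσm.aemeasurable).1 hind'
  unfold expCoords
  rw [h1, ← hQV, hσ.map_eq_map_levyZ hd hζ h, Measure.map_prod_map _ _ hQ hZ]
  rfl

end Subordinator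

/-! ### Almost sure convergence of the coupling -/

/-- Convergence in mean of countably many increasing distances gives almost sure convergence of all
of them along one subsequence. -/
theorem exists_subseq_ae_tendsto_zero {Ω : Type*} [MeasurableSpace Ω] {P : Measure Ω}
    {D : ℕ → ℕ → Ω → ENNReal} (hD : ∀ n T, Measurable (D n T))
    (hmono : ∀ n ω, Monotone fun T => D n T ω)
    (hlim : ∀ T, Tendsto (fun n => ∫⁻ ω, D n T ω ∂P) atTop (𝓝 0)) :
    ∃ φ : ℕ → ℕ, StrictMono φ ∧
      ∀ᵐ ω ∂P, ∀ T, Tendsto (fun n => D (φ n) T ω) atTop (𝓝 0) := by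
  -- Diagonal choice: the `n`-th term controls the horizon `n` with mean at most `2 ^ (-n)`, and a
  -- fixed `T` is dominated as soon as `n ≥ T`.
  obtain ⟨φ, hφ, hle⟩ := extraction_forall_of_eventually
    (P := fun n k => ∫⁻ ω, D k n ω ∂P ≤ (1 / 2 : ENNReal) ^ n) fun n =>
      (hlim n).eventually (Iic_mem_nhds (ENNReal.pow_pos (by simp) n))
  refine ⟨φ, hφ, ?_⟩
  have hsum : ∫⁻ ω, ∑' n, D (φ n) n ω ∂P ≠ ⊤ := by
    rw [lintegral_tsum fun n => (hD _ _).aemeasurable]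
    refine ne_top_of_le_ne_top ?_ (ENNReal.tsum_le_tsum hle)
    rw [ENNReal.tsum_geometric]
    simp
  filter_upwards [ae_lt_top (Measurable.tsum fun n => hD (φ n) n) hsum] with ω hω T
  refine tendsto_of_tendsto_of_tendsto_of_le_of_le' tendsto_const_nhds
    (ENNReal.tendsto_atTop_zero_of_tsum_ne_top hω.ne) (.of_forall fun _ => zero_le) ?_
  filter_upwards [eventually_ge_atTop T] with n hn using hmono _ _ hn

theorem tendstoUniformlyOn_negLog {zs : ℕ → ℚ≥0 → ℝ} {z : ℚ≥0 → ℝ} (hz : Antitone z)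
    (hpos : ∀ q, 0 < z q)
    (h : ∀ T : ℕ, Tendsto (fun n => ⨆ q : ℚ≥0, ⨆ _ : (q : ℝ) ≤ T, ENNReal.ofReal |zs n q - z q|)
      atTop (𝓝 0)) (T : ℝ≥0) :
    TendstoUniformlyOn (fun n q => negLog (zs n q)) (fun q => negLog (z q)) atTop
      {q : ℚ≥0 | (q : ℝ≥0) ≤ T} := by
  obtain ⟨N, hN⟩ := exists_nat_ge T
  -- Since `z` is antitone, `z N` bounds it below up to time `N`; on `[z N / 2, ∞)` the logarithm is
  -- Lipschitz, and `η` keeps the approximants in that range.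
  have hc : 0 < z N / 2 := half_pos (hpos N)
  rw [Metric.tendstoUniformlyOn_iff]
  intro ε hε
  set η := min (z N / 2) (ε * (z N / 2)) with hη
  have hη0 : 0 < η := by positivity
  filter_upwards [(h N).eventually (gt_mem_nhds (ENNReal.ofReal_pos.2 hη0))] with n hn q hq
  have hqN : (q : ℝ≥0) ≤ N := le_trans hq hN
  have hqN' : q ≤ N := by exact_mod_cast hqN
  have hqNr : (q : ℝ) ≤ N := by exact_mod_cast hqN'
  have h1 : |zs n q - z q| < η := by
    have : ENNReal.ofReal |zs n q - z q| < ENNReal.ofReal η :=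
      (le_iSup₂ (f := fun (q : ℚ≥0) (_ : (q : ℝ) ≤ N) => ENNReal.ofReal |zs n q - z q|)
        q hqNr).trans_lt hn
    exact (ENNReal.ofReal_lt_ofReal_iff hη0).1 this
  have hz1 : z N ≤ z q := hz hqN'
  have h2 : z N / 2 ≤ zs n q := by
    have := (abs_lt.1 (h1.trans_le (min_le_left _ _))).1
    linarith
  refine (dist_negLog_le hc (by linarith) h2).trans_lt ?_
  rw [div_lt_iff₀ hc, abs_sub_comm]
  exact h1.trans_le (min_le_right _ _)

theorem tendsto_pathTriple (t y : ℝ≥0) {ws : ℕ → ℝ} {w : ℝ} {zs : ℕ → ℚ≥0 → ℝ} {z : ℚ≥0 → ℝ}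
    (hw : 0 < w) (hws : Tendsto ws atTop (𝓝 w)) (hpos : ∀ q, 0 < z q)
    (hstrict : StrictMono fun q => negLog (z q)) (hz : Antitone z)
    (hreg : IsRegularPath fun q => negLog (z q))
    (hregs : ∀ n, IsRegularPath fun q => negLog (zs n q))
    (h : ∀ T : ℕ, Tendsto (fun n => ⨆ q : ℚ≥0, ⨆ _ : (q : ℝ) ≤ T, ENNReal.ofReal |zs n q - z q|)
      atTop (𝓝 0)) :
    Tendsto (fun n => pathTriple t y (ws n, zs n)) atTop (𝓝 (pathTriple t y (w, z))) := by
  rw [pathTriple_of_isRegularPath t y hreg,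
    funext fun n => pathTriple_of_isRegularPath (p := (ws n, zs n)) t y (hregs n)]
  have hsm := rightReg_strictMono hstrict
  refine tendsto_shiftedTriple t y ?_ (fun n => rightReg_mono _) (fun n => rightReg_rightCont _)
    hsm (rightReg_rightCont _) ?_ fun T => ?_
  · have : ContinuousAt negLog w :=
      continuous_real_toNNReal.continuousAt.comp (Real.continuousAt_log hw.ne').neg
    exact this.tendsto.comp hws
  · refine hreg.rightReg_unbounded_or_zero.resolve_right fun h0 => ?_
    have := hsm zero_lt_one
    rw [h0, h0] at this
    exact lt_irrefl _ this
  · exact rightReg_tendstoUniformlyOn T (fun n => (hregs n).1) hreg.1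
      (tendstoUniformlyOn_negLog hz hpos h (T + 1))

/-! ### The Skorokhod coupling and weak convergence -/

section Limit

variable {Ω : ℕ → Type*} [∀ n, MeasurableSpace (Ω n)]
  {P : (n : ℕ) → Measure (Ω n)} [∀ n, IsProbabilityMeasure (P n)]
  {Ω' : Type*} [MeasurableSpace Ω'] {P' : Measure Ω'} [IsProbabilityMeasure P']
  {σs : (n : ℕ) → ℝ≥0 → Ω n → ℝ≥0} {Vs : (n : ℕ) → Ω n → ℝ≥0}
  {σ : ℝ≥0 → Ω' → ℝ≥0} {V : Ω' → ℝ≥0}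

/-- Skorokhod coupling of nonnegative random variables whose Laplace transforms converge, by
quantile functions. -/
theorem exists_subseq_quantile (hVs : ∀ n, Measurable (Vs n)) (hV : Measurable V)
    (hlim : ∀ k : ℕ, Tendsto (fun n => ∫ ω, Real.exp (-(k * (Vs n ω : ℝ))) ∂(P n)) atTop
      (𝓝 (∫ ω, Real.exp (-(k * (V ω : ℝ))) ∂P'))) :
    ∃ φ : ℕ → ℕ, StrictMono φ ∧ ∃ (Qs : ℕ → ℝ → ℝ) (Q : ℝ → ℝ),
      (∀ n, Measurable (Qs n)) ∧ Measurable Q ∧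
      (∀ n, (volume.restrict (Ioc (0 : ℝ) 1)).map (Qs n) =
        (P (φ n)).map fun ω => Real.exp (-(Vs (φ n) ω : ℝ))) ∧
      ((volume.restrict (Ioc (0 : ℝ) 1)).map Q = P'.map fun ω => Real.exp (-(V ω : ℝ))) ∧
      ∀ᵐ u ∂(volume.restrict (Ioc (0 : ℝ) 1)), Tendsto (fun n => Qs n u) atTop (𝓝 (Q u)) := by
  have hm : ∀ n, Measurable fun ω => Real.exp (-(Vs n ω : ℝ)) := fun n => by
    have := hVs n
    fun_prop
  have hm' : Measurable fun ω => Real.exp (-(V ω : ℝ)) := by fun_prop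
  have h01 : ∀ x : ℝ≥0, Real.exp (-(x : ℝ)) ∈ Icc (0 : ℝ) 1 := fun x =>
    ⟨(Real.exp_pos _).le, Real.exp_le_one_iff.2 (by simp)⟩
  have hprob : ∀ n, IsProbabilityMeasure ((P n).map fun ω => Real.exp (-(Vs n ω : ℝ))) := fun n =>
    Measure.isProbabilityMeasure_map (hm n).aemeasurable
  choose Qs hQm hQ01 hQ using fun n => exists_monotone_map_eq
    ((P n).map fun ω => Real.exp (-(Vs n ω : ℝ)))
    ((ae_map_iff (hm n).aemeasurable measurableSet_Icc).2 (.of_forall fun ω => h01 _))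
  obtain ⟨φ, hφ, Q, hQmono, hQ01', hQlim⟩ := exists_subseq_tendsto_of_monotone hQm hQ01
  refine ⟨φ, hφ, fun n => Qs (φ n), Q, fun n => (hQm _).measurable, hQmono.measurable,
    fun n => hQ _, ?_, ae_restrict_of_ae hQlim⟩
  -- The Helly limit of the quantile functions is identified through its moments: they are the
  -- limits of the transforms of the `Vs`.
  have hmom : ∀ k : ℕ, ∫ u in Ioc (0 : ℝ) 1, Q u ^ k = ∫ ω, Real.exp (-(V ω : ℝ)) ^ k ∂P' := by
    intro k
    have h1 : Tendsto (fun n => ∫ u in Ioc (0 : ℝ) 1, Qs (φ n) u ^ k) atTop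
        (𝓝 (∫ u in Ioc (0 : ℝ) 1, Q u ^ k)) := by
      refine tendsto_integral_of_dominated_convergence (fun _ => 1)
        (fun n => ((hQm _).measurable.pow_const k).aestronglyMeasurable) (integrable_const _)
        (fun n => .of_forall fun u => ?_) ?_
      · rw [Real.norm_of_nonneg (pow_nonneg (hQ01 _ u).1 k)]
        exact pow_le_one₀ (hQ01 _ u).1 (hQ01 _ u).2
      · filter_upwards [ae_restrict_of_ae hQlim] with u hu using hu.pow k
    have h2 : ∀ n, ∫ u in Ioc (0 : ℝ) 1, Qs n u ^ k =
        ∫ ω, Real.exp (-(k * (Vs n ω : ℝ))) ∂(P n) := by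
      intro n
      have h3 := integral_map (μ := volume.restrict (Ioc (0 : ℝ) 1)) (f := fun x : ℝ => x ^ k)
        (hQm n).measurable.aemeasurable (measurable_id.pow_const k).aestronglyMeasurable
      rw [← h3, hQ n, integral_map (f := fun x : ℝ => x ^ k) (hm n).aemeasurable
        (measurable_id.pow_const k).aestronglyMeasurable]
      refine integral_congr_ae (.of_forall fun ω => ?_)
      simp only [← Real.exp_nat_mul]
      congr 1
      ring
    simp_rw [h2] at h1
    rw [tendsto_nhds_unique h1 ((hlim k).comp hφ.tendsto_atTop)]
    refine integral_congr_ae (.of_forall fun ω => ?_)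
    simp only [← Real.exp_nat_mul]
    congr 1
    ring
  have hpi := map_eq_of_moments (ι := Unit) (P := volume.restrict (Ioc (0 : ℝ) 1)) (P' := P')
    (X := fun _ => Q) (Y := fun _ ω => Real.exp (-(V ω : ℝ))) (fun _ => hQmono.measurable)
    (fun _ => hm') (fun _ => hQ01') (fun _ ω => h01 _) fun s k => by
      simp_rw [Finset.prod_pow_eq_pow_sum]
      exact hmom _
  have := congrArg (fun m => m.map fun x : Unit → ℝ => x ()) hpi
  rwa [Measure.map_map (measurable_pi_apply _)
    (measurable_pi_iff.2 fun _ => hQmono.measurable), Measure.map_map (measurable_pi_apply _)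
    (measurable_pi_iff.2 fun _ => hm')] at this

/-- Along a subsequence, the triples of converging subordinators converge weakly. -/
theorem exists_subseq_tendsto_integral_shiftedTriple
    (hσs : ∀ n, IsSubordinator (σs n) (P n)) (hσ : IsSubordinator σ P')
    (hstrict : ∀ᵐ ω ∂P', StrictMono fun s => σ s ω)
    (hVs : ∀ n, Measurable (Vs n)) (hV : Measurable V)
    (hinds : ∀ n, IndepFun (fun ω s => σs n s ω) (Vs n) (P n))
    (hind : IndepFun (fun ω s => σ s ω) V P')
    (hσlim : ∀ k : ℕ, Tendsto (fun n => ∫ ω, Real.exp (-(k * (σs n 1 ω : ℝ))) ∂(P n)) atTop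
      (𝓝 (∫ ω, Real.exp (-(k * (σ 1 ω : ℝ))) ∂P')))
    (hVlim : ∀ k : ℕ, Tendsto (fun n => ∫ ω, Real.exp (-(k * (Vs n ω : ℝ))) ∂(P n)) atTop
      (𝓝 (∫ ω, Real.exp (-(k * (V ω : ℝ))) ∂P')))
    (t y : ℝ≥0) (f : (CadlagSpace t × CadlagSpace y × FellCloseds ℝ≥0) →ᵇ ℝ)
    (hf : Measurable f) :
    ∃ φ : ℕ → ℕ, Tendsto (fun n => ∫ ω, f (shiftedTriple t y (Vs (φ n) ω)
      fun s => σs (φ n) s ω) ∂(P (φ n))) atTop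
      (𝓝 (∫ ω, f (shiftedTriple t y (V ω) fun s => σ s ω) ∂P')) := by
  choose ds ζs hds hζs hmonos hexp using fun n => (hσs n).exists_levyExponent_eq
  have hΦ : ∀ k, Tendsto (fun n => levyExponent (ds n) (ζs n) k) atTop
      (𝓝 (logLaplace (σ 1) P' k)) := fun k => by
    simp_rw [hexp]
    exact ((hσlim k).log (integral_exp_neg_pos (hσ.measurable 1) k).ne').neg
  -- Three nested extractions: for the profiles, for the quantile functions, and for passing from
  -- convergence in mean to almost sure convergence.
  obtain ⟨φ₁, hφ₁, d, ζ, hd, hζ, hmono, hexp', hζlim⟩ :=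
    exists_subseq_levyExponent hds hζs hmonos hΦ
  obtain ⟨φ₂, hφ₂, Qs, Q, hQs, hQ, hQslaw, hQlaw, hQlim⟩ :=
    exists_subseq_quantile (P := fun n => P (φ₁ n)) (P' := P') (fun n => hVs (φ₁ n)) hV
      fun k => (hVlim k).comp hφ₁.tendsto_atTop
  have hmean : ∀ T : ℕ, Tendsto (fun n => ∫⁻ ω, ⨆ q : ℚ≥0, ⨆ _ : (q : ℝ) ≤ T,
      ENNReal.ofReal |levyZ (ds (φ₁ (φ₂ n))) (ζs (φ₁ (φ₂ n))) q ω - levyZ d ζ q ω| ∂quadrantLaw)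
      atTop (𝓝 0) := by
    refine tendsto_lintegral_iSup_levyZ (fun n => hds _) (fun n => hζs _) (fun n => hmonos _)
      hd hζ hmono ?_ ?_
    · filter_upwards [hζlim] with h hh using hh.comp hφ₂.tendsto_atTop
    · rw [hexp']
      exact (hΦ 1).comp (hφ₁.comp hφ₂).tendsto_atTop
  obtain ⟨φ₃, hφ₃, hae⟩ := exists_subseq_ae_tendsto_zero (P := quadrantLaw)
    (D := fun n T ω => ⨆ q : ℚ≥0, ⨆ _ : (q : ℝ) ≤ T,
      ENNReal.ofReal |levyZ (ds (φ₁ (φ₂ n))) (ζs (φ₁ (φ₂ n))) q ω - levyZ d ζ q ω|)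
    (fun n T => Measurable.iSup fun q => Measurable.iSup fun _ =>
      (((hζs _).measurable_levyZ _ _).sub (hζ.measurable_levyZ _ _)).abs.ennreal_ofReal)
    (fun n ω T T' hT => iSup_mono fun q => iSup_mono' fun h =>
      ⟨h.trans (by exact_mod_cast hT), le_rfl⟩) hmean
  set ψ : ℕ → ℕ := fun n => φ₁ (φ₂ (φ₃ n)) with hψ
  set X : ℕ → ℝ × (ℕ → ℕ × (ℕ → ℝ × ℝ)) → ℝ × (ℚ≥0 → ℝ) := fun n =>
    coupledCoords (Qs (φ₃ n)) (ds (ψ n)) (ζs (ψ n)) with hX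
  set Y : ℝ × (ℕ → ℕ × (ℕ → ℝ × ℝ)) → ℝ × (ℚ≥0 → ℝ) := coupledCoords Q d ζ with hY
  have hXm : ∀ n, Measurable (X n) := fun n => (hζs _).measurable_coupledCoords (hQs _) _
  have hYm : Measurable Y := hζ.measurable_coupledCoords hQ _
  have hXlaw : ∀ n, (P (ψ n)).map (expCoords (σs (ψ n)) (Vs (ψ n))) = couplingLaw.map (X n) :=
    fun n => (hσs _).map_expCoords (hVs _) (hinds _) (hds _) (hζs _) (hexp _) (hQs _) (hQslaw _)
  have hYlaw : P'.map (expCoords σ V) = couplingLaw.map Y :=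
    hσ.map_expCoords hV hind hd hζ hexp' hQ hQlaw
  have hfm : Measurable fun p => f (pathTriple t y p) := hf.comp (measurable_pathTriple t y)
  -- Measurability of `f` for the product σ-field lets its integral be computed from the law of the
  -- coordinates alone.
  have hXint : ∀ n, ∫ ω, f (shiftedTriple t y (Vs (ψ n) ω) fun s => σs (ψ n) s ω) ∂(P (ψ n)) =
      ∫ p, f (pathTriple t y (X n p)) ∂couplingLaw := by
    intro n
    rw [← integral_map (hXm n).aemeasurable hfm.aestronglyMeasurable, ← hXlaw,
      integral_map ((hσs _).measurable_expCoords (hVs _)).aemeasurable hfm.aestronglyMeasurable]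
    refine integral_congr_ae ?_
    filter_upwards [(hσs (ψ n)).ae_eq_pathTriple (V := Vs (ψ n)) t y] with ω hω
    rw [hω]
  have hYint : ∫ ω, f (shiftedTriple t y (V ω) fun s => σ s ω) ∂P' =
      ∫ p, f (pathTriple t y (Y p)) ∂couplingLaw := by
    rw [← integral_map hYm.aemeasurable hfm.aestronglyMeasurable, ← hYlaw,
      integral_map (hσ.measurable_expCoords hV).aemeasurable hfm.aestronglyMeasurable]
    refine integral_congr_ae ?_
    filter_upwards [hσ.ae_eq_pathTriple (V := V) t y] with ω hω
    rw [hω]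
  have hpath : Measurable fun (p : ℝ × (ℚ≥0 → ℝ)) (q : ℚ≥0) => negLog (p.2 q) :=
    measurable_pi_iff.2 fun q =>
      measurable_negLog.comp ((measurable_pi_apply q).comp measurable_snd)
  have hregset : MeasurableSet {p : ℝ × (ℚ≥0 → ℝ) | IsRegularPath fun q => negLog (p.2 q)} :=
    hpath measurableSet_isRegularPath
  have hXreg : ∀ᵐ p ∂couplingLaw, ∀ n, IsRegularPath fun q => negLog ((X n p).2 q) := by
    refine ae_all_iff.2 fun n => ?_
    refine (ae_map_iff (hXm n).aemeasurable hregset).1 ?_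
    rw [← hXlaw]
    exact (ae_map_iff ((hσs _).measurable_expCoords (hVs _)).aemeasurable hregset).2
      (hσs _).ae_isRegularPath
  have hYreg : ∀ᵐ p ∂couplingLaw, IsRegularPath fun q => negLog ((Y p).2 q) := by
    refine (ae_map_iff hYm.aemeasurable hregset).1 ?_
    rw [← hYlaw]
    exact (ae_map_iff (hσ.measurable_expCoords hV).aemeasurable hregset).2 hσ.ae_isRegularPath
  have hposset : MeasurableSet {p : ℝ × (ℚ≥0 → ℝ) | 0 < p.1 ∧ (∀ q, 0 < p.2 q) ∧
      ∀ q r : ℚ≥0, q < r → negLog (p.2 q) < negLog (p.2 r)} := by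
    have hq : ∀ q : ℚ≥0, Measurable fun p : ℝ × (ℚ≥0 → ℝ) => p.2 q := fun q =>
      (measurable_pi_apply q).comp measurable_snd
    have hr : ∀ q r : ℚ≥0, MeasurableSet {p : ℝ × (ℚ≥0 → ℝ) |
        q < r → negLog (p.2 q) < negLog (p.2 r)} := fun q r =>
      MeasurableSet.imp (MeasurableSet.const _)
        (measurableSet_lt (measurable_negLog.comp (hq q)) (measurable_negLog.comp (hq r)))
    have heq : {p : ℝ × (ℚ≥0 → ℝ) | 0 < p.1 ∧ (∀ q, 0 < p.2 q) ∧
        ∀ q r : ℚ≥0, q < r → negLog (p.2 q) < negLog (p.2 r)} =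
        {p | 0 < p.1} ∩ ((⋂ q, {p | 0 < p.2 q}) ∩
          ⋂ q, ⋂ r, {p | q < r → negLog (p.2 q) < negLog (p.2 r)}) := by
      ext p
      simp only [mem_inter_iff, mem_iInter, mem_ofPred_eq]
    rw [heq]
    exact (measurableSet_lt measurable_const measurable_fst).inter
      ((MeasurableSet.iInter fun q => measurableSet_lt measurable_const (hq q)).inter
        (MeasurableSet.iInter fun q => MeasurableSet.iInter fun r => hr q r))
  -- A jump profile may vanish, which would be an infinite jump. Positivity and strict monotonicity
  -- are therefore not read off the construction but inherited from the law of `σ` and `V`.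
  have hYpos : ∀ᵐ p ∂couplingLaw, 0 < (Y p).1 ∧ (∀ q, 0 < (Y p).2 q) ∧
      ∀ q r : ℚ≥0, q < r → negLog ((Y p).2 q) < negLog ((Y p).2 r) := by
    refine (ae_map_iff hYm.aemeasurable hposset).1 ?_
    rw [← hYlaw]
    refine (ae_map_iff (hσ.measurable_expCoords hV).aemeasurable hposset).2 ?_
    filter_upwards [hstrict] with ω hω
    refine ⟨Real.exp_pos _, fun q => Real.exp_pos _, fun q r hqr => ?_⟩
    simp only [expCoords, negLog_exp_neg]
    exact hω (by exact_mod_cast hqr)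
  have hQlim' : ∀ᵐ p ∂couplingLaw, Tendsto (fun n => Qs n p.1) atTop (𝓝 (Q p.1)) :=
    Measure.quasiMeasurePreserving_fst.ae hQlim
  have hae' : ∀ᵐ p ∂couplingLaw, ∀ T : ℕ, Tendsto (fun n => ⨆ q : ℚ≥0, ⨆ _ : (q : ℝ) ≤ T,
      ENNReal.ofReal |levyZ (ds (ψ n)) (ζs (ψ n)) q p.2 - levyZ d ζ q p.2|) atTop (𝓝 0) :=
    Measure.quasiMeasurePreserving_snd.ae hae
  refine ⟨ψ, ?_⟩
  rw [hYint]
  simp_rw [hXint]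
  refine tendsto_integral_of_dominated_convergence (fun _ => ‖f‖)
    (fun n => (hfm.comp (hXm n)).aestronglyMeasurable) (integrable_const _)
    (fun n => .of_forall fun p => f.norm_coe_le_norm _) ?_
  filter_upwards [hXreg, hYreg, hYpos, hQlim', hae'] with p h1 h2 h3 h4 h5
  refine (f.continuous.tendsto _).comp ?_
  refine tendsto_pathTriple t y h3.1 (h4.comp hφ₃.tendsto_atTop) h3.2.1
    (fun q r hqr => h3.2.2 q r hqr) ?_ h2 h1 h5
  exact fun q r hqr => hζ.levyZ_antitone hd p.2 (by exact_mod_cast hqr)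

/-- The limit integral is the same for all subsequences, so it is enough to extract a convergent one
from each; the extraction applies to any reindexed sequence. -/
theorem weaklyConverges_shiftedTriple
    (hσs : ∀ n, IsSubordinator (σs n) (P n)) (hσ : IsSubordinator σ P')
    (hstrict : ∀ᵐ ω ∂P', StrictMono fun s => σ s ω)
    (hVs : ∀ n, Measurable (Vs n)) (hV : Measurable V)
    (hinds : ∀ n, IndepFun (fun ω s => σs n s ω) (Vs n) (P n))
    (hind : IndepFun (fun ω s => σ s ω) V P')
    (hσlim : TendstoInDistribution (fun n => σs n 1) atTop (σ 1) P P')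
    (hVlim : TendstoInDistribution Vs atTop V P P') (t y : ℝ≥0) :
    WeaklyConverges (fun n ω => shiftedTriple t y (Vs n ω) fun s => σs n s ω) P
      (fun ω => shiftedTriple t y (V ω) fun s => σ s ω) P' where
  aemeasurable_seq n := (hσs n).aemeasurable_shiftedTriple (hVs n) t y
  aemeasurable_lim := hσ.aemeasurable_shiftedTriple hV t y
  tendsto_integral f hf := by
    refine tendsto_of_subseq_tendsto fun ns hns => ?_
    exact exists_subseq_tendsto_integral_shiftedTriple (P := fun n => P (ns n)) (P' := P')
      (fun n => hσs (ns n)) hσ hstrict (fun n => hVs (ns n)) hV (fun n => hinds (ns n)) hind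
      (fun k => (TendstoInDistribution.tendsto_integral_exp_neg hσlim k).comp hns)
      (fun k => (TendstoInDistribution.tendsto_integral_exp_neg hVlim k).comp hns) t y f hf

end Limit

theorem triple_eq_shiftedTriple (t y : ℝ≥0) (g : ℝ≥0 → ℝ≥0) :
    triple t y g = shiftedTriple t y 0 g := by
  have h : shiftedRange 0 g =
      (⟨closure (range g), isClosed_closure⟩ : TopologicalSpace.Closeds ℝ≥0) := by
    refine TopologicalSpace.Closeds.ext ?_
    change (fun r => 0 + r) '' closure (range g) = closure (range g)
    simp
  simp [triple, shiftedTriple, h]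

theorem proposition4
    {Ω : ℕ → Type*} [∀ n, MeasurableSpace (Ω n)]
    (P : (n : ℕ) → Measure (Ω n)) [∀ n, IsProbabilityMeasure (P n)]
    {Ω' : Type*} [MeasurableSpace Ω'] (P' : Measure Ω') [IsProbabilityMeasure P']
    (σs : (n : ℕ) → ℝ≥0 → Ω n → ℝ≥0) (Vs : (n : ℕ) → Ω n → ℝ≥0)
    (σ : ℝ≥0 → Ω' → ℝ≥0) (V : Ω' → ℝ≥0)
    (hσs : ∀ n, IsSubordinator (σs n) (P n)) (hσ : IsSubordinator σ P')
    (hσ_strict : ∀ᵐ ω ∂P', StrictMono (fun s => σ s ω))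
    (hVs : ∀ n, Measurable (Vs n)) (hV : Measurable V)
    (h_indep_seq : ∀ n, IndepFun (fun ω s => σs n s ω) (Vs n) (P n))
    (h_indep : IndepFun (fun ω s => σ s ω) V P')
    (hσ_tendsto : TendstoInDistribution (fun n => σs n 1) atTop (σ 1) P P')
    (hV_tendsto : TendstoInDistribution Vs atTop V P P')
    (t y : ℝ≥0) (ht : 0 < t) (hy : 0 < y) :
    WeaklyConverges
        (fun n ω => shiftedTriple t y (Vs n ω) (fun s => σs n s ω)) P
        (fun ω => shiftedTriple t y (V ω) (fun s => σ s ω)) P' ∧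
      WeaklyConverges
        (fun n ω => triple t y (fun s => σs n s ω)) P
        (fun ω => triple t y (fun s => σ s ω)) P' := by
  refine ⟨weaklyConverges_shiftedTriple hσs hσ hσ_strict hVs hV h_indep_seq h_indep hσ_tendsto
    hV_tendsto t y, ?_⟩
  simp_rw [triple_eq_shiftedTriple]
  -- The unshifted statement is the case of zero shifts, which are independent of everything and
  -- converge trivially.
  refine weaklyConverges_shiftedTriple (Vs := fun _ _ => 0) (V := fun _ => 0) hσs hσ hσ_strict
    (fun _ => measurable_const) measurable_const (fun n => ?_) ?_ hσ_tendsto ?_ t y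
  · exact indepFun_const_right _ 0
  · exact indepFun_const_right _ 0
  · refine ⟨fun n => aemeasurable_const, aemeasurable_const, ?_⟩
    simp only [Measure.map_const, measure_univ, one_smul]
    exact tendsto_const_nhds
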